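/- **Theorem (Energetic stability).** Setting. Let $d\ge 2$ and let $\alpha'\ge 0$, $k'\ge \alpha'+1$ be integers. Let $\hat\Omega=\prod_{i=1}^d(a_i,b_i)$, and let $\mathcal F:\overline{\hat\Omega}\to\mathbb R^d$ be an injective $C^{\alpha'+1}$ map with $\det D\mathcal F\neq 0$ on $\overline{\hat\Omega}$; put $\Omega=\mathcal F(\hat\Omega)$. For knot values $a_i=\zeta_{i,1}<\dots<\zeta_{i,n_i}=b_i$ let $\hat{\mathcal T}_h$ be the tensor-product mesh of $\hat\Omega$ with these knots and $\mathcal T_h=\mathcal F(\hat{\mathcal T}_h)$. Assume that $\mathcal F$ is $C^{\alpha'+2}$ on each closed element of $\hat{\mathcal T}_h$, and that for some $\kappa,h>0$ every $K=\mathcal F(\hat K)\in\mathcal T_h$ satisfies $\kappa h\le \operatorname{diam}K\le h/\kappa$, while any two side lengths $\ell,\ell'$ of $\hat K$ satisfy $\kappa\,\ell\le\ell'$. Let $\mathcal V_h$ be the divergence-conforming B-spline space: all fields $v$ on $\overline\Omega$ with $v\cdot n=0$ on $\partial\Omega$ and $v\circ\mathcal F=(\det D\mathcal F)^{-1}D\mathcal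 F\,\hat v$, where the $i$-th component of $\hat v$ is a tensor-product spline on $\hat{\mathcal T}_h$ of degree $k'+1$ and regularity $C^{\alpha'+1}$ in direction $i$, and of degree $k'$ and regularity $C^{\alpha'}$ in the other directions. Let $\mathring{\mathcal V}_h=\{v\in\mathcal V_h:\nabla\cdot v=0\}$. With $(\cdot,\cdot)$ and $\|\cdot\|$ the $L^2(\Omega)$ inner product and norm, viscosity $\nu>0$, Nitsche constant $C_{\rm Nit}$ and $(\nabla v)_{ij}=\partial_i v_j$, $\nabla^s v=\tfrac12(\nabla v+(\nabla v)^T)$, set $$\mathscr A_{\rm stb}(u,v)=(2\nu\nabla^su,\nabla^sv)-(2\nu\, n\cdot\nabla^su,v)_{\partial\Omega}-(2\nu\, n\cdot\nabla^sv,u)_{\partial\Omega}+\Big(2\nu\tfrac{C_{\rm Nit}}{h}u,v\Big)_{\partial\Omega}+J_h(u,v)-(u\otimes u,\nabla v),$$ $$J_h(u,v)=\sum_{e}\big(\eta\,[\![\partial_n^{\alpha'+1}u]\!],[\![\partial_n^{\alpha'+1}v]\!]\big)_e,$$ where $e$ runs over the interior mesh facets, $[\![\cdot]\!]$ is the jump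 across $e$, and $\eta=\eta(u;x,n)\ge 0$ is any stabilization parameter that is continuous in $(x,n)\in\overline\Omega\times\mathbb R^d$ whenever $u$ is continuous on $\overline\Omega$ (for example $\eta=\gamma\min\{|u|h/\nu,1\}\,h^{2\alpha'+2}|u\cdot n|$ with $\gamma\ge0$). Let $f(t)\in L^2(\Omega)^d$ for $t\in(0,T]$. A function $u_h$ solves the solenoidal semidiscrete problem (with homogeneous Dirichlet data) if $u_h(t)\in\mathring{\mathcal V}_h$ for all $t\in(0,T]$, $u_h$ is differentiable in time on $(0,T]$, and $$\Big(\frac{\partial u_h}{\partial t},v_h\Big)+\mathscr A_{\rm stb}(u_h,v_h)=(f,v_h)\qquad\text{for all }v_h\in\mathring{\mathcal V}_h,\ t\in(0,T].$$ Claim. There is a constant $C_0>0$, depending only on $d,k',\alpha',\mathcal F$ (with its domain $\hat\Omega$) and $\kappa$ (in particular not on the mesh, $h$, $\nu$, $\eta$, $T$, $f$ or $u_h$), such that if $C_{\rm Nit}\ge C_0$, then every solution $u_h$ of the solenoidal semidiscrete problem satisfies, for all $t\in(0,T]$ (with a one-sided derivative at $t=T$), $$\frac{d}{dt}\,\frac12\|u_h\|^2=-\mathscr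 A_{\rm stb}(u_h,u_h)+(f,u_h)\le (f,u_h).$$ Consequently, if $f(t)=0$ for all $t\in(0,T]$, or if $f$ is conservative, i.e. for every $t\in(0,T]$ there is $\Phi(t)\in H^1(\Omega)$ with $f(t)=\nabla\Phi(t)$, then the kinetic energy $\tfrac12\|u_h(t)\|^2$ is nonincreasing on $(0,T]$. -/

import Mathlib

open MeasureTheory Set Filter Topology
open scoped ContDiff

noncomputable section

namespace SkelStab

/-- Points and vectors of `ℝ^d`, `d = n + 1`. Only the topology, the Lebesgue measure and explicit
dot products are used on this type; Euclidean lengths are written through `euclNorm`. -/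
abbrev Pt (n : ℕ) : Type := Fin (n + 1) → ℝ

/-- Euclidean length `|v|`. -/
def euclNorm {n : ℕ} (v : Pt n) : ℝ := Real.sqrt (v ⬝ᵥ v)

/-- Tensor contraction `C : D = ∑ C_ij D_ij`. -/
def contract {n : ℕ} (C D : Matrix (Fin (n + 1)) (Fin (n + 1)) ℝ) : ℝ :=
  ∑ i, ∑ j, C i j * D i j

/-! ### Parametric domain, mesh and spline spaces -/

/-- The open parametric box `Ω̂ = ∏ (a_i, b_i)`. -/
def paramDomain {n : ℕ} (a b : Pt n) : Set (Pt n) := Set.univ.pi fun i => Ioo (a i) (b i)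

/-- A tensor product mesh of the box `[a, b]`: in direction `i` the unique knot values
`a_i = ζ_{i,0} < … < ζ_{i,N_i} = b_i`. -/
structure ParamMesh {n : ℕ} (a b : Pt n) where
  /-- number of elements in each direction -/
  N : Fin (n + 1) → ℕ
  N_pos : ∀ i, 0 < N i
  /-- unique knot values in each direction -/
  knot : ∀ i, Fin (N i + 1) → ℝ
  knot_strictMono : ∀ i, StrictMono (knot i)
  knot_first : ∀ i, knot i 0 = a i
  knot_last : ∀ i, knot i (Fin.last (N i)) = b i

namespace ParamMesh

variable {n : ℕ} {a b : Pt n} (M : ParamMesh a b)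

/-- Indices of the elements. -/
abbrev Elem : Type := ∀ i, Fin (M.N i)

/-- Lower corner of an element. -/
def lo (J : M.Elem) : Pt n := fun i => M.knot i (J i).castSucc

/-- Upper corner of an element. -/
def hi (J : M.Elem) : Pt n := fun i => M.knot i (J i).succ

/-- The closed parametric element. -/
def closedElem (J : M.Elem) : Set (Pt n) := Icc (M.lo J) (M.hi J)

/-- The open parametric element. -/
def openElem (J : M.Elem) : Set (Pt n) := paramDomain (M.lo J) (M.hi J)

/-- `h_K`: the Euclidean diameter of the physical element `K = F(K̂)`. -/
def elemDiam (F : Pt n → Pt n) (J : M.Elem) : ℝ :=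
  Metric.diam
    ((WithLp.toLp 2 : Pt n → EuclideanSpace ℝ (Fin (n + 1))) '' (F '' M.closedElem J))

/-- The physical mesh is quasi-uniform with global mesh size `h` and constant `κ`
(`κ h ≤ h_K ≤ h / κ`), and the parametric elements are shape regular with the same constant. -/
structure IsQuasiUniform (F : Pt n → Pt n) (κ h : ℝ) : Prop where
  h_pos : 0 < h
  diam_lower : ∀ J : M.Elem, κ * h ≤ M.elemDiam F J
  diam_upper : ∀ J : M.Elem, M.elemDiam F J ≤ h / κ
  shape : ∀ (J : M.Elem) (i l : Fin (n + 1)), κ * (M.hi J i - M.lo J i) ≤ M.hi J l - M.lo J l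

end ParamMesh

/-- Univariate splines of degree `p` with `r` continuous derivatives on the breakpoints `ζ`: the
span of the B-splines of degree `p` over the open knot vector in which every internal breakpoint is
repeated `p - r` times. -/
def univariateSplines (p r : ℕ) {m : ℕ} (ζ : Fin (m + 1) → ℝ) : Set (ℝ → ℝ) :=
  {s | ContDiffOn ℝ (r : ℕ∞) s (Icc (ζ 0) (ζ (Fin.last m))) ∧
    ∀ j : Fin m, ∃ P : Polynomial ℝ, P.natDegree ≤ p ∧
      ∀ x ∈ Icc (ζ j.castSucc) (ζ j.succ), s x = P.eval x}

/-- Tensor product splines `B^{p_1,…,p_d}_{r_1,…,r_d}`: the span of the products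
`x ↦ ∏ s_l(x_l)` of univariate splines. Only the values on the box `[a, b]` matter. -/
def tensorSplines {n : ℕ} {a b : Pt n} (M : ParamMesh a b) (p r : Fin (n + 1) → ℕ) :
    Submodule ℝ (Pt n → ℝ) :=
  Submodule.span ℝ {g | ∃ s : Fin (n + 1) → ℝ → ℝ,
    (∀ l, s l ∈ univariateSplines (p l) (r l) (M.knot l)) ∧ g = fun x => ∏ l, s l (x l)}

/-! ### The geometric mapping -/

section Geometry

variable {n : ℕ} (a b : Pt n) (F : Pt n → Pt n)

/-- The Jacobian matrix `DF` on the closed box. -/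
def jac (x : Pt n) : Matrix (Fin (n + 1)) (Fin (n + 1)) ℝ :=
  LinearMap.toMatrix' (fderivWithin ℝ F (Icc a b) x : Pt n →ₗ[ℝ] Pt n)

/-- `F` is a regular `C^{α+1}` parametrization defined on the closed box `[a, b]`. -/
structure IsParametrization (α : ℕ) : Prop where
  contDiffOn : ContDiffOn ℝ ((α + 1 : ℕ) : ℕ∞) F (Icc a b)
  injOn : InjOn F (Icc a b)
  det_ne_zero : ∀ x ∈ Icc a b, (jac a b F x).det ≠ 0

/-- The physical domain `Ω = F(Ω̂)`. -/
def domain : Set (Pt n) := F '' paramDomain a b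

/-- The closure of the physical domain. -/
def closedDomain : Set (Pt n) := F '' Icc a b

/-- `DF⁻ᵀ e_i`, a normal vector to the image of `{x_i = const}`, pointing towards increasing
`x_i`. -/
def conormal (i : Fin (n + 1)) (x : Pt n) : Pt n := (jac a b F x)⁻¹ i

/-- The unit normal to the image of `{x_i = const}` at `F x`, pointing towards increasing `x_i`. -/
def unitNormal (i : Fin (n + 1)) (x : Pt n) : Pt n :=
  (euclNorm (conormal a b F i x))⁻¹ • conormal a b F i x

/-- The surface area density of `F` restricted to `{x_i = const}`: `|det DF| |DF⁻ᵀ e_i|`. -/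
def areaDensity (i : Fin (n + 1)) (x : Pt n) : ℝ :=
  |(jac a b F x).det| * euclNorm (conormal a b F i x)

/-- The surface integral of `y ↦ g y n(y)` over the image under `F` of the flat facet
`{x_i = c, lo ≤ x' ≤ hi}`, where `n` is the unit normal multiplied by the sign `σ`. -/
def facetIntegral (i : Fin (n + 1)) (c σ : ℝ) (lo hi : Fin n → ℝ) (g : Pt n → Pt n → ℝ) : ℝ :=
  ∫ y in Icc lo hi,
    g (F (i.insertNth c y)) (σ • unitNormal a b F i (i.insertNth c y)) *
      areaDensity a b F i (i.insertNth c y)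

/-- The surface integral of `y ↦ g y n(y)` over `∂Ω`, with `n` the outward unit normal. -/
def boundaryIntegral (g : Pt n → Pt n → ℝ) : ℝ :=
  ∑ i : Fin (n + 1),
    (facetIntegral a b F i (b i) 1 (fun l => a (i.succAbove l)) (fun l => b (i.succAbove l)) g +
      facetIntegral a b F i (a i) (-1) (fun l => a (i.succAbove l))
        (fun l => b (i.succAbove l)) g)

/-- The sum over all interior facets `e` of the surface integrals of `y ↦ g y n(y)` over `e`. The
interior facets are the upper facets, in each direction `i`, of the elements that have a further
element above them in that direction; the lower element is the positive one. -/
def skeletonIntegral (M : ParamMesh a b) (g : Pt n → Pt n → ℝ) : ℝ :=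
  ∑ J : M.Elem, ∑ i : Fin (n + 1),
    if (J i : ℕ) + 1 < M.N i then
      facetIntegral a b F i (M.hi J i) 1 (fun l => M.lo J (i.succAbove l))
        (fun l => M.hi J (i.succAbove l)) g
    else 0

/-! ### Differential operators and the discrete spaces -/

/-- The gradient `(∇v)_ij = ∂_i v_j`. It is the ordinary derivative in `Ω`, and the derivative from
inside `Ω` on `∂Ω`. -/
def grad (v : Pt n → Pt n) (x : Pt n) : Matrix (Fin (n + 1)) (Fin (n + 1)) ℝ :=
  Matrix.of fun i j => fderivWithin ℝ v (closedDomain a b F) x (Pi.single i 1) j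

/-- The symmetric gradient `∇ˢv`. -/
def symGrad (v : Pt n → Pt n) (x : Pt n) : Matrix (Fin (n + 1)) (Fin (n + 1)) ℝ :=
  (1 / 2 : ℝ) • (grad a b F v x + (grad a b F v x).transpose)

/-- The divergence. -/
def divergence (v : Pt n → Pt n) (x : Pt n) : ℝ := (grad a b F v x).trace

/-- The divergence-conforming B-spline velocity space `V_h` of degree `k` and continuity `α`, with
no flow through `∂Ω`: Piola transforms `v(F x) = (det DF)⁻¹ DF w(x)` of fields `w` whose `i`-th
component is a spline of degree `k + 1` and regularity `α + 1` in direction `i`, and of degree `k`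
and regularity `α` in the other directions. Functions in `V_h` are considered on the closure of
`Ω` only. -/
def velocitySpace (k α : ℕ) (M : ParamMesh a b) : Set (Pt n → Pt n) :=
  {v | (∃ w : Pt n → Pt n,
      (∀ i, (fun x => w x i) ∈ tensorSplines M (fun l => if l = i then k + 1 else k)
        (fun l => if l = i then α + 1 else α)) ∧
      ∀ x ∈ Icc a b, v (F x) = (jac a b F x).det⁻¹ • (jac a b F x).mulVec (w x)) ∧
    ∀ i, ∀ x ∈ Icc a b, (x i = a i ∨ x i = b i) → v (F x) ⬝ᵥ unitNormal a b F i x = 0}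

/-- The solenoidal subset of `V_h`. -/
def solenoidalSpace (k α : ℕ) (M : ParamMesh a b) : Set (Pt n → Pt n) :=
  {v | v ∈ velocitySpace a b F k α M ∧
    ∀ J : M.Elem, ∀ x ∈ M.openElem J, divergence a b F v (F x) = 0}

/-! ### Variational forms -/

/-- The `L²(Ω)` inner product of vector fields. -/
def l2Inner (u v : Pt n → Pt n) : ℝ := ∫ x in domain a b F, u x ⬝ᵥ v x

/-- The kinetic energy `½ ‖u‖²`. -/
def energy (u : Pt n → Pt n) : ℝ := (1 / 2) * l2Inner a b F u u

/-- Viscous form `A(u,v) = (2ν ∇ˢu, ∇ˢv)`. -/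
def viscousForm (ν : ℝ) (u v : Pt n → Pt n) : ℝ :=
  ∫ x in domain a b F, 2 * ν * contract (symGrad a b F u x) (symGrad a b F v x)

/-- Convective form `C(w;u,v) = -(w ⊗ u, ∇v)`. -/
def convectiveForm (w u v : Pt n → Pt n) : ℝ :=
  -∫ x in domain a b F, contract (Matrix.vecMulVec (w x) (u x)) (grad a b F v x)

end Geometry

section Stabilization

variable {n : ℕ}

/-- The `m`-th normal derivative `∂_n^m v` at `y`, for a fixed direction `ν`. -/
def normalDeriv (m : ℕ) (v : Pt n → Pt n) (ν : Pt n) (y : Pt n) : Pt n :=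
  iteratedFDeriv ℝ m v y fun _ => ν

/-- The jump `φ⁺ - φ⁻` of `φ = ∂_n^m v` at the point `y` of a facet with unit normal `ν`, where
`φ⁺(y) = lim φ(y - ε ν)` and `φ⁻(y) = lim φ(y + ε ν)` as `ε → 0⁺`. -/
def jumpNormalDeriv (m : ℕ) (v : Pt n → Pt n) (y ν : Pt n) : Pt n :=
  limUnder (𝓝[>] (0 : ℝ)) (fun ε => normalDeriv m v ν (y - ε • ν)) -
    limUnder (𝓝[>] (0 : ℝ)) (fun ε => normalDeriv m v ν (y + ε • ν))

/-- Admissible stabilization parameters on the closed domain `S`. The number `η u y ν` is the value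
at the point `y` of a facet with unit normal `ν`, for the velocity field `u`. -/
structure IsStabParam (S : Set (Pt n)) (η : (Pt n → Pt n) → Pt n → Pt n → ℝ) : Prop where
  nonneg : ∀ u y ν, 0 ≤ η u y ν
  continuousOn : ∀ u, ContinuousOn u S →
    ContinuousOn (fun q : Pt n × Pt n => η u q.1 q.2) (S ×ˢ Set.univ)

/-- The parameter `η = γ min(Re_h, 1) h^{2α+2} |u · n|`, with `Re_h = |u| h / visc`. -/
def reynoldsStabParam (γ visc h : ℝ) (α : ℕ) (u : Pt n → Pt n) (y ν : Pt n) : ℝ :=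
  γ * min (euclNorm (u y) * h / visc) 1 * h ^ (2 * α + 2) * |u y ⬝ᵥ ν|

/-- The parameter based on the element Reynolds number is admissible. -/
theorem isStabParam_reynoldsStabParam (S : Set (Pt n)) {γ visc h : ℝ} (hγ : 0 ≤ γ)
    (hv : 0 < visc) (hh : 0 < h) (α : ℕ) : IsStabParam S (reynoldsStabParam γ visc h α) where
  nonneg u y ν := by
    have h1 : 0 ≤ euclNorm (u y) * h / visc :=
      div_nonneg (mul_nonneg (Real.sqrt_nonneg _) hh.le) hv.le
    have h2 : 0 ≤ min (euclNorm (u y) * h / visc) 1 := le_min h1 zero_le_one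
    unfold reynoldsStabParam
    positivity
  continuousOn u hu := by
    have hc : ContinuousOn (fun q : Pt n × Pt n => u q.1) (S ×ˢ Set.univ) :=
      hu.comp continuous_fst.continuousOn (fun q hq => hq.1)
    have hd : ∀ f g : Pt n × Pt n → Pt n, ContinuousOn f (S ×ˢ Set.univ) →
        ContinuousOn g (S ×ˢ Set.univ) →
        ContinuousOn (fun q => f q ⬝ᵥ g q) (S ×ˢ Set.univ) := by
      intro f g hf hg
      unfold dotProduct
      exact continuousOn_finsetSum _ fun i _ =>
        ((continuous_apply i).comp_continuousOn hf).mul ((continuous_apply i).comp_continuousOn hg)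
    unfold reynoldsStabParam euclNorm
    have h1 := hd _ _ hc hc
    have h2 := hd _ _ hc continuous_snd.continuousOn
    exact ((continuousOn_const.mul ((((h1.sqrt).mul continuousOn_const).div_const _).inf
      continuousOn_const)).mul continuousOn_const).mul h2.abs

end Stabilization

section Problem

variable {n : ℕ} (a b : Pt n) (F : Pt n → Pt n)

/-- The skeleton stabilization form
`J_h(u,v) = ∑_e (η [[∂_n^{α+1} u]], [[∂_n^{α+1} v]])_e`, with `η` evaluated at `u`. -/
def skeletonForm (M : ParamMesh a b) (α : ℕ) (η : (Pt n → Pt n) → Pt n → Pt n → ℝ)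
    (u v : Pt n → Pt n) : ℝ :=
  skeletonIntegral a b F M fun y ν =>
    η u y ν * (jumpNormalDeriv (α + 1) u y ν ⬝ᵥ jumpNormalDeriv (α + 1) v y ν)

/-- `A_h(u,v) = A(u,v) - (2ν n·∇ˢu, v)_∂Ω - (2ν n·∇ˢv, u)_∂Ω + (2ν (C_Nit/h) u, v)_∂Ω + J_h(u,v)`. -/
def nitscheForm (M : ParamMesh a b) (α : ℕ) (η : (Pt n → Pt n) → Pt n → Pt n → ℝ)
    (ν CNit h : ℝ) (u v : Pt n → Pt n) : ℝ :=
  viscousForm a b F ν u v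
    - boundaryIntegral a b F
        (fun y nrm => (2 * ν) * ((symGrad a b F u y).vecMul nrm ⬝ᵥ v y))
    - boundaryIntegral a b F
        (fun y nrm => (2 * ν) * ((symGrad a b F v y).vecMul nrm ⬝ᵥ u y))
    + boundaryIntegral a b F (fun y _ => 2 * ν * (CNit / h) * (u y ⬝ᵥ v y))
    + skeletonForm a b F M α η u v

/-- `A_stb(u,v) = A_h(u,v) + C(u;u,v)`. -/
def stabForm (M : ParamMesh a b) (α : ℕ) (η : (Pt n → Pt n) → Pt n → Pt n → ℝ)
    (ν CNit h : ℝ) (u v : Pt n → Pt n) : ℝ :=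
  nitscheForm a b F M α η ν CNit h u v + convectiveForm a b F u u v

/-- The time derivative `∂u/∂t` on the time interval `(0, T]`. -/
def timeDeriv (T : ℝ) (u : ℝ → Pt n → Pt n) (t : ℝ) (x : Pt n) : Pt n :=
  derivWithin (fun s => u s x) (Ioc 0 T) t

/-- `u` solves the solenoidal semidiscrete problem on `(0, T]` with homogeneous Dirichlet data and
body force `f`. -/
structure IsSemidiscreteSolution (k α : ℕ) (M : ParamMesh a b)
    (η : (Pt n → Pt n) → Pt n → Pt n → ℝ) (ν CNit h T : ℝ) (f u : ℝ → Pt n → Pt n) : Prop where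
  mem : ∀ t ∈ Ioc 0 T, u t ∈ solenoidalSpace a b F k α M
  differentiable : ∀ t ∈ Ioc 0 T, ∀ x ∈ domain a b F,
    DifferentiableWithinAt ℝ (fun s => u s x) (Ioc 0 T) t
  equation : ∀ t ∈ Ioc 0 T, ∀ v ∈ solenoidalSpace a b F k α M,
    l2Inner a b F (timeDeriv T u t) v + stabForm a b F M α η ν CNit h (u t) v
      = l2Inner a b F (f t) v

/-- `g = ∇Φ` weakly in `Ω` for a potential `Φ ∈ H¹(Ω)` (here `g` is assumed to be in `L²`
elsewhere, so `Φ ∈ L²(Ω)` is what remains to be required). -/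
def IsConservative (Ω : Set (Pt n)) (g : Pt n → Pt n) : Prop :=
  ∃ Φ : Pt n → ℝ, MemLp Φ 2 (volume.restrict Ω) ∧
    ∀ φ : Pt n → ℝ, ContDiff ℝ ∞ φ → HasCompactSupport φ → tsupport φ ⊆ Ω →
      ∀ i, ∫ x in Ω, Φ x * fderiv ℝ φ x (Pi.single i 1) = -∫ x in Ω, g x i * φ x

end Problem

end SkelStab

end

noncomputable section

namespace SkelStab

/-! ### One-dimensional inequalities -/

/-! Testing the equation with `u t` itself gives the energy identity, so everything rests on
nonnegativity of the stabilized form on the diagonal. The skeleton term is a sum of integrals of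
nonnegative functions. The convective term vanishes: the Piola transform turns `div u = 0` and `u ·
n = 0` into the same properties of the parametric spline field `w`, and integrating `w · ∇|u ∘ F|²`
along coordinate lines gives zero (`det_mul_divergence`, `convectiveForm_self_eq_zero`). What
remains is coercivity of the Nitsche form with a penalty that does not see the mesh.

By Young's inequality this reduces to the discrete trace bound `h ‖∇u‖²_∂Ω ≤ C (‖∇ˢu‖²_Ω + h⁻¹
‖u‖²_∂Ω)`, which is `exists_faceSum_gradDensity_le`. It hides a Korn inequality with boundary
values. Only the elementary Korn inequality for compactly supported Lipschitz fields is used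
(`integral_sq_lineDeriv_le`): the field is cut off in a boundary layer of width `δ = θ r`, where `r`
bounds the parametric element sides from below. The errors live in the layer. There `|u|²/δ²` is
handled by a Poincaré inequality from the boundary (`slabSum_normDensity_le`), and the derivatives
by an inverse inequality along coordinate lines, which says that a layer of width `θ r` carries only
a fraction of order `θ` of the total (`exists_line_inverse_ineq`, `slabSum_le`). A small `θ` lets
this fraction be absorbed (`absorb_le`).

The Piola field `u` is not piecewise polynomial, so the inverse inequality is applied to `w`; the
densities of `u` and `w` are comparable pointwise (`IsDiscreteField.pullDensity_le`,
`IsDiscreteField.sobolevDensity_le`). The constants come from `GeomBound`, a property of `F` on the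
box that mentions no mesh.

Two further points need care. Differentiability in time is assumed only pointwise in space; since
the discrete fields lie in a finite-dimensional space, whose dual is spanned by evaluations, the
energy is differentiable too (`hasDerivWithinAt_energy`). For conservative forces, `(∇Φ, u) = 0` is
proved for a weak gradient by approximating `u` with mollified, cut-off fields whose divergences
stay bounded and tend to zero pointwise; boundedness uses `u · n = 0`
(`l2Inner_eq_zero_of_isConservative`). -/

theorem exists_sq_eval_le_integral_unit (m : ℕ) : ∃ C : ℝ, 0 < C ∧ ∀ P : Polynomial ℝ,
    P.natDegree ≤ m → ∀ x ∈ Icc (0 : ℝ) 1, P.eval x ^ 2 ≤ C * ∫ t in (0 : ℝ)..1, P.eval t ^ 2 := by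
  let ev : (Fin (m + 1) → ℝ) → ℝ → ℝ := fun c t => ∑ j : Fin (m + 1), c j * t ^ (j : ℕ)
  let Q : (Fin (m + 1) → ℝ) → ℝ := fun c => ∫ t in (0 : ℝ)..1, ev c t ^ 2
  have hQc : Continuous Q := by
    apply intervalIntegral.continuous_parametric_intervalIntegral_of_continuous'
    change Continuous fun p : (Fin (m + 1) → ℝ) × ℝ => ev p.1 p.2 ^ 2
    fun_prop
  have hQpos : ∀ c, c ≠ 0 → 0 < Q c := by
    intro c hc
    let P : Polynomial ℝ := ∑ j : Fin (m + 1), Polynomial.C (c j) * Polynomial.X ^ (j : ℕ)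
    have hP : ∀ t, P.eval t = ev c t := fun t => by simp [P, ev, Polynomial.eval_finsetSum]
    have hP0 : P ≠ 0 := by
      intro h
      apply hc
      funext j
      have := congrArg (fun p => Polynomial.coeff p (j : ℕ)) h
      simpa [P, Polynomial.finsetSum_coeff, Polynomial.coeff_X_pow, Fin.val_inj] using this
    obtain ⟨x, hx, hxr⟩ : ∃ x ∈ Icc (0 : ℝ) 1, P.eval x ≠ 0 := by
      by_contra! hcon
      exact hP0 (Polynomial.eq_zero_of_infinite_isRoot P
        ((Icc_infinite (zero_lt_one (α := ℝ))).mono fun x hx => hcon x hx))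
    refine intervalIntegral.integral_pos zero_lt_one ?_ (fun t _ => sq_nonneg _) ⟨x, hx, ?_⟩
    · exact Continuous.continuousOn (by fun_prop)
    · rw [hP] at hxr
      positivity
  -- `Q` is a positive definite quadratic form in the coefficients, so by compactness it has a
  -- positive minimum on the unit sphere. By homogeneity this minimum bounds the coefficient norm by
  -- the `L²` norm, and on `[0, 1]` the coefficients bound the values.
  obtain ⟨c₀, hc₀, hmin⟩ := (isCompact_sphere (0 : Fin (m + 1) → ℝ) 1).exists_isMinOn
    (NormedSpace.sphere_nonempty.2 zero_le_one) hQc.continuousOn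
  have hμ : 0 < Q c₀ := hQpos c₀ (by rintro rfl; simp at hc₀)
  refine ⟨(m + 1) ^ 2 / Q c₀, by positivity, fun P hP x hx => ?_⟩
  let c : Fin (m + 1) → ℝ := fun j => P.coeff j
  have hev : ∀ t, P.eval t = ev c t := fun t => by
    rw [Polynomial.eval_eq_sum_range' (Nat.lt_succ_of_le hP), Finset.sum_range]
  have h1 : |P.eval x| ≤ (m + 1) * ‖c‖ := by
    rw [hev]
    calc |ev c x| ≤ ∑ j : Fin (m + 1), |c j * x ^ (j : ℕ)| := Finset.abs_sum_le_sum_abs _ _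
      _ ≤ ∑ _j : Fin (m + 1), ‖c‖ := by
        refine Finset.sum_le_sum fun j _ => ?_
        rw [abs_mul, abs_of_nonneg (pow_nonneg hx.1 _)]
        calc |c j| * x ^ (j : ℕ) ≤ |c j| * 1 :=
              mul_le_mul_of_nonneg_left (pow_le_one₀ hx.1 hx.2) (abs_nonneg _)
          _ ≤ ‖c‖ := by rw [mul_one]; exact norm_le_pi_norm c j
      _ = (m + 1) * ‖c‖ := by simp
  have h2 : Q c₀ * ‖c‖ ^ 2 ≤ ∫ t in (0 : ℝ)..1, P.eval t ^ 2 := by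
    simp only [hev]
    change _ ≤ Q c
    by_cases hc : c = 0
    · rw [hc]; simp only [norm_zero]
      refine le_trans (by simp) (intervalIntegral.integral_nonneg zero_le_one fun t _ => sq_nonneg _)
    · have hn : 0 < ‖c‖ := norm_pos_iff.2 hc
      have hs : ‖c‖⁻¹ • c ∈ Metric.sphere (0 : Fin (m + 1) → ℝ) 1 := by
        simp [norm_smul, hn.ne']
      have := hmin hs
      have hQs : Q (‖c‖⁻¹ • c) = (‖c‖⁻¹) ^ 2 * Q c := by
        simp only [Q]
        rw [← intervalIntegral.integral_const_mul]
        congr 1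
        funext t
        simp only [ev, Pi.smul_apply, smul_eq_mul, mul_assoc, ← Finset.mul_sum]
        ring
      simp only [mem_ofPred_eq] at this
      rw [hQs] at this
      calc Q c₀ * ‖c‖ ^ 2 ≤ ((‖c‖⁻¹) ^ 2 * Q c) * ‖c‖ ^ 2 := by gcongr
        _ = Q c := by field_simp
  calc P.eval x ^ 2 = |P.eval x| ^ 2 := (sq_abs _).symm
    _ ≤ ((m + 1) * ‖c‖) ^ 2 := by gcongr
    _ = (m + 1) ^ 2 / Q c₀ * (Q c₀ * ‖c‖ ^ 2) := by field_simp
    _ ≤ _ := by gcongr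

/-- Inverse inequality for univariate polynomials. -/
theorem exists_sq_eval_le_integral (m : ℕ) : ∃ C : ℝ, 0 < C ∧ ∀ P : Polynomial ℝ,
    P.natDegree ≤ m → ∀ s t : ℝ, s < t → ∀ x ∈ Icc s t,
      P.eval x ^ 2 ≤ C / (t - s) * ∫ r in s..t, P.eval r ^ 2 := by
  obtain ⟨C, hC, h⟩ := exists_sq_eval_le_integral_unit m
  refine ⟨C, hC, fun P hP s t hst x hx => ?_⟩
  have hl : 0 < t - s := sub_pos.2 hst
  let R : Polynomial ℝ := P.comp (Polynomial.C s + Polynomial.C (t - s) * Polynomial.X)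
  have hR : ∀ y, R.eval y = P.eval (s + (t - s) * y) := fun y => by simp [R]
  have hRd : R.natDegree ≤ m := by
    refine Polynomial.natDegree_comp_le.trans ?_
    have : (Polynomial.C s + Polynomial.C (t - s) * Polynomial.X).natDegree ≤ 1 := by
      compute_degree
    calc _ ≤ P.natDegree * 1 := Nat.mul_le_mul_left _ this
      _ ≤ m := by simpa using hP
  have h1 := h R hRd ((x - s) / (t - s)) ⟨div_nonneg (sub_nonneg.2 hx.1) hl.le,
    (div_le_one hl).2 (sub_le_sub_right hx.2 _)⟩
  simp only [hR] at h1
  rw [intervalIntegral.integral_comp_add_mul (fun y => P.eval y ^ 2) hl.ne' s] at h1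
  rw [mul_div_cancel₀ _ hl.ne'] at h1
  simp only [add_sub_cancel, mul_zero, add_zero, mul_one, smul_eq_mul] at h1
  calc P.eval x ^ 2 ≤ _ := h1
    _ = _ := by rw [div_eq_mul_inv]; ring

/-- Cauchy–Schwarz against the constant function. The quadratic polynomial `λ ↦ ∫ (λ - |f|)²` is
nonnegative, so its discriminant is nonpositive. -/
theorem sq_intervalIntegral_le {f : ℝ → ℝ} {s t x y : ℝ} (hx : x ∈ Icc s t) (hy : y ∈ Icc s t)
    (hf : IntervalIntegrable f volume s t) (hf2 : IntervalIntegrable (fun r => f r ^ 2) volume s t) :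
    (∫ r in x..y, f r) ^ 2 ≤ (t - s) * ∫ r in s..t, f r ^ 2 := by
  have hst : s ≤ t := hx.1.trans hx.2
  have h1 : |∫ r in x..y, f r| ≤ ∫ r in s..t, |f r| := by
    refine (intervalIntegral.norm_integral_le_integral_norm_uIoc (f := f)).trans ?_
    rw [intervalIntegral.integral_of_le hst]
    refine setIntegral_mono_set ?_ (ae_of_all _ fun _ => norm_nonneg _) ?_
    · exact ((intervalIntegrable_iff_integrableOn_Ioc_of_le hst).1 hf).norm
    · refine LE.le.eventuallyLE fun r hr => ?_
      rw [uIoc, mem_Ioc] at hr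
      exact ⟨(le_min hx.1 hy.1).trans_lt hr.1, hr.2.trans (max_le hx.2 hy.2)⟩
  set I := ∫ r in s..t, |f r| with hI
  set Q := ∫ r in s..t, f r ^ 2 with hQ
  have hI0 : 0 ≤ I := intervalIntegral.integral_nonneg hst fun _ _ => abs_nonneg _
  have hexp : ∀ lam : ℝ, 0 ≤ (t - s) * lam ^ 2 - 2 * lam * I + Q := by
    intro lam
    have : ∫ r in s..t, (lam - |f r|) ^ 2 = (t - s) * lam ^ 2 - 2 * lam * I + Q := by
      have e : ∀ r, (lam - |f r|) ^ 2 = (lam ^ 2 - 2 * lam * |f r|) + f r ^ 2 := fun r => by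
        rw [sub_sq, sq_abs]
      simp only [e]
      rw [intervalIntegral.integral_add _ hf2, intervalIntegral.integral_sub _ (hf.abs.const_mul _),
        intervalIntegral.integral_const_mul, intervalIntegral.integral_const, smul_eq_mul]
      · exact intervalIntegrable_const
      · exact intervalIntegrable_const.sub (hf.abs.const_mul _)
    rw [← this]
    exact intervalIntegral.integral_nonneg hst fun _ _ => sq_nonneg _
  have h2 : I ^ 2 ≤ (t - s) * Q := by
    have := discrim_le_zero (a := t - s) (b := -2 * I) (c := Q) fun x => by
      have := hexp x; linarith [this]
    rw [discrim] at this
    linarith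
  calc (∫ r in x..y, f r) ^ 2 = |∫ r in x..y, f r| ^ 2 := (sq_abs _).symm
    _ ≤ I ^ 2 := by gcongr
    _ ≤ _ := h2

/-- The one-dimensional source of the Poincaré inequalities: `y` is later a boundary point and `S`
the set of internal knots, where the derivative of a continuous piecewise smooth function may jump.
-/
theorem sq_le_of_hasDerivAt_off_countable {g g' : ℝ → ℝ} {s t x y : ℝ} {S : Set ℝ}
    (hS : S.Countable) (hx : x ∈ Icc s t) (hy : y ∈ Icc s t) (hg : ContinuousOn g (Icc s t))
    (hd : ∀ r ∈ Ioo s t \ S, HasDerivAt g (g' r) r) (hi : IntervalIntegrable g' volume s t)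
    (hi2 : IntervalIntegrable (fun r => g' r ^ 2) volume s t) :
    g x ^ 2 ≤ 2 * g y ^ 2 + 2 * (t - s) * ∫ r in s..t, g' r ^ 2 := by
  have hsub : uIcc y x ⊆ Icc s t := by
    intro r hr
    rw [uIcc, mem_Icc] at hr
    exact ⟨(le_inf hy.1 hx.1).trans hr.1, hr.2.trans (sup_le hy.2 hx.2)⟩
  have hftc : ∫ r in y..x, g' r = g x - g y := by
    refine MeasureTheory.integral_eq_of_hasDerivAt_off_countable g g' hS (hg.mono hsub)
      (fun r hr => hd r ⟨⟨?_, ?_⟩, hr.2⟩) (hi.mono_set ?_)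
    · exact (le_min hy.1 hx.1).trans_lt hr.1.1
    · exact hr.1.2.trans_le (max_le hy.2 hx.2)
    · rw [uIcc_of_le (hx.1.trans hx.2)]; exact hsub
  have h1 := sq_intervalIntegral_le hy hx hi hi2
  rw [hftc] at h1
  -- The square supplied is exactly `2 (g x - g y)² + 2 (g y)² - (g x)²`.
  nlinarith [sq_nonneg (g x - 2 * g y)]

/-! ### Integration over boxes along coordinate lines -/

/-- Fubini for the splitting of the box into coordinate direction `i` and the remaining ones. The
integrability statements are returned as well, since later estimates compare the inner integrals. -/
theorem integral_Icc_eq_integral_lines {n : ℕ} (i : Fin (n + 1)) (a b : Pt n) (g : Pt n → ℝ)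
    (hg : IntegrableOn g (Icc a b)) :
    IntegrableOn (fun y : Fin n → ℝ => ∫ t in Icc (a i) (b i), g (i.insertNth t y))
        (Icc (fun l => a (i.succAbove l)) fun l => b (i.succAbove l)) ∧
      (∀ᵐ y ∂(volume.restrict (Icc (fun l => a (i.succAbove l)) fun l => b (i.succAbove l))),
        IntegrableOn (fun t => g (i.insertNth t y)) (Icc (a i) (b i))) ∧
      ∫ x in Icc a b, g x = ∫ y in Icc (fun l => a (i.succAbove l)) fun l => b (i.succAbove l),
        ∫ t in Icc (a i) (b i), g (i.insertNth t y) := by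
  let e := MeasurableEquiv.piFinSuccAbove (fun _ : Fin (n + 1) => ℝ) i
  have he : MeasurePreserving e.symm :=
    (volume_preserving_piFinSuccAbove (fun _ : Fin (n + 1) => ℝ) i).symm
  have hpre : e.symm ⁻¹' Icc a b = Icc (a i) (b i) ×ˢ
      Icc (fun l => a (i.succAbove l)) fun l => b (i.succAbove l) := by
    ext ⟨t, y⟩
    simp only [e, MeasurableEquiv.piFinSuccAbove, mem_preimage, mem_Icc, mem_prod, Pi.le_def]
    change (∀ l, a l ≤ i.insertNth (α := fun _ => ℝ) t y l) ∧
      (∀ l, i.insertNth (α := fun _ => ℝ) t y l ≤ b l) ↔ _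
    rw [Fin.forall_iff_succAbove i, Fin.forall_iff_succAbove i]
    simp
    tauto
  have hI : IntegrableOn (fun p : ℝ × (Fin n → ℝ) => g (i.insertNth p.1 p.2))
      (Icc (a i) (b i) ×ˢ Icc (fun l => a (i.succAbove l)) fun l => b (i.succAbove l)) := by
    have := (he.integrableOn_comp_preimage e.symm.measurableEmbedding).2 hg
    rwa [hpre] at this
  have hI' := hI
  rw [IntegrableOn, Measure.volume_eq_prod, ← Measure.prod_restrict] at hI'
  refine ⟨hI'.integral_prod_right, hI'.prod_left_ae, ?_⟩
  rw [← he.setIntegral_preimage_emb e.symm.measurableEmbedding, hpre, Measure.volume_eq_prod,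
    ← Measure.prod_restrict]
  exact integral_prod_symm _ hI'

end SkelStab

end


noncomputable section

namespace SkelStab

/-! ### Derivative of the determinant -/

/-- Jacobi's formula. The Leibniz expansion shows that the derivative of the determinant depends
only on the matrix and its derivative at the point (`key`), so the curve may be replaced by the
affine one `A t + s A'`. There the derivative is read off from the expansion of `det (1 + s B)` with
`B = A⁻¹ A'`. -/
theorem hasDerivAt_det {m : Type*} [Fintype m] [DecidableEq m] {A : ℝ → Matrix m m ℝ}
    {A' : Matrix m m ℝ} {t : ℝ} (hA : ∀ i j, HasDerivAt (fun s => A s i j) (A' i j) t)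
    (hdet : (A t).det ≠ 0) :
    HasDerivAt (fun s => (A s).det) ((A t).det * ((A t)⁻¹ * A').trace) t := by
  have key : ∀ (B : ℝ → Matrix m m ℝ) (r : ℝ),
      (∀ i j, HasDerivAt (fun s => B s i j) (A' i j) r) → B r = A t →
      HasDerivAt (fun s => (B s).det) (∑ σ : Equiv.Perm m, ((Equiv.Perm.sign σ : ℤ) : ℝ) *
        ∑ i, (∏ j ∈ Finset.univ.erase i, A t (σ j) j) • A' (σ i) i) r := by
    intro B r hB hr
    simp only [Matrix.det_apply']
    refine HasDerivAt.fun_sum fun σ _ => HasDerivAt.const_mul _ ?_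
    rw [← hr]
    exact HasDerivAt.fun_finsetProd fun i _ => hB (σ i) i
  have h1 := key A t hA rfl
  have h2 := key (fun s => A t + s • A') 0 (fun i j => by
    simpa using ((hasDerivAt_id (0 : ℝ)).mul_const (A' i j)).const_add (A t i j)) (by simp)
  have h3 : HasDerivAt (fun s : ℝ => (A t + s • A').det) ((A t).det * ((A t)⁻¹ * A').trace) 0 := by
    have e : ∀ s : ℝ, (A t + s • A').det = (A t).det * (1 + ((A t)⁻¹ * A').trace * s +
        ((1 + (Polynomial.X : Polynomial ℝ) • ((A t)⁻¹ * A').map Polynomial.C).det).divX.divX.eval s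
          * s ^ 2) := by
      intro s
      rw [← Matrix.det_one_add_smul, ← Matrix.det_mul, mul_add, mul_one, Matrix.mul_smul,
        ← mul_assoc, Matrix.mul_nonsing_inv _ (isUnit_iff_ne_zero.2 hdet), one_mul]
    simp only [e]
    refine HasDerivAt.const_mul _ ?_
    set R := ((1 + (Polynomial.X : Polynomial ℝ) •
      ((A t)⁻¹ * A').map Polynomial.C).det).divX.divX
    have := (((hasDerivAt_id (0 : ℝ)).const_mul ((A t)⁻¹ * A').trace).const_add 1).add
      ((R.hasDerivAt 0).mul (hasDerivAt_pow 2 (0 : ℝ)))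
    convert! this using 1
    simp
  rwa [h2.unique h3] at h1

/-! ### Lipschitz bounds -/

/-- A compactness argument on `K × K`. Near a diagonal point `F` differs little from its injective
derivative, uniformly by the mean value inequality on a convex set; near an off-diagonal point
injectivity keeps `‖F x - F y‖` away from zero. The two cases make the bound hold up to the boundary
of `K`. -/
theorem exists_pos_mul_norm_sub_le {E : Type*} [NormedAddCommGroup E] [NormedSpace ℝ E]
    [FiniteDimensional ℝ E] {K : Set E} (hK : IsCompact K) (hconv : Convex ℝ K)
    (hu : UniqueDiffOn ℝ K) {F : E → E} (hF : ContDiffOn ℝ 1 F K) (hinj : InjOn F K)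
    (hd : ∀ x ∈ K, Function.Injective (fderivWithin ℝ F K x)) :
    ∃ c : ℝ, 0 < c ∧ ∀ x ∈ K, ∀ y ∈ K, c * ‖x - y‖ ≤ ‖F x - F y‖ := by
  suffices H : ∃ c : ℝ, 0 < c ∧ ∀ q ∈ K ×ˢ K, c * ‖q.1 - q.2‖ ≤ ‖F q.1 - F q.2‖ by
    obtain ⟨c, hc, h⟩ := H
    exact ⟨c, hc, fun x hx y hy => h (x, y) ⟨hx, hy⟩⟩
  refine (hK.prod hK).induction_on
    (p := fun S => ∃ c : ℝ, 0 < c ∧ ∀ q ∈ S, c * ‖q.1 - q.2‖ ≤ ‖F q.1 - F q.2‖) ?_ ?_ ?_ ?_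
  · exact ⟨1, one_pos, fun q hq => absurd hq (notMem_empty _)⟩
  · rintro S T hST ⟨c, hc, h⟩
    exact ⟨c, hc, fun q hq => h q (hST hq)⟩
  · rintro S T ⟨c, hc, h⟩ ⟨c', hc', h'⟩
    refine ⟨min c c', lt_min hc hc', fun q hq => ?_⟩
    rcases hq with hq | hq
    · exact (mul_le_mul_of_nonneg_right (min_le_left _ _) (norm_nonneg _)).trans (h q hq)
    · exact (mul_le_mul_of_nonneg_right (min_le_right _ _) (norm_nonneg _)).trans (h' q hq)
  · rintro ⟨z, z'⟩ ⟨hz, hz'⟩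
    by_cases hzz : z = z'
    · subst hzz
      obtain ⟨k, hk, hanti⟩ := LinearMap.exists_antilipschitzWith
        (fderivWithin ℝ F K z : E →ₗ[ℝ] E) (LinearMap.ker_eq_bot.2 (hd z hz))
      have hk' : (0 : ℝ) < k := hk
      have hcont := (hF.continuousOn_fderivWithin hu le_rfl) z hz
      -- The derivative at `z` expands by at least `1 / k`; an oscillation of the derivative of at
      -- most half of that leaves a lower bound `1 / (2k)` for `F`.
      have hev : ∀ᶠ x in 𝓝[K] z, ‖fderivWithin ℝ F K x - fderivWithin ℝ F K z‖ ≤ 1 / (2 * k) := by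
        have := Metric.tendsto_nhds.1 hcont (1 / (2 * k)) (by positivity)
        filter_upwards [this] with x hx
        rw [dist_eq_norm] at hx
        exact hx.le
      obtain ⟨r, hr, hball⟩ := Metric.mem_nhdsWithin_iff.1 hev
      have hbK : Metric.ball z r ∩ K ∈ 𝓝[K] z :=
        inter_comm K _ ▸ inter_mem_nhdsWithin K (Metric.ball_mem_nhds z hr)
      refine ⟨(Metric.ball z r ∩ K) ×ˢ (Metric.ball z r ∩ K), ?_, 1 / (2 * k), by positivity, ?_⟩
      · rw [nhdsWithin_prod_eq]
        exact prod_mem_prod hbK hbK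
      · rintro ⟨x, y⟩ ⟨hx, hy⟩
        have hm := Convex.norm_image_sub_le_of_norm_hasFDerivWithin_le' (f := F)
          (s := Metric.ball z r ∩ K) (f' := fun x => fderivWithin ℝ F K x)
          (φ := fderivWithin ℝ F K z) (C := 1 / (2 * k))
          (fun x hx => (((hF.differentiableOn one_ne_zero) x hx.2).hasFDerivWithinAt).mono
            inter_subset_right) (fun x hx => hball hx) ((convex_ball z r).inter hconv) hy hx
        have ha := hanti.le_mul_dist (x - y) 0
        simp only [dist_zero_right, map_zero] at ha
        have ha' : ‖x - y‖ ≤ k * ‖fderivWithin ℝ F K z (x - y)‖ := ha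
        have ht : ‖fderivWithin ℝ F K z (x - y)‖ ≤ ‖F x - F y‖ +
            ‖F x - F y - fderivWithin ℝ F K z (x - y)‖ := by
          have := norm_sub_le (F x - F y) (F x - F y - fderivWithin ℝ F K z (x - y))
          simpa using this
        have h2 : k * ‖fderivWithin ℝ F K z (x - y)‖ ≤ k * (‖F x - F y‖ +
            1 / (2 * k) * ‖x - y‖) := by
          gcongr
          exact ht.trans (by gcongr)
        have h3 : k * (‖F x - F y‖ + 1 / (2 * k) * ‖x - y‖) = k * ‖F x - F y‖ + ‖x - y‖ / 2 := by
          field_simp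
        have h4 : ‖x - y‖ ≤ 2 * k * ‖F x - F y‖ := by linarith
        calc 1 / (2 * k) * ‖x - y‖ ≤ 1 / (2 * k) * (2 * k * ‖F x - F y‖) := by gcongr
          _ = ‖F x - F y‖ := by field_simp
    · have hne : F z ≠ F z' := fun h => hzz (hinj hz hz' h)
      have hpos : 0 < ‖F z - F z'‖ := norm_pos_iff.2 (sub_ne_zero.2 hne)
      have hc : ContinuousWithinAt (fun q : E × E => ‖F q.1 - F q.2‖) (K ×ˢ K) (z, z') := by
        have h1 : ContinuousWithinAt (fun q : E × E => F q.1) (K ×ˢ K) (z, z') :=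
          (hF.continuousOn z hz).comp continuous_fst.continuousWithinAt fun q hq => hq.1
        have h2 : ContinuousWithinAt (fun q : E × E => F q.2) (K ×ˢ K) (z, z') :=
          (hF.continuousOn z' hz').comp continuous_snd.continuousWithinAt fun q hq => hq.2
        exact (h1.sub h2).norm
      have hc2 : ContinuousWithinAt (fun q : E × E => ‖q.1 - q.2‖) (K ×ˢ K) (z, z') :=
        Continuous.continuousWithinAt (by fun_prop)
      refine ⟨_, (hc.eventually (lt_mem_nhds (half_lt_self hpos))).and
        (hc2.eventually (gt_mem_nhds (lt_add_one _))),
        (‖F z - F z'‖ / 2) / (‖z - z'‖ + 1), by positivity, ?_⟩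
      rintro q ⟨hq1, hq2⟩
      calc (‖F z - F z'‖ / 2) / (‖z - z'‖ + 1) * ‖q.1 - q.2‖
          ≤ (‖F z - F z'‖ / 2) / (‖z - z'‖ + 1) * (‖z - z'‖ + 1) := by gcongr
        _ = ‖F z - F z'‖ / 2 := by field_simp
        _ ≤ _ := hq1.le

/-- Lipschitz bounds on the closed pieces of a finite cover glue to the same bound on a convex set.
Along the segment from `x` to `y`, continuous induction propagates the estimate: to the right of any
parameter the segment returns infinitely often to one fixed piece, which by closedness contains the
current point too. The constant is not multiplied by the number of pieces. -/
theorem norm_sub_le_of_cover {ι E G : Type*} [Finite ι] [NormedAddCommGroup E] [NormedSpace ℝ E]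
    [NormedAddCommGroup G] {S : ι → Set E} {K : Set E} {g : E → G} {L : ℝ}
    (hcl : ∀ i, IsClosed (S i)) (hK : Convex ℝ K) (hcov : K ⊆ ⋃ i, S i)
    (hg : ContinuousOn g K)
    (hlip : ∀ i, ∀ x ∈ S i, x ∈ K → ∀ y ∈ S i, y ∈ K → ‖g x - g y‖ ≤ L * ‖x - y‖)
    {x y : E} (hx : x ∈ K) (hy : y ∈ K) : ‖g y - g x‖ ≤ L * ‖y - x‖ := by
  let γ : ℝ → E := fun t => x + t • (y - x)
  have hγc : Continuous γ := by fun_prop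
  have hγK : ∀ t ∈ Icc (0 : ℝ) 1, γ t ∈ K := fun t ht => hK.add_smul_sub_mem hx hy ht
  have hγd : ∀ s t, s ≤ t → ‖γ t - γ s‖ = (t - s) * ‖y - x‖ := by
    intro s t hst
    have : γ t - γ s = (t - s) • (y - x) := by simp only [γ]; module
    rw [this, norm_smul, Real.norm_of_nonneg (sub_nonneg.2 hst)]
  have hgγ : ContinuousOn (fun t => g (γ t)) (Icc 0 1) := hg.comp hγc.continuousOn hγK
  let T : Set ℝ := {t | ‖g (γ t) - g x‖ ≤ L * (t * ‖y - x‖)}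
  have hclosed : IsClosed (T ∩ Icc 0 1) := by
    have h1 : ContinuousOn (fun t => L * (t * ‖y - x‖) - ‖g (γ t) - g x‖) (Icc 0 1) :=
      (Continuous.continuousOn (by fun_prop)).sub (hgγ.sub continuousOn_const).norm
    have := h1.preimage_isClosed_of_isClosed isClosed_Icc (isClosed_Ici (a := (0 : ℝ)))
    convert this using 1
    ext t
    simp [T, and_comm]
  have hsub : Icc (0 : ℝ) 1 ⊆ T := by
    refine hclosed.Icc_subset_of_forall_exists_gt (by simp [T, γ]) ?_
    rintro t ⟨htT, ht⟩ s hs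
    have hev : ∀ᶠ r in 𝓝[>] t, r ∈ Ioc t (min s 1) := Ioc_mem_nhdsGT (lt_min hs ht.2)
    have hfr : ∃ i, ∃ᶠ r in 𝓝[>] t, γ r ∈ S i := by
      by_contra! hcon
      have h2 : ∀ᶠ r in 𝓝[>] t, ∀ i, γ r ∉ S i :=
        eventually_all.2 hcon
      obtain ⟨r, hr, hr'⟩ := (h2.and hev).exists
      obtain ⟨i, hi⟩ := mem_iUnion.1 (hcov (hγK r ⟨ht.1.trans hr'.1.le, hr'.2.trans (min_le_right _ _)⟩))
      exact hr i hi
    obtain ⟨i, hi⟩ := hfr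
    have hti : γ t ∈ S i := (hcl i).mem_of_frequently_of_tendsto hi
      (hγc.continuousAt.tendsto.mono_left nhdsWithin_le_nhds)
    obtain ⟨r, hr, hr'⟩ := (hi.and_eventually hev).exists
    have hrs := hr'.2.trans (min_le_left _ _)
    have hr1 := hr'.2.trans (min_le_right _ _)
    refine ⟨r, ?_, hr'.1, hrs⟩
    have h1 := hlip i (γ r) hr (hγK r ⟨ht.1.trans hr'.1.le, hr1⟩) (γ t) hti
      (hγK t ⟨ht.1, ht.2.le⟩)
    rw [hγd t r hr'.1.le] at h1
    have h2 : ‖g (γ t) - g x‖ ≤ L * (t * ‖y - x‖) := htT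
    change ‖g (γ r) - g x‖ ≤ L * (r * ‖y - x‖)
    calc ‖g (γ r) - g x‖ ≤ ‖g (γ r) - g (γ t)‖ + ‖g (γ t) - g x‖ := norm_sub_le_norm_sub_add_norm_sub _ _ _
      _ ≤ L * ((r - t) * ‖y - x‖) + L * (t * ‖y - x‖) := add_le_add h1 h2
      _ = _ := by ring
  have := hsub (right_mem_Icc.2 zero_le_one)
  simpa [T, γ] using this

/-! ### Curves in finite-dimensional function spaces -/

/-- A function killed by all evaluations is zero, so evaluations span the dual of a
finite-dimensional function space. Pointwise differentiability therefore passes to every linear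
functional, in particular to coordinates, and through coordinates to quadratic forms. -/
theorem exists_hasDerivWithinAt_of_eval {X : Type*} (V : Submodule ℝ (X → ℝ)) [FiniteDimensional ℝ V]
    {u : ℝ → V} {s : Set ℝ} {t : ℝ}
    (hu : ∀ x, DifferentiableWithinAt ℝ (fun r => (u r : X → ℝ) x) s t) :
    ∃ u' : V, (∀ φ : V →ₗ[ℝ] ℝ, HasDerivWithinAt (fun r => φ (u r)) (φ u') s t) ∧
      ∀ B : V →ₗ[ℝ] V →ₗ[ℝ] ℝ, (∀ v w, B v w = B w v) →
        HasDerivWithinAt (fun r => B (u r) (u r)) (2 * B u' (u t)) s t := by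
  let ev : X → V →ₗ[ℝ] ℝ := fun x => (LinearMap.proj x).comp V.subtype
  have htop : Submodule.span ℝ (range ev) = ⊤ := by
    refine Submodule.span_eq_top_of_ne_zero fun z hz => ?_
    by_contra! hcon
    apply hz
    ext x
    exact hcon (ev x) ⟨x, rfl⟩
  have hdiff : ∀ φ : V →ₗ[ℝ] ℝ, DifferentiableWithinAt ℝ (fun r => φ (u r)) s t := by
    intro φ
    have hφ : φ ∈ Submodule.span ℝ (range ev) := htop ▸ Submodule.mem_top
    induction hφ using Submodule.span_induction with
    | mem φ h => obtain ⟨x, rfl⟩ := h; exact hu x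
    | zero => exact differentiableWithinAt_const _
    | add φ ψ _ _ h1 h2 => exact h1.add h2
    | smul c φ _ h => exact h.const_mul c
  let b := Module.finBasis ℝ V
  have hc : ∀ j, HasDerivWithinAt (fun r => b.coord j (u r))
      (derivWithin (fun r => b.coord j (u r)) s t) s t := fun j => (hdiff _).hasDerivWithinAt
  set c' : _ → ℝ := fun j => derivWithin (fun r => b.coord j (u r)) s t
  have hrepr : ∀ v : V, v = ∑ j, b.coord j v • b j := fun v => (b.sum_repr v).symm
  have happ : ∀ (φ : V →ₗ[ℝ] ℝ) (v : V), φ v = ∑ j, b.coord j v * φ (b j) := by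
    intro φ v
    conv_lhs => rw [hrepr v]
    simp only [map_sum, map_smul, smul_eq_mul]
  have hφ : ∀ φ : V →ₗ[ℝ] ℝ, HasDerivWithinAt (fun r => φ (u r)) (φ (∑ j, c' j • b j)) s t := by
    intro φ
    rw [funext fun r => happ φ (u r)]
    simp only [map_sum, map_smul, smul_eq_mul]
    exact HasDerivWithinAt.fun_sum fun j _ => (hc j).mul_const _
  refine ⟨∑ j, c' j • b j, hφ, fun B hB => ?_⟩
  have e : (fun r => B (u r) (u r)) = fun r => ∑ j, b.coord j (u r) * B (b j) (u r) :=
    funext fun r => happ (B.flip (u r)) (u r)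
  rw [e]
  have := HasDerivWithinAt.fun_sum (u := Finset.univ) fun j _ => (hc j).mul (hφ (B (b j)))
  convert! this using 1
  rw [Finset.sum_add_distrib, two_mul]
  congr 1
  · change B.flip (u t) (∑ j, c' j • b j) = _
    simp only [map_sum, map_smul, smul_eq_mul, LinearMap.flip_apply]
    rfl
  · rw [hB, ← LinearMap.flip_apply, happ]
    rfl

end SkelStab

end


noncomputable section

namespace SkelStab

/-! ### Korn's inequality for Lipschitz fields with compact support -/

section Korn

variable {n : ℕ}

theorem lineDeriv_eq_zero_of_notMem_tsupport {f : Pt n → ℝ} {x : Pt n} (hx : x ∉ tsupport f)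
    (v : Pt n) : lineDeriv ℝ f x v = 0 := by
  have h : f =ᶠ[𝓝 x] fun _ => 0 := notMem_tsupport_iff_eventuallyEq.1 hx
  rw [h.lineDeriv_eq]
  simp [lineDeriv]

theorem integrable_lineDeriv {f : Pt n → ℝ} {C : NNReal} (hf : LipschitzWith C f)
    (hc : HasCompactSupport f) (v : Pt n) : Integrable fun x => lineDeriv ℝ f x v := by
  have hK : IsCompact (tsupport f) := hc
  have h1 : IntegrableOn (fun x => lineDeriv ℝ f x v) (tsupport f) :=
    (hf.locallyIntegrable_lineDeriv (μ := volume) v).integrableOn_isCompact hK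
  rwa [integrableOn_iff_integrable_of_support_subset] at h1
  intro x hx
  by_contra hx'
  exact hx (lineDeriv_eq_zero_of_notMem_tsupport hx' v)

theorem integrable_lineDeriv_mul {f g : Pt n → ℝ} {C D : NNReal} (hf : LipschitzWith C f)
    (hg : LipschitzWith D g) (hc : HasCompactSupport g) (v w : Pt n) :
    Integrable fun x => lineDeriv ℝ f x v * lineDeriv ℝ g x w := by
  refine (integrable_lineDeriv hg hc w).bdd_mul (c := C * ‖v‖)
    (aestronglyMeasurable_lineDeriv hf.continuous volume) (ae_of_all _ fun x => ?_)
  exact norm_lineDeriv_le_of_lipschitz ℝ hf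

/-- Two integrations by parts without second derivatives. One of the two derivatives is replaced by
a difference quotient; integrating the other one by parts and translating the integral moves the
difference quotient onto the other factor (`key`). Letting the step tend to zero on both sides gives
the identity. -/
theorem integral_lineDeriv_mul_lineDeriv_comm {f g : Pt n → ℝ} {C D : NNReal}
    (hf : LipschitzWith C f) (hfc : HasCompactSupport f) (hg : LipschitzWith D g)
    (hgc : HasCompactSupport g) (v w : Pt n) :
    ∫ x, lineDeriv ℝ f x v * lineDeriv ℝ g x w = ∫ x, lineDeriv ℝ f x w * lineDeriv ℝ g x v := by
  have A := hg.integral_inv_smul_sub_mul_tendsto_integral_lineDeriv_mul (μ := volume)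
    (integrable_lineDeriv hf hfc v) w
  have B := hf.integral_inv_smul_sub_mul_tendsto_integral_lineDeriv_mul (μ := volume)
    (integrable_lineDeriv hg hgc (-v)) (-w)
  have hgf : ∀ t : ℝ, LipschitzWith D fun x => g (x + t • w) := fun t => by
    have := hg.comp (LipschitzWith.of_dist_le_mul (K := 1) fun x y => by simp :
      LipschitzWith 1 fun x : Pt n => x + t • w)
    rw [mul_one] at this
    exact this
  have key : ∀ t : ℝ, ∫ x, (t⁻¹ • (g (x + t • w) - g x)) * lineDeriv ℝ f x v =
      ∫ x, (t⁻¹ • (f (x + t • (-w)) - f x)) * lineDeriv ℝ g x (-v) := by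
    intro t
    have hd : LipschitzWith (D + D) fun x => g (x + t • w) - g x := (hgf t).sub hg
    have h2 := LipschitzWith.integral_lineDeriv_mul_eq (μ := volume) hf hd ?_ v
    swap
    · have hsh : HasCompactSupport fun x => g (x + t • w) := by
        have := hgc.comp_homeomorph (Homeomorph.addRight (t • w))
        exact this
      exact hsh.sub hgc
    have hae : ∀ᵐ x : Pt n, lineDeriv ℝ (fun x => g (x + t • w) - g x) x (-v) =
        lineDeriv ℝ g (x + t • w) (-v) - lineDeriv ℝ g x (-v) := by
      have e1 := hg.ae_lineDifferentiableAt (μ := volume) (-v)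
      have e2 : ∀ᵐ x : Pt n, LineDifferentiableAt ℝ g (x + t • w) (-v) :=
        (measurePreserving_add_right volume (t • w)).quasiMeasurePreserving.ae e1
      filter_upwards [e1, e2] with x h1 h2
      have d1 := h1.hasLineDerivAt
      have d2 := h2.hasLineDerivAt
      have d3 : HasLineDerivAt ℝ (fun x => g (x + t • w)) (lineDeriv ℝ g (x + t • w) (-v)) x (-v) := by
        unfold HasLineDerivAt at d2 ⊢
        simpa only [add_right_comm] using d2
      have d4 : HasLineDerivAt ℝ (fun x => g (x + t • w) - g x)
          (lineDeriv ℝ g (x + t • w) (-v) - lineDeriv ℝ g x (-v)) x (-v) := by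
        unfold HasLineDerivAt at d3 d1 ⊢
        exact d3.sub d1
      exact d4.lineDeriv
    have hi1 : Integrable fun x => lineDeriv ℝ g (x + t • w) (-v) * f x := by
      refine (hf.continuous.integrable_of_hasCompactSupport hfc).bdd_mul (c := D * ‖-v‖) ?_ ?_
      · exact ((measurable_lineDeriv hg.continuous).comp
          (measurable_id.add_const _)).aestronglyMeasurable
      · exact ae_of_all _ fun x => norm_lineDeriv_le_of_lipschitz ℝ hg
    have hi2 : Integrable fun x => lineDeriv ℝ g x (-v) * f x := by
      refine (hf.continuous.integrable_of_hasCompactSupport hfc).bdd_mul (c := D * ‖-v‖) ?_ ?_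
      · exact aestronglyMeasurable_lineDeriv hg.continuous volume
      · exact ae_of_all _ fun x => norm_lineDeriv_le_of_lipschitz ℝ hg
    have hi3 : Integrable fun x => f (x + t • (-w)) * lineDeriv ℝ g x (-v) := by
      have := (integrable_lineDeriv hg hgc (-v)).bdd_mul (f := fun x => f (x + t • (-w))) ?_ ?_
        (c := (hfc.exists_bound_of_continuous hf.continuous).choose)
      · exact this
      · exact (hf.continuous.comp (continuous_add_const _)).aestronglyMeasurable
      · exact ae_of_all _ fun x => (hfc.exists_bound_of_continuous hf.continuous).choose_spec _
    have hshift : ∫ x, lineDeriv ℝ g (x + t • w) (-v) * f x =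
        ∫ x, f (x + t • (-w)) * lineDeriv ℝ g x (-v) := by
      rw [← integral_add_right_eq_self _ (t • (-w))]
      refine integral_congr_ae (ae_of_all _ fun x => ?_)
      simp [mul_comm]
    simp only [smul_eq_mul, mul_assoc, integral_const_mul]
    congr 1
    calc ∫ x, (g (x + t • w) - g x) * lineDeriv ℝ f x v
        = ∫ x, lineDeriv ℝ f x v * (g (x + t • w) - g x) := by simp only [mul_comm]
      _ = ∫ x, (lineDeriv ℝ g (x + t • w) (-v) - lineDeriv ℝ g x (-v)) * f x := by
        rw [h2]
        refine integral_congr_ae ?_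
        filter_upwards [hae] with x hx
        rw [hx]
      _ = ∫ x, (f (x + t • (-w)) - f x) * lineDeriv ℝ g x (-v) := by
        simp only [sub_mul]
        rw [integral_sub hi1 hi2, integral_sub hi3 (by simpa only [mul_comm] using hi2), hshift]
        simp only [mul_comm]
  simp only [key] at A
  have := tendsto_nhds_unique A B
  simp only [lineDeriv_neg, mul_neg, neg_mul, neg_neg] at this
  rw [← this]
  simp only [mul_comm]

/-- Korn's inequality for compactly supported Lipschitz fields. -/
theorem integral_sq_lineDeriv_le {v : Pt n → Pt n} {C : NNReal}
    (hv : ∀ j, LipschitzWith C fun x => v x j) (hc : ∀ j, HasCompactSupport fun x => v x j) :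
    ∫ x, ∑ i, ∑ j, lineDeriv ℝ (fun x => v x j) x (Pi.single i 1) ^ 2 ≤
      2 * ∫ x, ∑ i, ∑ j, ((1 / 2 : ℝ) * (lineDeriv ℝ (fun x => v x j) x (Pi.single i 1) +
        lineDeriv ℝ (fun x => v x i) x (Pi.single j 1))) ^ 2 := by
  set D : Fin (n + 1) → Fin (n + 1) → Pt n → ℝ :=
    fun i j x => lineDeriv ℝ (fun x => v x j) x (Pi.single i 1) with hD
  have hint : ∀ i j k l, Integrable fun x => D i j x * D k l x := fun i j k l =>
    integrable_lineDeriv_mul (hv j) (hv l) (hc l) _ _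
  -- Exchanging derivatives turns the cross term `∫ ∇v : (∇v)ᵀ` into `∫ (div v)²`. Since `|∇ˢv|²` is
  -- half of `|∇v|²` plus half of the cross term, the constant `2` results.
  have hcross : 0 ≤ ∫ x, ∑ i, ∑ j, D i j x * D j i x := by
    have h1 : ∫ x, ∑ i, ∑ j, D i j x * D j i x = ∫ x, ∑ i, ∑ j, D j j x * D i i x := by
      rw [integral_finsetSum _ fun i _ => integrable_finsetSum _ fun j _ => hint i j j i,
        integral_finsetSum _ fun i _ => integrable_finsetSum _ fun j _ => hint j j i i]
      refine Finset.sum_congr rfl fun i _ => ?_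
      rw [integral_finsetSum _ fun j _ => hint i j j i,
        integral_finsetSum _ fun j _ => hint j j i i]
      refine Finset.sum_congr rfl fun j _ => ?_
      exact integral_lineDeriv_mul_lineDeriv_comm (hv j) (hc j) (hv i) (hc i) _ _
    rw [h1]
    refine integral_nonneg fun x => ?_
    have : ∑ i, ∑ j, D j j x * D i i x = (∑ i, D i i x) ^ 2 := by
      rw [sq, Finset.sum_mul_sum, Finset.sum_comm]
    simp only [this]
    exact sq_nonneg _
  have hsq : Integrable fun x => ∑ i, ∑ j, D i j x ^ 2 := by
    simp only [sq]
    exact integrable_finsetSum _ fun i _ => integrable_finsetSum _ fun j _ => hint i j i j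
  have hcr : Integrable fun x => ∑ i, ∑ j, D i j x * D j i x :=
    integrable_finsetSum _ fun i _ => integrable_finsetSum _ fun j _ => hint i j j i
  have hpt : ∀ x, ∑ i, ∑ j, ((1 / 2 : ℝ) * (D i j x + D j i x)) ^ 2 =
      (1 / 2) * ∑ i, ∑ j, D i j x ^ 2 + (1 / 2) * ∑ i, ∑ j, D i j x * D j i x := by
    intro x
    have e1 : ∀ i j, ((1 / 2 : ℝ) * (D i j x + D j i x)) ^ 2 = (1 / 4) * D i j x ^ 2 +
        (1 / 4) * D j i x ^ 2 + (1 / 2) * (D i j x * D j i x) := fun i j => by ring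
    simp only [e1, Finset.sum_add_distrib, ← Finset.mul_sum]
    rw [Finset.sum_comm (f := fun i j => D j i x ^ 2)]
    ring
  change ∫ x, ∑ i, ∑ j, D i j x ^ 2 ≤
    2 * ∫ x, ∑ i, ∑ j, ((1 / 2 : ℝ) * (D i j x + D j i x)) ^ 2
  simp only [hpt]
  rw [integral_add (hsq.const_mul _) (hcr.const_mul _), integral_const_mul, integral_const_mul]
  linarith

end Korn

end SkelStab

end


noncomputable section

namespace SkelStab

/-! ### Meshes -/

theorem exists_mem_Icc_knot {m : ℕ} (hm : 0 < m) {ζ : Fin (m + 1) → ℝ} {t : ℝ}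
    (ht : t ∈ Icc (ζ 0) (ζ (Fin.last m))) :
    ∃ j : Fin m, t ∈ Icc (ζ j.castSucc) (ζ j.succ) := by
  by_contra! hcon
  have h : ∀ j : Fin (m + 1), ζ j ≤ t := by
    intro j
    induction j using Fin.induction with
    | zero => exact ht.1
    | succ j ih =>
      by_contra h
      exact hcon j ⟨ih, (not_le.1 h).le⟩
  obtain ⟨m, rfl⟩ : ∃ k, m = k + 1 := ⟨m - 1, by omega⟩
  exact hcon (Fin.last m) ⟨h _, by simpa using ht.2⟩

theorem eventually_mem_Icc_knot {m : ℕ} {ζ : Fin (m + 1) → ℝ} {t : ℝ} {j : Fin m}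
    (ht : t ∈ Icc (ζ j.castSucc) (ζ j.succ))
    (hreg : ∀ i : Fin (m + 1), i ≠ 0 → i ≠ Fin.last m → t ≠ ζ i) :
    ∀ᶠ s in 𝓝 t, s ∈ Icc (ζ 0) (ζ (Fin.last m)) → s ∈ Icc (ζ j.castSucc) (ζ j.succ) := by
  have h1 : ∀ᶠ s in 𝓝 t, s ∈ Icc (ζ 0) (ζ (Fin.last m)) → ζ j.castSucc ≤ s := by
    by_cases h : j.castSucc = 0
    · rw [h]; exact Eventually.of_forall fun s hs => hs.1
    · have hlt : ζ j.castSucc < t :=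
        lt_of_le_of_ne ht.1 (hreg _ h (Fin.castSucc_lt_last j).ne).symm
      filter_upwards [lt_mem_nhds hlt] with s hs _ using hs.le
  have h2 : ∀ᶠ s in 𝓝 t, s ∈ Icc (ζ 0) (ζ (Fin.last m)) → s ≤ ζ j.succ := by
    by_cases h : j.succ = Fin.last m
    · rw [h]; exact Eventually.of_forall fun s hs => hs.2
    · have hlt : t < ζ j.succ := lt_of_le_of_ne ht.2 (hreg _ (Fin.succ_ne_zero j) h)
      filter_upwards [gt_mem_nhds hlt] with s hs _ using hs.le
  filter_upwards [h1, h2] with s h1 h2 hs using ⟨h1 hs, h2 hs⟩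

theorem uniqueDiffOn_Icc_pi {m : ℕ} {a b : Fin m → ℝ} (hab : ∀ i, a i < b i) :
    UniqueDiffOn ℝ (Icc a b) := by
  rw [← pi_univ_Icc]
  exact UniqueDiffOn.univ_pi fun i => uniqueDiffOn_Icc (hab i)

theorem paramDomain_subset_Icc {n : ℕ} {a b : Pt n} : paramDomain a b ⊆ Icc a b :=
  fun _ hx => ⟨fun i => (hx i trivial).1.le, fun i => (hx i trivial).2.le⟩

theorem isOpen_paramDomain {n : ℕ} (a b : Pt n) : IsOpen (paramDomain a b) :=
  isOpen_set_pi finite_univ fun _ _ => isOpen_Ioo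

theorem paramDomain_ae_eq_Icc {n : ℕ} (a b : Pt n) :
    paramDomain a b =ᵐ[volume] Icc a b :=
  Measure.univ_pi_Ioo_ae_eq_Icc

namespace ParamMesh

variable {n : ℕ} {a b : Pt n} (M : ParamMesh a b)

theorem bounds_lt {n : ℕ} {a b : Pt n} (M : ParamMesh a b) (i : Fin (n + 1)) : a i < b i := by
  rw [← M.knot_first i, ← M.knot_last i]
  exact M.knot_strictMono i (Fin.lt_def.2 (by simpa using M.N_pos i))

theorem lo_lt_hi (J : M.Elem) (i : Fin (n + 1)) : M.lo J i < M.hi J i :=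
  M.knot_strictMono i Fin.castSucc_lt_succ

theorem closedElem_subset (J : M.Elem) : M.closedElem J ⊆ Icc a b := by
  rintro x ⟨h1, h2⟩
  refine ⟨fun i => ?_, fun i => ?_⟩
  · rw [← M.knot_first i]
    exact ((M.knot_strictMono i).monotone (Fin.zero_le _)).trans (h1 i)
  · rw [← M.knot_last i]
    exact (h2 i).trans ((M.knot_strictMono i).monotone (Fin.le_last _))

theorem Icc_subset_iUnion : Icc a b ⊆ ⋃ J : M.Elem, M.closedElem J := by
  intro x hx
  have h : ∀ i, ∃ j : Fin (M.N i), x i ∈ Icc (M.knot i j.castSucc) (M.knot i j.succ) := fun i =>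
    exists_mem_Icc_knot (M.N_pos i) (by rw [M.knot_first, M.knot_last]; exact ⟨hx.1 i, hx.2 i⟩)
  choose J hJ using h
  exact mem_iUnion.2 ⟨J, fun i => (hJ i).1, fun i => (hJ i).2⟩

theorem isCompact_closedElem (J : M.Elem) : IsCompact (M.closedElem J) := isCompact_Icc

theorem convex_closedElem (J : M.Elem) : Convex ℝ (M.closedElem J) := convex_Icc _ _

theorem uniqueDiffOn_closedElem (J : M.Elem) : UniqueDiffOn ℝ (M.closedElem J) :=
  uniqueDiffOn_Icc_pi (M.lo_lt_hi J)

/-- Points that lie on no internal knot plane. -/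
def regular : Set (Pt n) :=
  {x | ∀ l (j : Fin (M.N l + 1)), j ≠ 0 → j ≠ Fin.last _ → x l ≠ M.knot l j}

/-- Points of a facet orthogonal to direction `i` that lie on no internal knot plane. -/
def faceRegular (i : Fin (n + 1)) : Set (Fin n → ℝ) :=
  {y | ∀ l (j : Fin (M.N (i.succAbove l) + 1)), j ≠ 0 → j ≠ Fin.last _ →
    y l ≠ M.knot (i.succAbove l) j}

/-- Coordinates on no internal knot. -/
def lineRegular (i : Fin (n + 1)) : Set ℝ :=
  {t | ∀ j : Fin (M.N i + 1), j ≠ 0 → j ≠ Fin.last _ → t ≠ M.knot i j}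

theorem insertNth_mem_regular {i : Fin (n + 1)} {t : ℝ} {y : Fin n → ℝ} :
    (i.insertNth t y : Pt n) ∈ M.regular ↔ t ∈ M.lineRegular i ∧ y ∈ M.faceRegular i := by
  change (∀ l, ∀ j : Fin (M.N l + 1), _ → _ → (i.insertNth t y : Pt n) l ≠ _) ↔ _
  rw [Fin.forall_iff_succAbove i]
  simp only [Fin.insertNth_apply_same, Fin.insertNth_apply_succAbove]
  rfl

theorem countable_lineRegular_compl (i : Fin (n + 1)) : (M.lineRegular i)ᶜ.Countable := by
  refine ((finite_range (M.knot i)).subset fun t ht => ?_).countable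
  have ht' : ¬ ∀ j : Fin (M.N i + 1), j ≠ 0 → j ≠ Fin.last _ → t ≠ M.knot i j := ht
  push Not at ht'
  obtain ⟨j, _, _, h⟩ := ht'
  exact ⟨j, h.symm⟩

theorem left_mem_lineRegular (i : Fin (n + 1)) : a i ∈ M.lineRegular i := by
  intro j hj _ h
  rw [← M.knot_first i] at h
  exact hj ((M.knot_strictMono i).injective h).symm

theorem right_mem_lineRegular (i : Fin (n + 1)) : b i ∈ M.lineRegular i := by
  intro j _ hj h
  rw [← M.knot_last i] at h
  exact hj ((M.knot_strictMono i).injective h).symm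

theorem ae_mem_lineRegular (i : Fin (n + 1)) : ∀ᵐ t : ℝ, t ∈ M.lineRegular i := by
  filter_upwards [(M.countable_lineRegular_compl i).ae_notMem volume] with t ht
  exact notMem_compl_iff.1 ht

theorem ae_mem_regular : ∀ᵐ x : Pt n, x ∈ M.regular := by
  have : ∀ᵐ x : Pt n, ∀ l (j : Fin (M.N l + 1)), x l ≠ M.knot l j := by
    refine ae_all_iff.2 fun l => ae_all_iff.2 fun j => ?_
    rw [ae_iff]
    simpa [volume_pi] using
      Measure.pi_hyperplane (fun _ : Fin (n + 1) => (volume : Measure ℝ)) l (M.knot l j)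
  filter_upwards [this] with x hx l j _ _ using hx l j

theorem ae_mem_faceRegular (i : Fin (n + 1)) : ∀ᵐ y : Fin n → ℝ, y ∈ M.faceRegular i := by
  have : ∀ᵐ y : Fin n → ℝ, ∀ l (j : Fin (M.N (i.succAbove l) + 1)),
      y l ≠ M.knot (i.succAbove l) j := by
    refine ae_all_iff.2 fun l => ae_all_iff.2 fun j => ?_
    rw [ae_iff]
    simpa [volume_pi] using Measure.pi_hyperplane (fun _ : Fin n => (volume : Measure ℝ)) l
      (M.knot (i.succAbove l) j)
  filter_upwards [this] with y hy l j _ _ using hy l j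

/-- Off the internal knot planes an element and the whole box agree near the point, outer boundary
included. Hence derivatives relative to the box, whose definition does not involve the mesh, can be
computed element by element. -/
theorem closedElem_mem_nhdsWithin {J : M.Elem} {x : Pt n} (hx : x ∈ M.closedElem J)
    (hr : x ∈ M.regular) : M.closedElem J ∈ 𝓝[Icc a b] x := by
  have h : ∀ i, ∀ᶠ z : Pt n in 𝓝 x, z i ∈ Icc (a i) (b i) → z i ∈ Icc (M.lo J i) (M.hi J i) := by
    intro i
    have := eventually_mem_Icc_knot (j := J i) ⟨hx.1 i, hx.2 i⟩ (hr i)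
    rw [M.knot_first, M.knot_last] at this
    exact (continuous_apply i).continuousAt.eventually this
  filter_upwards [mem_nhdsWithin_of_mem_nhds (eventually_all.2 h), self_mem_nhdsWithin]
    with z hz hzI
  exact ⟨fun i => (hz i ⟨hzI.1 i, hzI.2 i⟩).1, fun i => (hz i ⟨hzI.1 i, hzI.2 i⟩).2⟩

theorem openElem_subset_closedElem (J : M.Elem) : M.openElem J ⊆ M.closedElem J :=
  paramDomain_subset_Icc

theorem openElem_subset_regular (J : M.Elem) : M.openElem J ⊆ M.regular := by
  intro x hx l j _ _ h
  have hl := hx l trivial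
  rw [h] at hl
  have h1 : (J l).castSucc < j := (M.knot_strictMono l).lt_iff_lt.1 hl.1
  have h2 : j < (J l).succ := (M.knot_strictMono l).lt_iff_lt.1 hl.2
  rw [Fin.lt_def] at h1 h2
  simp at h1 h2
  omega

theorem openElem_subset_paramDomain (J : M.Elem) : M.openElem J ⊆ paramDomain a b := by
  intro x hx i _
  have h1 := hx i trivial
  have h2 := M.closedElem_subset J
  have h3 : M.lo J ∈ Icc a b := h2 (left_mem_Icc.2 fun i => (M.lo_lt_hi J i).le)
  have h4 : M.hi J ∈ Icc a b := h2 (right_mem_Icc.2 fun i => (M.lo_lt_hi J i).le)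
  exact ⟨(h3.1 i).trans_lt h1.1, h1.2.trans_le (h4.2 i)⟩

theorem isOpen_openElem (J : M.Elem) : IsOpen (M.openElem J) := isOpen_paramDomain _ _

/-- A regular point of the open box lies in an open element. -/
theorem mem_openElem_of_regular {J : M.Elem} {x : Pt n} (hx : x ∈ M.closedElem J)
    (hr : x ∈ M.regular) (hxi : x ∈ paramDomain a b) : x ∈ M.openElem J := by
  intro i _
  have hi : x i ∈ Ioo (a i) (b i) := hxi i trivial
  rw [← M.knot_first i, ← M.knot_last i] at hi
  refine ⟨lt_of_le_of_ne (hx.1 i) ?_, lt_of_le_of_ne (hx.2 i) ?_⟩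
  · by_cases h : (J i).castSucc = 0
    · change M.knot i (J i).castSucc ≠ _
      rw [h]; exact hi.1.ne
    · exact (hr i _ h (Fin.castSucc_lt_last _).ne).symm
  · by_cases h : (J i).succ = Fin.last _
    · change _ ≠ M.knot i (J i).succ
      rw [h]; exact hi.2.ne
    · exact hr i _ (Fin.succ_ne_zero _) h

theorem fderivWithin_eq_of_regular {E : Type*} [NormedAddCommGroup E] [NormedSpace ℝ E]
    {J : M.Elem} {x : Pt n} (hx : x ∈ M.closedElem J) (hr : x ∈ M.regular) (g : Pt n → E) :
    fderivWithin ℝ g (Icc a b) x = fderivWithin ℝ g (M.closedElem J) x := by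
  have h : 𝓝[M.closedElem J] x = 𝓝[Icc a b] x :=
    le_antisymm (nhdsWithin_mono _ (M.closedElem_subset J))
      (nhdsWithin_le_iff.2 (M.closedElem_mem_nhdsWithin hx hr))
  refine fderivWithin_congr_set ?_
  rw [nhdsWithin_eq_iff_eventuallyEq] at h
  exact h.symm

theorem hasFDerivWithinAt_of_regular {E : Type*} [NormedAddCommGroup E] [NormedSpace ℝ E]
    {J : M.Elem} {x : Pt n} (hx : x ∈ M.closedElem J) (hr : x ∈ M.regular) {g : Pt n → E}
    (hg : ContDiffOn ℝ 1 g (M.closedElem J)) :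
    HasFDerivWithinAt g (fderivWithin ℝ g (Icc a b) x) (Icc a b) x := by
  have := (hg.differentiableOn one_ne_zero x hx).hasFDerivWithinAt
  rw [← M.fderivWithin_eq_of_regular hx hr] at this
  exact this.mono_of_mem_nhdsWithin (M.closedElem_mem_nhdsWithin hx hr)

/-! ### Piecewise continuous functions -/

/-- Functions that agree on each element, off the internal knot planes, with a function continuous
on the closed element. -/
def PwCont (g : Pt n → ℝ) : Prop :=
  ∀ J : M.Elem, ∃ g' : Pt n → ℝ, ContinuousOn g' (M.closedElem J) ∧
    ∀ x ∈ M.closedElem J, x ∈ M.regular → g x = g' x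

variable {M}

theorem PwCont.of_continuousOn {g : Pt n → ℝ} (hg : ContinuousOn g (Icc a b)) : M.PwCont g :=
  fun J => ⟨g, hg.mono (M.closedElem_subset J), fun _ _ _ => rfl⟩

theorem PwCont.const (c : ℝ) : M.PwCont fun _ => c := .of_continuousOn continuousOn_const

theorem PwCont.add {f g : Pt n → ℝ} (hf : M.PwCont f) (hg : M.PwCont g) :
    M.PwCont fun x => f x + g x := fun J => by
  obtain ⟨f', hf', ef⟩ := hf J
  obtain ⟨g', hg', eg⟩ := hg J
  exact ⟨fun x => f' x + g' x, hf'.add hg', fun x hx hr => by simp only [ef x hx hr, eg x hx hr]⟩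

theorem PwCont.mul {f g : Pt n → ℝ} (hf : M.PwCont f) (hg : M.PwCont g) :
    M.PwCont fun x => f x * g x := fun J => by
  obtain ⟨f', hf', ef⟩ := hf J
  obtain ⟨g', hg', eg⟩ := hg J
  exact ⟨fun x => f' x * g' x, hf'.mul hg', fun x hx hr => by simp only [ef x hx hr, eg x hx hr]⟩

theorem PwCont.sum {ι : Type*} {s : Finset ι} {f : ι → Pt n → ℝ} (hf : ∀ i ∈ s, M.PwCont (f i)) :
    M.PwCont fun x => ∑ i ∈ s, f i x := fun J => by
  choose! f' hf' ef using fun i hi => hf i hi J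
  exact ⟨fun x => ∑ i ∈ s, f' i x, continuousOn_finsetSum _ fun i hi => hf' i hi,
    fun x hx hr => Finset.sum_congr rfl fun i hi => ef i hi x hx hr⟩

theorem PwCont.sq {f : Pt n → ℝ} (hf : M.PwCont f) : M.PwCont fun x => f x ^ 2 := by
  simpa only [pow_two] using hf.mul hf

theorem PwCont.congr {f g : Pt n → ℝ} (hf : M.PwCont f)
    (h : ∀ x ∈ Icc a b, x ∈ M.regular → g x = f x) : M.PwCont g := fun J => by
  obtain ⟨f', hf', ef⟩ := hf J
  exact ⟨f', hf', fun x hx hr => (h x (M.closedElem_subset J hx) hr).trans (ef x hx hr)⟩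

theorem PwCont.exists_bound {g : Pt n → ℝ} (hg : M.PwCont g) :
    ∃ C : ℝ, ∀ x ∈ Icc a b, x ∈ M.regular → |g x| ≤ C := by
  choose g' hg' eg using hg
  choose C hC using fun J => (M.isCompact_closedElem J).exists_bound_of_continuousOn (hg' J)
  obtain ⟨C', hC'⟩ := (Set.finite_range C).bddAbove
  refine ⟨C', fun x hx hr => ?_⟩
  obtain ⟨J, hJ⟩ := mem_iUnion.1 (M.Icc_subset_iUnion hx)
  rw [eg J x hJ hr]
  exact (hC J x hJ).trans (hC' ⟨J, rfl⟩)

theorem PwCont.continuousOn {g : Pt n → ℝ} (hg : M.PwCont g) :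
    ContinuousOn g (Icc a b ∩ M.regular) := by
  rintro x ⟨hx, hr⟩
  obtain ⟨J, hJ⟩ := mem_iUnion.1 (M.Icc_subset_iUnion hx)
  obtain ⟨g', hg', eg⟩ := hg J
  have h1 : ContinuousWithinAt g' (M.closedElem J ∩ M.regular) x :=
    (hg' x hJ).mono inter_subset_left
  have h2 : ContinuousWithinAt g (M.closedElem J ∩ M.regular) x :=
    h1.congr (fun z hz => eg z hz.1 hz.2) (eg x hJ hr)
  refine h2.mono_of_mem_nhdsWithin ?_
  exact inter_mem (nhdsWithin_mono _ inter_subset_left (M.closedElem_mem_nhdsWithin hJ hr))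
    (mem_of_superset self_mem_nhdsWithin inter_subset_right)

/-- Continuity is asked only on a subset of full measure, because derivatives have no controlled
values on the internal knot planes. -/
theorem integrableOn_of_continuousOn_inter {X : Type*} [TopologicalSpace X] [MeasurableSpace X]
    [OpensMeasurableSpace X] [SecondCountableTopology X] {μ : Measure X} {s R : Set X}
    (hs : MeasurableSet s) (hsf : μ s ≠ ⊤) (hR : ∀ᵐ x ∂μ, x ∈ R)
    {g : X → ℝ} (hg : ContinuousOn g (s ∩ R)) {C : ℝ} (hC : ∀ x ∈ s, x ∈ R → |g x| ≤ C)
    (hRm : MeasurableSet R) : IntegrableOn g s μ := by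
  have hae : (s ∩ R : Set X) =ᵐ[μ] s := inter_ae_eq_left_of_ae_eq_univ (eventuallyEq_univ.2 hR)
  have h1 : IntegrableOn g (s ∩ R) μ := by
    refine IntegrableOn.of_bound ((measure_mono inter_subset_left).trans_lt hsf.lt_top)
      (hg.aestronglyMeasurable (hs.inter hRm)) C ?_
    filter_upwards [ae_restrict_mem (hs.inter hRm)] with x hx using hC x hx.1 hx.2
  exact h1.congr_set_ae hae.symm

theorem isOpen_regular : IsOpen M.regular := by
  have : M.regular = ⋂ l, ⋂ j : Fin (M.N l + 1), {x : Pt n | j ≠ 0 → j ≠ Fin.last _ →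
      x l ≠ M.knot l j} := by
    ext x; simp [regular]
  rw [this]
  refine isOpen_iInter_of_finite fun l => isOpen_iInter_of_finite fun j => ?_
  by_cases h : j ≠ 0 ∧ j ≠ Fin.last _
  · simp only [h, ne_eq, not_false_eq_true, forall_const]
    exact isOpen_ne_fun (continuous_apply l) continuous_const
  · convert isOpen_univ
    ext x
    simp only [mem_ofPred_eq, mem_univ, iff_true]
    exact fun h1 h2 => absurd ⟨h1, h2⟩ h

theorem PwCont.integrableOn {g : Pt n → ℝ} (hg : M.PwCont g) : IntegrableOn g (Icc a b) := by
  obtain ⟨C, hC⟩ := hg.exists_bound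
  exact integrableOn_of_continuousOn_inter measurableSet_Icc isCompact_Icc.measure_ne_top
    M.ae_mem_regular hg.continuousOn hC isOpen_regular.measurableSet

/-! ### Slicing piecewise continuous functions along faces and coordinate lines. -/

theorem insertNth_mem_Icc {i : Fin (n + 1)} {t : ℝ} {y : Fin n → ℝ} :
    (i.insertNth t y : Pt n) ∈ Icc a b ↔ t ∈ Icc (a i) (b i) ∧
      y ∈ Icc (fun l => a (i.succAbove l)) (fun l => b (i.succAbove l)) := by
  simp only [mem_Icc, Pi.le_def]
  rw [Fin.forall_iff_succAbove i, Fin.forall_iff_succAbove i (P := fun l => _ ≤ b l)]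
  simp
  tauto

theorem continuous_insertNth (i : Fin (n + 1)) :
    Continuous fun p : ℝ × (Fin n → ℝ) => (i.insertNth p.1 p.2 : Pt n) := by
  refine continuous_pi fun l => ?_
  refine Fin.succAboveCases i ?_ (fun l => ?_) l
  · simpa using continuous_fst
  · simp only [Fin.insertNth_apply_succAbove]
    fun_prop

/-- The two outer faces qualify, since `lineRegular` excludes internal knots only. This is what
gives traces of gradients on the boundary a meaning. -/
theorem PwCont.integrableOn_face {g : Pt n → ℝ} (hg : M.PwCont g) {i : Fin (n + 1)} {c : ℝ}
    (hc : c ∈ Icc (a i) (b i)) (hcr : c ∈ M.lineRegular i) :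
    IntegrableOn (fun y : Fin n → ℝ => g (i.insertNth c y))
      (Icc (fun l => a (i.succAbove l)) fun l => b (i.succAbove l)) := by
  obtain ⟨C, hC⟩ := hg.exists_bound
  have hcont : Continuous fun y : Fin n → ℝ => (i.insertNth c y : Pt n) :=
    (continuous_insertNth i).comp (Continuous.prodMk_right c)
  have hR : M.faceRegular i = (fun y : Fin n → ℝ => (i.insertNth c y : Pt n)) ⁻¹' M.regular := by
    ext y
    rw [mem_preimage, M.insertNth_mem_regular]
    exact ⟨fun h => ⟨hcr, h⟩, fun h => h.2⟩
  refine integrableOn_of_continuousOn_inter measurableSet_Icc isCompact_Icc.measure_ne_top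
    (M.ae_mem_faceRegular i) (hg.continuousOn.comp hcont.continuousOn ?_) (C := C) ?_ ?_
  · exact fun y hy => ⟨insertNth_mem_Icc.2 ⟨hc, hy.1⟩, M.insertNth_mem_regular.2 ⟨hcr, hy.2⟩⟩
  · exact fun y hy hr => hC _ (insertNth_mem_Icc.2 ⟨hc, hy⟩) (M.insertNth_mem_regular.2 ⟨hcr, hr⟩)
  · rw [hR]; exact (isOpen_regular.preimage hcont).measurableSet

theorem PwCont.integrableOn_line {g : Pt n → ℝ} (hg : M.PwCont g) {i : Fin (n + 1)}
    {y : Fin n → ℝ} (hy : y ∈ Icc (fun l => a (i.succAbove l)) fun l => b (i.succAbove l))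
    (hyr : y ∈ M.faceRegular i) :
    IntegrableOn (fun t : ℝ => g (i.insertNth t y)) (Icc (a i) (b i)) := by
  obtain ⟨C, hC⟩ := hg.exists_bound
  have hcont : Continuous fun t : ℝ => (i.insertNth t y : Pt n) :=
    (continuous_insertNth i).comp (Continuous.prodMk_left y)
  have hR : M.lineRegular i = (fun t : ℝ => (i.insertNth t y : Pt n)) ⁻¹' M.regular := by
    ext t
    rw [mem_preimage, M.insertNth_mem_regular]
    exact ⟨fun h => ⟨h, hyr⟩, fun h => h.1⟩
  refine integrableOn_of_continuousOn_inter measurableSet_Icc isCompact_Icc.measure_ne_top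
    (M.ae_mem_lineRegular i) (hg.continuousOn.comp hcont.continuousOn ?_) (C := C) ?_ ?_
  · exact fun t ht => ⟨insertNth_mem_Icc.2 ⟨ht.1, hy⟩, M.insertNth_mem_regular.2 ⟨ht.2, hyr⟩⟩
  · exact fun t ht hr => hC _ (insertNth_mem_Icc.2 ⟨ht, hy⟩) (M.insertNth_mem_regular.2 ⟨hr, hyr⟩)
  · rw [hR]; exact (isOpen_regular.preimage hcont).measurableSet

/-! ### Partial derivatives on the box and the fundamental theorem of calculus on lines. -/

/-- The partial derivative on the closed box. -/
def _root_.SkelStab.partialDeriv (a b : Pt n) (k : Fin (n + 1)) (g : Pt n → ℝ) (x : Pt n) : ℝ :=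
  fderivWithin ℝ g (Icc a b) x (Pi.single k 1)

theorem pwCont_partialDeriv {g : Pt n → ℝ} (hg : ∀ J : M.Elem, ContDiffOn ℝ 1 g (M.closedElem J))
    (k : Fin (n + 1)) : M.PwCont (partialDeriv a b k g) := fun J =>
  ⟨fun x => fderivWithin ℝ g (M.closedElem J) x (Pi.single k 1),
    ((hg J).continuousOn_fderivWithin (M.uniqueDiffOn_closedElem J) le_rfl).clm_apply
      continuousOn_const,
    fun x hx hr => by rw [partialDeriv, M.fderivWithin_eq_of_regular hx hr]⟩

theorem hasDerivAt_insertNth (i : Fin (n + 1)) (y : Fin n → ℝ) (t : ℝ) :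
    HasDerivAt (fun s : ℝ => (i.insertNth s y : Pt n)) (Pi.single i 1) t := by
  refine hasDerivAt_pi.2 fun l => ?_
  refine Fin.succAboveCases i ?_ (fun l => ?_) l
  · simpa using hasDerivAt_id' t
  · simpa using hasDerivAt_const t (y l)

theorem hasDerivAt_line {g : Pt n → ℝ} (hg : ∀ J : M.Elem, ContDiffOn ℝ 1 g (M.closedElem J))
    {i : Fin (n + 1)} {y : Fin n → ℝ}
    (hy : y ∈ Icc (fun l => a (i.succAbove l)) fun l => b (i.succAbove l))
    (hyr : y ∈ M.faceRegular i) {t : ℝ} (ht : t ∈ Ioo (a i) (b i)) (htr : t ∈ M.lineRegular i) :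
    HasDerivAt (fun s => g (i.insertNth s y)) (partialDeriv a b i g (i.insertNth t y)) t := by
  have hx : (i.insertNth t y : Pt n) ∈ Icc a b := insertNth_mem_Icc.2 ⟨Ioo_subset_Icc_self ht, hy⟩
  have hr : (i.insertNth t y : Pt n) ∈ M.regular := M.insertNth_mem_regular.2 ⟨htr, hyr⟩
  obtain ⟨J, hJ⟩ := mem_iUnion.1 (M.Icc_subset_iUnion hx)
  have h1 := M.hasFDerivWithinAt_of_regular hJ hr (hg J)
  have h2 := h1.comp_hasDerivWithinAt t
    (hasDerivAt_insertNth i y t).hasDerivWithinAt (s := Icc (a i) (b i))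
    (fun s hs => insertNth_mem_Icc.2 ⟨hs, hy⟩)
  exact h2.hasDerivAt (Icc_mem_nhds ht.1 ht.2)

/-- The fundamental theorem of calculus on almost every coordinate line. It may skip the finitely
many internal knots because `g` is continuous there, so that no contributions of interior facets
appear. -/
theorem integral_partialDeriv_eq_zero {g : Pt n → ℝ} {i : Fin (n + 1)}
    (hc : ContinuousOn g (Icc a b)) (hg : ∀ J : M.Elem, ContDiffOn ℝ 1 g (M.closedElem J))
    (h0 : ∀ x ∈ Icc a b, x i = a i ∨ x i = b i → g x = 0) :
    ∫ x in Icc a b, partialDeriv a b i g x = 0 := by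
  have hab := M.bounds_lt i
  rw [(integral_Icc_eq_integral_lines i a b _ (pwCont_partialDeriv hg i).integrableOn).2.2]
  refine (setIntegral_congr_ae (g := fun _ => (0 : ℝ)) measurableSet_Icc ?_).trans (by simp)
  filter_upwards [M.ae_mem_faceRegular i] with y hyr hy
  have hint := (pwCont_partialDeriv hg i).integrableOn_line hy hyr
  have h1 := MeasureTheory.integral_eq_of_hasDerivAt_off_countable_of_le
    (fun s => g (i.insertNth s y)) (fun t => partialDeriv a b i g (i.insertNth t y)) hab.le
    (M.countable_lineRegular_compl i)
    (hc.comp ((continuous_insertNth i).comp (Continuous.prodMk_left y)).continuousOn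
      fun s hs => insertNth_mem_Icc.2 ⟨hs, hy⟩)
    (fun t ht => hasDerivAt_line hg hy hyr ht.1 (notMem_compl_iff.1 ht.2))
    ((intervalIntegrable_iff_integrableOn_Icc_of_le hab.le).2 hint)
  rw [intervalIntegral.integral_of_le hab.le, ← integral_Icc_eq_integral_Ioc] at h1
  rw [h1, h0 _ (insertNth_mem_Icc.2 ⟨right_mem_Icc.2 hab.le, hy⟩) (by simp),
    h0 _ (insertNth_mem_Icc.2 ⟨left_mem_Icc.2 hab.le, hy⟩) (by simp), sub_zero]

end ParamMesh

end SkelStab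

end


noncomputable section

namespace SkelStab

/-! ### Tensor product polynomials and splines -/

/-- Polynomials of degree at most `m` in each variable. -/
def polySpace (n m : ℕ) : Submodule ℝ (Pt n → ℝ) :=
  Submodule.span ℝ (range fun e : Fin (n + 1) → Fin (m + 1) => fun x : Pt n => ∏ l, x l ^ (e l : ℕ))

instance (n m : ℕ) : FiniteDimensional ℝ (polySpace n m) :=
  FiniteDimensional.span_of_finite ℝ (finite_range _)

variable {n : ℕ}

theorem prod_eval_mem_polySpace {m : ℕ} {P : Fin (n + 1) → Polynomial ℝ}
    (hP : ∀ l, (P l).natDegree ≤ m) : (fun x : Pt n => ∏ l, (P l).eval (x l)) ∈ polySpace n m := by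
  have : (fun x : Pt n => ∏ l, (P l).eval (x l)) =
      ∑ e : Fin (n + 1) → Fin (m + 1), (∏ l, (P l).coeff (e l)) •
        fun x : Pt n => ∏ l, x l ^ (e l : ℕ) := by
    funext x
    simp only [Finset.sum_apply, Pi.smul_apply, smul_eq_mul, ← Finset.prod_mul_distrib]
    rw [← Fintype.piFinset_univ, Finset.sum_prod_piFinset (Finset.univ : Finset (Fin (m + 1)))
      (fun l j => (P l).coeff (j : ℕ) * x l ^ (j : ℕ))]
    refine Finset.prod_congr rfl fun l _ => ?_
    rw [Polynomial.eval_eq_sum_range' (Nat.lt_succ_of_le (hP l)), Finset.sum_range]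
  rw [this]
  exact Submodule.sum_mem _ fun e _ => Submodule.smul_mem _ _ (Submodule.subset_span ⟨e, rfl⟩)

theorem contDiff_of_mem_polySpace {m : ℕ} {g : Pt n → ℝ} (hg : g ∈ polySpace n m) {r : WithTop ℕ∞} :
    ContDiff ℝ r g := by
  induction hg using Submodule.span_induction with
  | mem g h =>
    obtain ⟨e, rfl⟩ := h
    exact contDiff_prod fun l _ => (contDiff_apply ℝ ℝ l).pow _
  | zero => exact contDiff_const
  | add f g _ _ hf hg => exact hf.add hg
  | smul c f _ hf => exact contDiff_const.smul hf

/-- Differentiation lowers one exponent and leaves the others, so the bound `m` on each exponent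
survives. The inverse inequality can thus treat `w` and `Dw` with one constant. -/
theorem fderiv_mem_polySpace {m : ℕ} {g : Pt n → ℝ} (hg : g ∈ polySpace n m) (k : Fin (n + 1)) :
    (fun x => fderiv ℝ g x (Pi.single k 1)) ∈ polySpace n m := by
  have hd : ∀ {g : Pt n → ℝ}, g ∈ polySpace n m → ∀ x, DifferentiableAt ℝ g x := fun hg x =>
    (contDiff_of_mem_polySpace hg (r := 1)).differentiable one_ne_zero x
  induction hg using Submodule.span_induction with
  | mem g h =>
    obtain ⟨e, rfl⟩ := h
    let P : Fin (n + 1) → Polynomial ℝ := fun l =>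
      if l = k then Polynomial.derivative (Polynomial.X ^ (e l : ℕ)) else Polynomial.X ^ (e l : ℕ)
    have hP : ∀ l, (P l).natDegree ≤ m := by
      intro l
      have := (e l).2
      simp only [P]
      split_ifs
      · refine (Polynomial.natDegree_derivative_le _).trans ?_
        rw [Polynomial.natDegree_X_pow]; omega
      · rw [Polynomial.natDegree_X_pow]; omega
    convert! prod_eval_mem_polySpace hP using 1
    funext x
    have h1 : HasFDerivAt (fun x : Pt n => ∏ l, x l ^ (e l : ℕ))
        (∑ l, (∏ j ∈ Finset.univ.erase l, x j ^ (e j : ℕ)) •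
          (((e l : ℕ) * x l ^ ((e l : ℕ) - 1) : ℝ) •
            (ContinuousLinearMap.proj l : Pt n →L[ℝ] ℝ))) x := by
      refine HasFDerivAt.finsetProd fun l _ => ?_
      have h0 : HasFDerivAt (fun x : Pt n => x l) (ContinuousLinearMap.proj l : Pt n →L[ℝ] ℝ) x :=
        hasFDerivAt_apply l x
      exact HasDerivAt.comp_hasFDerivAt (f := fun x : Pt n => x l) x
        (hasDerivAt_pow (e l : ℕ) (x l)) h0
    rw [h1.fderiv]
    simp only [sum_apply, smul_apply,
      ContinuousLinearMap.proj_apply, smul_eq_mul]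
    rw [Finset.sum_eq_single k (fun l _ hl => by simp [hl]) (by simp)]
    rw [← Finset.mul_prod_erase _ _ (Finset.mem_univ k)]
    simp only [P, if_true, Pi.single_eq_same, mul_one]
    rw [mul_comm]
    congr 1
    · rw [Polynomial.derivative_X_pow]; simp
    · refine Finset.prod_congr rfl fun l hl => ?_
      simp [Finset.ne_of_mem_erase hl]
  | zero =>
    have : (fun x : Pt n => fderiv ℝ (0 : Pt n → ℝ) x (Pi.single k 1)) = 0 := by
      funext x; simp
    rw [this]
    exact Submodule.zero_mem _
  | add f g hf hg ihf ihg =>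
    have : (fun x : Pt n => fderiv ℝ (f + g) x (Pi.single k 1)) =
        (fun x => fderiv ℝ f x (Pi.single k 1)) + fun x => fderiv ℝ g x (Pi.single k 1) := by
      funext x
      rw [fderiv_add (hd hf x) (hd hg x)]; rfl
    rw [this]
    exact Submodule.add_mem _ ihf ihg
  | smul c f hf ih =>
    have : (fun x : Pt n => fderiv ℝ (c • f) x (Pi.single k 1)) =
        c • fun x => fderiv ℝ f x (Pi.single k 1) := by
      funext x
      rw [fderiv_const_smul (hd hf x)]; rfl
    rw [this]
    exact Submodule.smul_mem _ _ ih

theorem exists_polynomial_line {m : ℕ} {g : Pt n → ℝ} (hg : g ∈ polySpace n m) (i : Fin (n + 1))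
    (y : Fin n → ℝ) : ∃ P : Polynomial ℝ, P.natDegree ≤ m ∧
      ∀ t, g (i.insertNth t y) = P.eval t := by
  induction hg using Submodule.span_induction with
  | mem g h =>
    obtain ⟨e, rfl⟩ := h
    refine ⟨Polynomial.C (∏ l, y l ^ (e (i.succAbove l) : ℕ)) * Polynomial.X ^ (e i : ℕ), ?_, ?_⟩
    · have := (e i).2
      exact (Polynomial.natDegree_C_mul_X_pow_le _ _).trans (by omega)
    · intro t
      simp only
      rw [Fin.prod_univ_succAbove _ i]
      simp only [Fin.insertNth_apply_same, Fin.insertNth_apply_succAbove, Polynomial.eval_mul,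
        Polynomial.eval_C, Polynomial.eval_pow, Polynomial.eval_X, mul_comm]
  | zero => exact ⟨0, by simp, by simp⟩
  | add f g _ _ hf hg =>
    obtain ⟨P, hP, eP⟩ := hf
    obtain ⟨Q, hQ, eQ⟩ := hg
    exact ⟨P + Q, Polynomial.natDegree_add_le_of_degree_le hP hQ, fun t => by simp [eP, eQ]⟩
  | smul c f _ hf =>
    obtain ⟨P, hP, eP⟩ := hf
    exact ⟨Polynomial.C c * P, (Polynomial.natDegree_C_mul_le _ _).trans hP, fun t => by simp [eP]⟩

variable {a b : Pt n} {M : ParamMesh a b}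

theorem continuousOn_of_mem_tensorSplines {p r : Fin (n + 1) → ℕ} {w : Pt n → ℝ}
    (hw : w ∈ tensorSplines M p r) : ContinuousOn w (Icc a b) := by
  induction hw using Submodule.span_induction with
  | mem g h =>
    obtain ⟨s, hs, rfl⟩ := h
    refine continuousOn_finsetProd _ fun l _ => ?_
    refine (hs l).1.continuousOn.comp (continuous_apply l).continuousOn fun x hx => ?_
    rw [M.knot_first, M.knot_last]
    exact ⟨hx.1 l, hx.2 l⟩
  | zero => exact continuousOn_const
  | add f g _ _ hf hg => exact hf.add hg
  | smul c f _ hf => exact continuousOn_const.smul hf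

/-- The different degrees in the different directions are replaced by a common upper bound; only
that bound enters the constants. -/
theorem exists_polySpace_eqOn {p r : Fin (n + 1) → ℕ} {m : ℕ} (hp : ∀ l, p l ≤ m) {w : Pt n → ℝ}
    (hw : w ∈ tensorSplines M p r) (J : M.Elem) :
    ∃ g ∈ polySpace n m, EqOn w g (M.closedElem J) := by
  induction hw using Submodule.span_induction with
  | mem g h =>
    obtain ⟨s, hs, rfl⟩ := h
    choose P hP hPe using fun l => (hs l).2 (J l)
    refine ⟨_, prod_eval_mem_polySpace fun l => (hP l).trans (hp l), fun x hx => ?_⟩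
    exact Finset.prod_congr rfl fun l _ => hPe l (x l) ⟨hx.1 l, hx.2 l⟩
  | zero => exact ⟨0, Submodule.zero_mem _, fun _ _ => rfl⟩
  | add f g _ _ hf hg =>
    obtain ⟨f', hf', ef⟩ := hf
    obtain ⟨g', hg', eg⟩ := hg
    exact ⟨f' + g', Submodule.add_mem _ hf' hg', fun x hx => by
      simp [ef hx, eg hx]⟩
  | smul c f _ hf =>
    obtain ⟨f', hf', ef⟩ := hf
    exact ⟨c • f', Submodule.smul_mem _ _ hf', fun x hx => by simp [ef hx]⟩

end SkelStab

end


noncomputable section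

namespace SkelStab

/-! ### The geometric mapping -/

/-- A regular `C¹` parametrization over a nondegenerate box. -/
structure RegularMap {n : ℕ} (a b : Pt n) (F : Pt n → Pt n) : Prop where
  lt : ∀ i, a i < b i
  contDiffOn : ContDiffOn ℝ 1 F (Icc a b)
  injOn : InjOn F (Icc a b)
  det_ne_zero : ∀ x ∈ Icc a b, (jac a b F x).det ≠ 0

theorem IsParametrization.regularMap {n : ℕ} {a b : Pt n} {F : Pt n → Pt n} {α : ℕ}
    (hF : IsParametrization a b F α) (hab : ∀ i, a i < b i) : RegularMap a b F where
  lt := hab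
  contDiffOn := hF.contDiffOn.of_le (by norm_cast; omega)
  injOn := hF.injOn
  det_ne_zero := hF.det_ne_zero

/-- The matrix `(det DF)⁻¹ DF` of the Piola transform. -/
def piola {n : ℕ} (a b : Pt n) (F : Pt n → Pt n) (x : Pt n) :
    Matrix (Fin (n + 1)) (Fin (n + 1)) ℝ :=
  (jac a b F x).det⁻¹ • jac a b F x

variable {n : ℕ} {a b : Pt n} {F : Pt n → Pt n}

theorem jac_apply (x : Pt n) (i j : Fin (n + 1)) :
    jac a b F x i j = fderivWithin ℝ F (Icc a b) x (Pi.single j 1) i := by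
  rw [jac, LinearMap.toMatrix'_apply]; rfl

theorem jac_mulVec (x v : Pt n) : (jac a b F x).mulVec v = fderivWithin ℝ F (Icc a b) x v := by
  rw [jac, LinearMap.toMatrix'_mulVec]; rfl

theorem jac_det (x : Pt n) : (fderivWithin ℝ F (Icc a b) x).det = (jac a b F x).det := by
  rw [jac, LinearMap.det_toMatrix']

namespace RegularMap

variable (hF : RegularMap a b F)

theorem uniqueDiffOn (hF : RegularMap a b F) : UniqueDiffOn ℝ (Icc a b) := uniqueDiffOn_Icc_pi hF.lt

theorem hasFDerivWithinAt (hF : RegularMap a b F) {x : Pt n} (hx : x ∈ Icc a b) :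
    HasFDerivWithinAt F (fderivWithin ℝ F (Icc a b) x) (Icc a b) x :=
  (hF.contDiffOn.differentiableOn one_ne_zero x hx).hasFDerivWithinAt

theorem continuousOn_jac (hF : RegularMap a b F) (i j : Fin (n + 1)) :
    ContinuousOn (fun x => jac a b F x i j) (Icc a b) := by
  simp only [jac_apply]
  exact (continuous_apply i).comp_continuousOn
    ((hF.contDiffOn.continuousOn_fderivWithin hF.uniqueDiffOn le_rfl).clm_apply continuousOn_const)

theorem continuousOn_jac' (hF : RegularMap a b F) : ContinuousOn (jac a b F) (Icc a b) :=
  continuousOn_pi.2 fun i => continuousOn_pi.2 fun j => hF.continuousOn_jac i j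

theorem continuousOn_det (hF : RegularMap a b F) :
    ContinuousOn (fun x => (jac a b F x).det) (Icc a b) :=
  (Continuous.matrix_det continuous_id).comp_continuousOn hF.continuousOn_jac'

theorem continuousOn_inv (hF : RegularMap a b F) (i j : Fin (n + 1)) :
    ContinuousOn (fun x => (jac a b F x)⁻¹ i j) (Icc a b) := by
  have h1 : ContinuousOn (fun x => (jac a b F x).adjugate) (Icc a b) :=
    (Continuous.matrix_adjugate continuous_id).comp_continuousOn hF.continuousOn_jac'
  have h2 : ContinuousOn (fun x => (jac a b F x).adjugate i j) (Icc a b) :=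
    (continuous_apply_apply i j).comp_continuousOn h1
  simp only [Matrix.inv_def, Matrix.smul_apply, smul_eq_mul, Ring.inverse_eq_inv']
  exact (hF.continuousOn_det.inv₀ hF.det_ne_zero).mul h2

theorem continuousOn_piola (hF : RegularMap a b F) (i j : Fin (n + 1)) :
    ContinuousOn (fun x => piola a b F x i j) (Icc a b) :=
  (hF.continuousOn_det.inv₀ hF.det_ne_zero).mul (hF.continuousOn_jac i j)

theorem contDiffOn_jac (hF : RegularMap a b F) {M : ParamMesh a b} {J : M.Elem}
    (hJ : ContDiffOn ℝ 2 F (M.closedElem J)) (i j : Fin (n + 1)) :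
    ContDiffOn ℝ 1 (fun x => jac a b F x i j) (M.closedElem J) := by
  have h1 : ContDiffOn ℝ 1 (fderivWithin ℝ F (M.closedElem J)) (M.closedElem J) :=
    hJ.fderivWithin (M.uniqueDiffOn_closedElem J) (by norm_num)
  have h2 : ContDiffOn ℝ 1 (fun x => fderivWithin ℝ F (M.closedElem J) x (Pi.single j 1) i)
      (M.closedElem J) :=
    (contDiff_apply ℝ ℝ i).comp_contDiffOn (h1.clm_apply contDiffOn_const)
  refine h2.congr fun x hx => ?_
  rw [jac_apply, ((hF.hasFDerivWithinAt (M.closedElem_subset J hx)).mono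
    (M.closedElem_subset J)).fderivWithin (M.uniqueDiffOn_closedElem J x hx)]

theorem contDiffOn_det (hF : RegularMap a b F) {M : ParamMesh a b} {J : M.Elem}
    (hJ : ContDiffOn ℝ 2 F (M.closedElem J)) :
    ContDiffOn ℝ 1 (fun x => (jac a b F x).det) (M.closedElem J) := by
  simp only [Matrix.det_apply']
  exact ContDiffOn.sum fun σ _ => contDiffOn_const.mul
    (contDiffOn_prod fun i _ => hF.contDiffOn_jac hJ _ _)

theorem contDiffOn_piola (hF : RegularMap a b F) {M : ParamMesh a b} {J : M.Elem}
    (hJ : ContDiffOn ℝ 2 F (M.closedElem J)) (i j : Fin (n + 1)) :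
    ContDiffOn ℝ 1 (fun x => piola a b F x i j) (M.closedElem J) :=
  ((hF.contDiffOn_det hJ).inv fun x hx => hF.det_ne_zero x (M.closedElem_subset J hx)).mul
    (hF.contDiffOn_jac hJ i j)

theorem isUnit_det (hF : RegularMap a b F) {x : Pt n} (hx : x ∈ Icc a b) :
    IsUnit (jac a b F x).det := isUnit_iff_ne_zero.2 (hF.det_ne_zero x hx)

theorem exists_antilipschitz (hF : RegularMap a b F) :
    ∃ c : ℝ, 0 < c ∧ ∀ x ∈ Icc a b, ∀ y ∈ Icc a b, c * ‖x - y‖ ≤ ‖F x - F y‖ := by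
  refine exists_pos_mul_norm_sub_le isCompact_Icc (convex_Icc a b) hF.uniqueDiffOn
    hF.contDiffOn hF.injOn fun x hx => ?_
  have := (fderivWithin ℝ F (Icc a b) x).toContinuousLinearEquivOfDetNeZero
    (by rw [jac_det]; exact hF.det_ne_zero x hx) |>.injective
  intro v w h
  apply this
  simpa using h

theorem continuousOn_invFunOn (hF : RegularMap a b F) :
    ContinuousOn (Function.invFunOn F (Icc a b)) (closedDomain a b F) := by
  obtain ⟨c, hc, h⟩ := hF.exists_antilipschitz
  refine LipschitzOnWith.continuousOn (K := ⟨c⁻¹, by positivity⟩) ?_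
  refine LipschitzOnWith.of_dist_le_mul fun p hp q hq => ?_
  have h1 := h _ (Function.invFunOn_mem hp) _ (Function.invFunOn_mem hq)
  rw [Function.invFunOn_eq hp, Function.invFunOn_eq hq] at h1
  rw [dist_eq_norm, dist_eq_norm]
  change _ ≤ c⁻¹ * _
  rwa [inv_mul_eq_div, le_div_iff₀' hc]

theorem invFunOn_apply (hF : RegularMap a b F) {x : Pt n} (hx : x ∈ Icc a b) :
    Function.invFunOn F (Icc a b) (F x) = x :=
  hF.injOn.leftInvOn_invFunOn hx

/-- The derivative of `F` as an isomorphism. -/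
def derivEquiv (hF : RegularMap a b F) {x : Pt n} (hx : x ∈ Icc a b) : Pt n ≃L[ℝ] Pt n :=
  (fderivWithin ℝ F (Icc a b) x).toContinuousLinearEquivOfDetNeZero
    (by rw [jac_det]; exact hF.det_ne_zero x hx)

theorem derivEquiv_symm_apply (hF : RegularMap a b F) {x : Pt n} (hx : x ∈ Icc a b) (v : Pt n) :
    (hF.derivEquiv hx).symm v = (jac a b F x)⁻¹.mulVec v := by
  rw [ContinuousLinearEquiv.symm_apply_eq]
  change _ = fderivWithin ℝ F (Icc a b) x _
  rw [← jac_mulVec, Matrix.mulVec_mulVec, Matrix.mul_nonsing_inv _ (hF.isUnit_det hx),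
    Matrix.one_mulVec]

/-- Holds also at boundary points, where the inverse function theorem is not available: the inverse
is continuous by the lower Lipschitz bound, and a continuous left inverse of a map with invertible
derivative is differentiable. -/
theorem hasFDerivWithinAt_invFunOn (hF : RegularMap a b F) {x : Pt n} (hx : x ∈ Icc a b) :
    HasFDerivWithinAt (Function.invFunOn F (Icc a b))
      ((hF.derivEquiv hx).symm : Pt n →L[ℝ] Pt n) (closedDomain a b F) (F x) := by
  have hmem : F x ∈ closedDomain a b F := mem_image_of_mem F hx
  refine HasFDerivWithinAt.of_local_left_inverse (f := F) (t := Icc a b) ?_ ?_ hmem ?_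
  · refine tendsto_nhdsWithin_iff.2 ⟨hF.continuousOn_invFunOn _ hmem, ?_⟩
    filter_upwards [self_mem_nhdsWithin] with p hp using Function.invFunOn_mem hp
  · rw [hF.invFunOn_apply hx]
    exact hF.hasFDerivWithinAt hx
  · filter_upwards [self_mem_nhdsWithin] with p hp using Function.invFunOn_eq hp

/-- Makes the derivative from inside the domain well determined on its boundary, hence `grad`
computable there. -/
theorem uniqueDiffWithinAt_closedDomain (hF : RegularMap a b F) {x : Pt n} (hx : x ∈ Icc a b) :
    UniqueDiffWithinAt ℝ (closedDomain a b F) (F x) :=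
  HasFDerivWithinAt.uniqueDiffWithinAt_of_continuousLinearEquiv (hF.derivEquiv hx)
    (hF.hasFDerivWithinAt hx) (hF.uniqueDiffOn x hx)

theorem hasFDerivWithinAt_closedDomain (hF : RegularMap a b F) {x : Pt n} (hx : x ∈ Icc a b)
    {u : Pt n → Pt n} {D : Pt n →L[ℝ] Pt n}
    (hu : HasFDerivWithinAt (fun z => u (F z)) D (Icc a b) x) :
    HasFDerivWithinAt u (D.comp ((hF.derivEquiv hx).symm : Pt n →L[ℝ] Pt n))
      (closedDomain a b F) (F x) := by
  have h1 := HasFDerivWithinAt.comp (F x) (g := fun z => u (F z)) (t := Icc a b) (g' := D)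
    (by rw [hF.invFunOn_apply hx]; exact hu) (hF.hasFDerivWithinAt_invFunOn hx)
    fun p hp => Function.invFunOn_mem hp
  refine h1.congr (fun p hp => ?_) ?_
  · simp only [Function.comp]; rw [Function.invFunOn_eq hp]
  · simp only [Function.comp]; rw [hF.invFunOn_apply hx]

/-- The chain rule `∇u = DF⁻ᵀ D(u ∘ F)ᵀ`, valid up to the boundary. Differentiability of `u` itself
is derived from that of the pullback. -/
theorem grad_apply (hF : RegularMap a b F) {x : Pt n} (hx : x ∈ Icc a b) {u : Pt n → Pt n}
    (hu : ∀ j, DifferentiableWithinAt ℝ (fun z => u (F z) j) (Icc a b) x) (i j : Fin (n + 1)) :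
    grad a b F u (F x) i j =
      ∑ k, (jac a b F x)⁻¹ k i * partialDeriv a b k (fun z => u (F z) j) x := by
  have hD : HasFDerivWithinAt (fun z => u (F z))
      (ContinuousLinearMap.pi fun j => fderivWithin ℝ (fun z => u (F z) j) (Icc a b) x)
      (Icc a b) x := hasFDerivWithinAt_pi.2 fun j => (hu j).hasFDerivWithinAt
  rw [grad, Matrix.of_apply, (hF.hasFDerivWithinAt_closedDomain hx hD).fderivWithin
    (hF.uniqueDiffWithinAt_closedDomain hx)]
  simp only [ContinuousLinearMap.comp_apply, ContinuousLinearMap.coe_pi',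
    ContinuousLinearEquiv.coe_coe]
  rw [hF.derivEquiv_symm_apply hx, Matrix.mulVec_single_one]
  conv_lhs => rw [← Finset.univ_sum_single ((jac a b F x)⁻¹.col i)]
  rw [map_sum]
  refine Finset.sum_congr rfl fun k _ => ?_
  rw [Matrix.col_apply, partialDeriv, ← smul_eq_mul, ← map_smul]
  congr 1
  ext l
  by_cases h : l = k
  · subst h; simp
  · simp [h]

theorem sum_jac_mul_grad (hF : RegularMap a b F) {x : Pt n} (hx : x ∈ Icc a b) {u : Pt n → Pt n}
    (hu : ∀ j, DifferentiableWithinAt ℝ (fun z => u (F z) j) (Icc a b) x) (k j : Fin (n + 1)) :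
    partialDeriv a b k (fun z => u (F z) j) x =
      ∑ i, jac a b F x i k * grad a b F u (F x) i j := by
  simp only [hF.grad_apply hx hu, Finset.mul_sum]
  rw [Finset.sum_comm]
  simp only [← mul_assoc, ← Finset.sum_mul]
  have h : ∀ l, ∑ i, jac a b F x i k * (jac a b F x)⁻¹ l i = if l = k then 1 else 0 := by
    intro l
    have := congrFun (congrFun (Matrix.nonsing_inv_mul _ (hF.isUnit_det hx)) l) k
    rw [Matrix.mul_apply, Matrix.one_apply] at this
    rw [← this]
    exact Finset.sum_congr rfl fun i _ => mul_comm _ _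
  simp [h]

/-- At interior points of the box the inverse function theorem applies, so `F` maps neighborhoods to
neighborhoods. -/
theorem isOpen_domain (hF : RegularMap a b F) : IsOpen (domain a b F) := by
  refine isOpen_iff_mem_nhds.2 ?_
  rintro _ ⟨x, hx, rfl⟩
  have hxI := paramDomain_subset_Icc hx
  have hnhds : Icc a b ∈ 𝓝 x :=
    mem_of_superset ((isOpen_paramDomain a b).mem_nhds hx) paramDomain_subset_Icc
  have h1 : ContDiffAt ℝ 1 F x := hF.contDiffOn.contDiffAt hnhds
  have h2 : HasStrictFDerivAt F (hF.derivEquiv hxI : Pt n →L[ℝ] Pt n) x := by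
    have := h1.hasStrictFDerivAt one_ne_zero
    rw [← fderivWithin_of_mem_nhds hnhds] at this
    exact this
  rw [← h2.map_nhds_eq_of_equiv]
  exact image_mem_map ((isOpen_paramDomain a b).mem_nhds hx)

theorem domain_subset_closedDomain : domain a b F ⊆ closedDomain a b F :=
  image_mono paramDomain_subset_Icc

theorem isCompact_closedDomain (hF : RegularMap a b F) : IsCompact (closedDomain a b F) :=
  isCompact_Icc.image_of_continuousOn hF.contDiffOn.continuousOn

theorem volume_closedDomain_diff (hF : RegularMap a b F) :
    volume (closedDomain a b F \ domain a b F) = 0 := by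
  have hsub : closedDomain a b F \ domain a b F ⊆ F '' (Icc a b \ paramDomain a b) := by
    rintro _ ⟨⟨x, hx, rfl⟩, h⟩
    exact ⟨x, ⟨hx, fun hx' => h ⟨x, hx', rfl⟩⟩, rfl⟩
  refine measure_mono_null hsub ?_
  refine addHaar_image_eq_zero_of_differentiableOn_of_addHaar_eq_zero volume
    ((hF.contDiffOn.differentiableOn one_ne_zero).mono sdiff_subset) ?_
  exact (ae_eq_set.1 (paramDomain_ae_eq_Icc a b)).2

theorem setIntegral_domain (hF : RegularMap a b F) (g : Pt n → ℝ) :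
    ∫ x in domain a b F, g x = ∫ x in Icc a b, |(jac a b F x).det| * g (F x) := by
  rw [domain, integral_image_eq_integral_abs_det_fderiv_smul volume
    (isOpen_paramDomain a b).measurableSet (f' := fun x => fderivWithin ℝ F (Icc a b) x)
    (fun x hx => (hF.hasFDerivWithinAt (paramDomain_subset_Icc hx)).mono paramDomain_subset_Icc)
    (hF.injOn.mono paramDomain_subset_Icc), setIntegral_congr_set (paramDomain_ae_eq_Icc a b)]
  simp only [jac_det, smul_eq_mul]

/-- The determinant is continuous and nonzero on a connected box, hence of constant sign. This
removes the absolute value of the change of variables wherever the Piola transform brings in `det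
DF` itself. -/
theorem exists_sign (hF : RegularMap a b F) :
    ∃ σ : ℝ, (σ = 1 ∨ σ = -1) ∧ ∀ x ∈ Icc a b, |(jac a b F x).det| = σ * (jac a b F x).det := by
  have hpre : IsPreconnected (Icc a b) := (convex_Icc a b).isPreconnected
  by_cases h : ∃ x ∈ Icc a b, 0 < (jac a b F x).det
  · obtain ⟨x, hx, hpos⟩ := h
    refine ⟨1, Or.inl rfl, fun y hy => ?_⟩
    rw [one_mul, abs_of_pos]
    by_contra hneg
    obtain ⟨z, hz, hz0⟩ := hpre.intermediate_value hy hx hF.continuousOn_det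
      ⟨not_lt.1 hneg, hpos.le⟩
    exact hF.det_ne_zero z hz hz0
  · push Not at h
    refine ⟨-1, Or.inr rfl, fun y hy => ?_⟩
    rw [neg_one_mul, abs_of_nonpos (h y hy)]

end RegularMap

/-! ### Uniform bounds for the geometric mapping -/

/-- Bounds for a parametrization by a single constant. -/
structure GeomBound (a b : Pt n) (F : Pt n → Pt n) (Λ : ℝ) : Prop where
  one_le : 1 ≤ Λ
  det_lower : ∀ x ∈ Icc a b, Λ⁻¹ ≤ |(jac a b F x).det|
  det_upper : ∀ x ∈ Icc a b, |(jac a b F x).det| ≤ Λ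
  jac_le : ∀ x ∈ Icc a b, ∀ i j, |jac a b F x i j| ≤ Λ
  inv_le : ∀ x ∈ Icc a b, ∀ i j, |(jac a b F x)⁻¹ i j| ≤ Λ
  piola_lip : ∀ x ∈ Icc a b, ∀ y ∈ Icc a b, ∀ i j,
    |piola a b F x i j - piola a b F y i j| ≤ Λ * ‖x - y‖
  area_lower : ∀ x ∈ Icc a b, ∀ i, Λ⁻¹ ≤ areaDensity a b F i x
  area_upper : ∀ x ∈ Icc a b, ∀ i, areaDensity a b F i x ≤ Λ
  lip : ∀ x ∈ Icc a b, ∀ y ∈ Icc a b, ‖F x - F y‖ ≤ Λ * ‖x - y‖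
  antilip : ∀ x ∈ Icc a b, ∀ y ∈ Icc a b, ‖x - y‖ ≤ Λ * ‖F x - F y‖

/-- The mesh serves only to produce the constant; the resulting Lipschitz bound on the box no longer
refers to it. In this way second derivatives of `F`, which exist only elementwise, are controlled
uniformly over meshes. -/
theorem ParamMesh.exists_lipschitz {M : ParamMesh a b} {g : Pt n → ℝ}
    (hc : ContinuousOn g (Icc a b)) (hg : ∀ J : M.Elem, ContDiffOn ℝ 1 g (M.closedElem J)) :
    ∃ L : ℝ, 0 ≤ L ∧ ∀ x ∈ Icc a b, ∀ y ∈ Icc a b, |g x - g y| ≤ L * ‖x - y‖ := by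
  choose K hK using fun J => (hg J).exists_lipschitzOnWith one_ne_zero (M.convex_closedElem J)
    (M.isCompact_closedElem J)
  obtain ⟨L, hL⟩ := (finite_range K).bddAbove
  refine ⟨L, L.2, fun x hx y hy => ?_⟩
  refine norm_sub_le_of_cover (S := M.closedElem) (K := Icc a b) (fun J => isClosed_Icc)
    (convex_Icc a b) M.Icc_subset_iUnion hc (fun J z hz _ w hw _ => ?_) hy hx
  refine ((hK J).norm_sub_le hz hw).trans ?_
  exact mul_le_mul_of_nonneg_right (NNReal.coe_le_coe.2 (hL ⟨J, rfl⟩)) (norm_nonneg _)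

namespace RegularMap

theorem euclNorm_conormal_pos (hF : RegularMap a b F) {x : Pt n} (hx : x ∈ Icc a b)
    (i : Fin (n + 1)) : 0 < euclNorm (conormal a b F i x) := by
  refine Real.sqrt_pos.2 (lt_of_le_of_ne ?_ fun h => ?_)
  · exact Finset.sum_nonneg fun j _ => mul_self_nonneg _
  · have h0 : conormal a b F i x = 0 := dotProduct_self_eq_zero.1 h.symm
    have := congrFun (congrFun (Matrix.nonsing_inv_mul _ (hF.isUnit_det hx)) i) i
    rw [Matrix.mul_apply, Matrix.one_apply_eq] at this
    rw [conormal] at h0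
    simp [h0] at this

theorem continuousOn_areaDensity (hF : RegularMap a b F) (i : Fin (n + 1)) :
    ContinuousOn (areaDensity a b F i) (Icc a b) := by
  refine hF.continuousOn_det.abs.mul (ContinuousOn.sqrt ?_)
  exact continuousOn_finsetSum _ fun j _ => (hF.continuousOn_inv i j).mul (hF.continuousOn_inv i j)

theorem exists_bounds_of_pos {X : Type*} [TopologicalSpace X] {K : Set X} (hK : IsCompact K)
    {g : X → ℝ} (hg : ContinuousOn g K) (hpos : ∀ x ∈ K, 0 < g x) :
    ∃ C : ℝ, ∀ Λ, C ≤ Λ → ∀ x ∈ K, Λ⁻¹ ≤ g x ∧ g x ≤ Λ := by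
  obtain ⟨C₁, h₁⟩ := hK.exists_bound_of_continuousOn hg
  obtain ⟨C₂, h₂⟩ := hK.exists_bound_of_continuousOn (hg.inv₀ fun x hx => (hpos x hx).ne')
  refine ⟨max C₁ C₂, fun Λ hΛ x hx => ⟨?_, ?_⟩⟩
  · have h := (h₂ x hx).trans ((le_max_right C₁ C₂).trans hΛ)
    rw [Pi.inv_apply, norm_inv, Real.norm_of_nonneg (hpos x hx).le] at h
    exact inv_le_of_inv_le₀ (hpos x hx) h
  · exact (le_abs_self _).trans ((h₁ x hx).trans ((le_max_left _ _).trans hΛ))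

/-- Each bound holds for all sufficiently large constants, so finitely many of them hold
simultaneously. -/
theorem exists_geomBound (hF : RegularMap a b F) (M : ParamMesh a b)
    (hM : ∀ J : M.Elem, ContDiffOn ℝ 2 F (M.closedElem J)) : ∃ Λ, GeomBound a b F Λ := by
  have hev : ∀ {P : ℝ → Prop}, (∃ C, ∀ Λ, C ≤ Λ → P Λ) → ∀ᶠ Λ in atTop, P Λ := fun ⟨C, hC⟩ =>
    eventually_atTop.2 ⟨C, hC⟩
  have hdet := hev (exists_bounds_of_pos isCompact_Icc hF.continuousOn_det.abs
    fun x hx => abs_pos.2 (hF.det_ne_zero x hx))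
  have harea : ∀ᶠ Λ in atTop, ∀ i, ∀ x ∈ Icc a b, Λ⁻¹ ≤ areaDensity a b F i x ∧
      areaDensity a b F i x ≤ Λ := eventually_all.2 fun i =>
    hev (exists_bounds_of_pos isCompact_Icc (hF.continuousOn_areaDensity i) fun x hx =>
      mul_pos (abs_pos.2 (hF.det_ne_zero x hx)) (hF.euclNorm_conormal_pos hx i))
  have hbd : ∀ {g : Fin (n + 1) → Fin (n + 1) → Pt n → ℝ},
      (∀ i j, ContinuousOn (g i j) (Icc a b)) →
      ∀ᶠ Λ in atTop, ∀ i j, ∀ x ∈ Icc a b, |g i j x| ≤ Λ := fun hg =>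
    eventually_all.2 fun i => eventually_all.2 fun j => by
      obtain ⟨C, hC⟩ := isCompact_Icc.exists_bound_of_continuousOn (hg i j)
      exact eventually_atTop.2 ⟨C, fun Λ h x hx => (hC x hx).trans h⟩
  have hjac := hbd hF.continuousOn_jac
  have hinv := hbd hF.continuousOn_inv
  have hlip : ∀ᶠ Λ in atTop, ∀ i j, ∀ x ∈ Icc a b, ∀ y ∈ Icc a b,
      |piola a b F x i j - piola a b F y i j| ≤ Λ * ‖x - y‖ :=
    eventually_all.2 fun i => eventually_all.2 fun j => by
      obtain ⟨L, _, hL⟩ := M.exists_lipschitz (hF.continuousOn_piola i j)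
        fun J => hF.contDiffOn_piola (hM J) i j
      exact eventually_atTop.2 ⟨L, fun Λ h x hx y hy => (hL x hx y hy).trans (by gcongr)⟩
  have hFlip : ∀ᶠ Λ in atTop, ∀ x ∈ Icc a b, ∀ y ∈ Icc a b, ‖F x - F y‖ ≤ Λ * ‖x - y‖ := by
    obtain ⟨K, hK⟩ := hF.contDiffOn.exists_lipschitzOnWith one_ne_zero (convex_Icc a b) isCompact_Icc
    exact eventually_atTop.2 ⟨K, fun Λ h x hx y hy =>
      (hK.norm_sub_le hx hy).trans (by gcongr)⟩
  have hanti : ∀ᶠ Λ in atTop, ∀ x ∈ Icc a b, ∀ y ∈ Icc a b, ‖x - y‖ ≤ Λ * ‖F x - F y‖ := by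
    obtain ⟨c, hc, h⟩ := hF.exists_antilipschitz
    refine eventually_atTop.2 ⟨c⁻¹, fun Λ hΛ x hx y hy => ?_⟩
    have h1 := h x hx y hy
    calc ‖x - y‖ = c⁻¹ * (c * ‖x - y‖) := by field_simp
      _ ≤ c⁻¹ * ‖F x - F y‖ := by gcongr
      _ ≤ _ := by gcongr
  obtain ⟨Λ, h1, h2, h3, h4, h5, h6, h7, h8⟩ := ((eventually_ge_atTop (1 : ℝ)).and
    (hdet.and (harea.and (hjac.and (hinv.and (hlip.and (hFlip.and hanti))))))).exists
  exact ⟨Λ, h1, fun x hx => (h2 x hx).1, fun x hx => (h2 x hx).2, fun x hx i j => h4 i j x hx,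
    fun x hx i j => h5 i j x hx, fun x hx y hy i j => h6 i j x hx y hy,
    fun x hx i => (h3 i x hx).1, fun x hx i => (h3 i x hx).2, h7, h8⟩

end RegularMap

end SkelStab

end


noncomputable section

namespace SkelStab

variable {n : ℕ} {a b : Pt n}

/-! ### Estimates on slabs -/

/-- The part of the box with `s ≤ x_i ≤ t`. -/
def slab (a b : Pt n) (i : Fin (n + 1)) (s t : ℝ) : Set (Pt n) :=
  Icc (Function.update a i s) (Function.update b i t)

theorem mem_slab {i : Fin (n + 1)} {s t : ℝ} (hs : a i ≤ s) (ht : t ≤ b i) {x : Pt n} :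
    x ∈ slab a b i s t ↔ x ∈ Icc a b ∧ x i ∈ Icc s t := by
  simp only [slab, mem_Icc, Pi.le_def, Function.update_apply]
  constructor
  · rintro ⟨h1, h2⟩
    have h1i := h1 i
    have h2i := h2 i
    simp only [if_true] at h1i h2i
    refine ⟨⟨fun l => ?_, fun l => ?_⟩, h1i, h2i⟩
    · have := h1 l
      split_ifs at this with h
      · subst h; exact hs.trans this
      · exact this
    · have := h2 l
      split_ifs at this with h
      · subst h; exact this.trans ht
      · exact this
  · rintro ⟨⟨h1, h2⟩, h3, h4⟩
    refine ⟨fun l => ?_, fun l => ?_⟩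
    · split_ifs with h
      · subst h; exact h3
      · exact h1 l
    · split_ifs with h
      · subst h; exact h4
      · exact h2 l

theorem slab_subset {i : Fin (n + 1)} {s t : ℝ} (hs : a i ≤ s) (ht : t ≤ b i) :
    slab a b i s t ⊆ Icc a b := fun _ hx => ((mem_slab hs ht).1 hx).1

theorem integral_slab (i : Fin (n + 1)) {s t : ℝ} {g : Pt n → ℝ}
    (hg : IntegrableOn g (slab a b i s t)) :
    IntegrableOn (fun y : Fin n → ℝ => ∫ r in Icc s t, g (i.insertNth r y))
        (Icc (fun l => a (i.succAbove l)) fun l => b (i.succAbove l)) ∧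
      ∫ x in slab a b i s t, g x =
        ∫ y in Icc (fun l => a (i.succAbove l)) fun l => b (i.succAbove l),
          ∫ r in Icc s t, g (i.insertNth r y) := by
  have := integral_Icc_eq_integral_lines i _ _ g hg
  simp only [Function.update_self, Function.update_of_ne (Fin.succAbove_ne i _)] at this
  exact ⟨this.1, this.2.2⟩

namespace ParamMesh

variable {M : ParamMesh a b}

/-- The one-dimensional inequality, starting from the value on the face `x_i = c`, integrated along
and across the lines of the slab. One factor `t - s` comes from Cauchy–Schwarz, another from the
width of the slab. -/
theorem integral_slab_sq_le {g : Pt n → ℝ} (hc : ContinuousOn g (Icc a b))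
    (hg : ∀ J : M.Elem, ContDiffOn ℝ 1 g (M.closedElem J)) {i : Fin (n + 1)} {s t c : ℝ}
    (hs : a i ≤ s) (ht : t ≤ b i) (hcm : c ∈ Icc s t) (hcr : c ∈ M.lineRegular i) :
    ∫ x in slab a b i s t, g x ^ 2 ≤
      2 * (t - s) * (∫ y in Icc (fun l => a (i.succAbove l)) fun l => b (i.succAbove l),
        g (i.insertNth c y) ^ 2) +
      2 * (t - s) ^ 2 * ∫ x in slab a b i s t, partialDeriv a b i g x ^ 2 := by
  have hst : s ≤ t := hcm.1.trans hcm.2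
  have hsub := slab_subset (a := a) (b := b) hs ht
  have hp := pwCont_partialDeriv hg i
  have hgp : M.PwCont g := .of_continuousOn hc
  have h1 := integral_slab (a := a) (b := b) i (hgp.sq.integrableOn.mono_set hsub)
  have h2 := integral_slab (a := a) (b := b) i (hp.sq.integrableOn.mono_set hsub)
  have hface := hgp.sq.integrableOn_face (i := i) (c := c) ⟨hs.trans hcm.1, hcm.2.trans ht⟩ hcr
  rw [h1.2, h2.2, ← integral_const_mul, ← integral_const_mul, ← integral_add
    (hface.const_mul _) (h2.1.const_mul _)]
  refine setIntegral_mono_on_ae h1.1 ((hface.const_mul _).add (h2.1.const_mul _))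
    measurableSet_Icc ?_
  filter_upwards [M.ae_mem_faceRegular i] with y hyr hy
  have hIcc : Icc s t ⊆ Icc (a i) (b i) := Icc_subset_Icc hs ht
  have hline : ContinuousOn (fun r => g (i.insertNth r y)) (Icc s t) :=
    hc.comp ((continuous_insertNth i).comp (Continuous.prodMk_left y)).continuousOn
      fun r hr => insertNth_mem_Icc.2 ⟨hIcc hr, hy⟩
  have hi := (intervalIntegrable_iff_integrableOn_Icc_of_le hst).2
    ((hp.integrableOn_line hy hyr).mono_set hIcc)
  have hi2 := (intervalIntegrable_iff_integrableOn_Icc_of_le hst).2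
    ((hp.sq.integrableOn_line hy hyr).mono_set hIcc)
  have key : ∀ r ∈ Icc s t, g (i.insertNth r y) ^ 2 ≤ 2 * g (i.insertNth c y) ^ 2 +
      2 * (t - s) * ∫ r in Icc s t, partialDeriv a b i g (i.insertNth r y) ^ 2 := by
    intro r hr
    have := sq_le_of_hasDerivAt_off_countable (M.countable_lineRegular_compl i) hr hcm hline
      (g' := fun r => partialDeriv a b i g (i.insertNth r y))
      (fun r hr => hasDerivAt_line hg hy hyr ⟨hs.trans_lt hr.1.1, hr.1.2.trans_le ht⟩
        (notMem_compl_iff.1 hr.2)) hi hi2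
    rwa [intervalIntegral.integral_of_le hst, ← integral_Icc_eq_integral_Ioc] at this
  have h3 := setIntegral_mono_on ((hgp.sq.integrableOn_line hy hyr).mono_set hIcc)
    (integrableOn_const (by simp)) measurableSet_Icc key
  rw [setIntegral_const] at h3
  simp only [Measure.real, Real.volume_Icc, ENNReal.toReal_ofReal (sub_nonneg.2 hst),
    smul_eq_mul] at h3
  calc _ ≤ _ := h3
    _ = _ := by ring

/-- A bound for `g` along coordinate lines gives trace and slab estimates. -/
theorem integral_face_le {q : Pt n → ℝ} (hq : M.PwCont q) {i : Fin (n + 1)} {c C : ℝ}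
    (hcm : c ∈ Icc (a i) (b i)) (hcr : c ∈ M.lineRegular i)
    (hline : ∀ y ∈ Icc (fun l => a (i.succAbove l)) fun l => b (i.succAbove l),
      y ∈ M.faceRegular i → ∀ t ∈ Icc (a i) (b i), t ∈ M.lineRegular i →
        q (i.insertNth t y) ≤ C * ∫ r in Icc (a i) (b i), q (i.insertNth r y)) :
    ∫ y in Icc (fun l => a (i.succAbove l)) fun l => b (i.succAbove l), q (i.insertNth c y) ≤
      C * ∫ x in Icc a b, q x := by
  have h1 := integral_Icc_eq_integral_lines i a b q hq.integrableOn
  rw [h1.2.2, ← integral_const_mul]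
  refine setIntegral_mono_on_ae (hq.integrableOn_face hcm hcr) (h1.1.const_mul _)
    measurableSet_Icc ?_
  filter_upwards [M.ae_mem_faceRegular i] with y hyr hy using hline y hy hyr c hcm hcr

/-- With `C` of order `1 / r`, a slab that is thin compared with `r` carries only a small fraction
of the integral over the box. This is the source of the smallness used for absorption. -/
theorem integral_slab_le {q : Pt n → ℝ} (hq : M.PwCont q) {i : Fin (n + 1)} {s t C : ℝ}
    (hs : a i ≤ s) (ht : t ≤ b i) (hst : s ≤ t)
    (hline : ∀ y ∈ Icc (fun l => a (i.succAbove l)) fun l => b (i.succAbove l),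
      y ∈ M.faceRegular i → ∀ t ∈ Icc (a i) (b i), t ∈ M.lineRegular i →
        q (i.insertNth t y) ≤ C * ∫ r in Icc (a i) (b i), q (i.insertNth r y)) :
    ∫ x in slab a b i s t, q x ≤ (t - s) * C * ∫ x in Icc a b, q x := by
  have hsub := slab_subset (a := a) (b := b) hs ht
  have h1 := integral_Icc_eq_integral_lines i a b q hq.integrableOn
  have h2 := integral_slab (a := a) (b := b) i (hq.integrableOn.mono_set hsub)
  rw [h1.2.2, h2.2, ← integral_const_mul]
  refine setIntegral_mono_on_ae h2.1 (h1.1.const_mul _) measurableSet_Icc ?_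
  filter_upwards [M.ae_mem_faceRegular i] with y hyr hy
  have hIcc : Icc s t ⊆ Icc (a i) (b i) := Icc_subset_Icc hs ht
  have h3 := setIntegral_mono_on_ae ((hq.integrableOn_line hy hyr).mono_set hIcc)
    (integrableOn_const (C := C * ∫ r in Icc (a i) (b i), q (i.insertNth r y)) (by simp))
    measurableSet_Icc (by
      filter_upwards [M.ae_mem_lineRegular i] with r hr hrm using hline y hy hyr r (hIcc hrm) hr)
  rw [setIntegral_const] at h3
  simp only [Measure.real, Real.volume_Icc, ENNReal.toReal_ofReal (sub_nonneg.2 hst),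
    smul_eq_mul] at h3
  rwa [mul_assoc]

end ParamMesh

/-! ### Piecewise polynomial fields -/

/-- `|w|² + |Dw|²` for a field on the box. -/
def sobolevDensity (a b : Pt n) (w : Pt n → Pt n) (x : Pt n) : ℝ :=
  ∑ i, w x i ^ 2 + ∑ k, ∑ i, partialDeriv a b k (fun z => w z i) x ^ 2

theorem sobolevDensity_nonneg (w : Pt n → Pt n) (x : Pt n) : 0 ≤ sobolevDensity a b w x := by
  unfold sobolevDensity; positivity

/-- Continuous fields that are tensor product polynomials of degree `m` on every element. -/
structure IsPwPoly (M : ParamMesh a b) (m : ℕ) (w : Pt n → Pt n) : Prop where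
  continuousOn : ∀ i, ContinuousOn (fun x => w x i) (Icc a b)
  poly : ∀ i J, ∃ g ∈ polySpace n m, EqOn (fun x => w x i) g (M.closedElem J)

variable {M : ParamMesh a b}

theorem IsPwPoly.contDiffOn {m : ℕ} {w : Pt n → Pt n} (hw : IsPwPoly M m w) (i : Fin (n + 1))
    (J : M.Elem) : ContDiffOn ℝ 1 (fun x => w x i) (M.closedElem J) := by
  obtain ⟨g, hg, he⟩ := hw.poly i J
  exact (contDiff_of_mem_polySpace hg).contDiffOn.congr he

theorem IsPwPoly.pwCont_sobolevDensity {m : ℕ} {w : Pt n → Pt n} (hw : IsPwPoly M m w) :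
    M.PwCont (sobolevDensity a b w) :=
  .add (.sum fun i _ => (ParamMesh.PwCont.of_continuousOn (hw.continuousOn i)).sq)
    (.sum fun k _ => .sum fun i _ =>
      (ParamMesh.pwCont_partialDeriv (fun J => hw.contDiffOn i J) k).sq)

/-- On the segment of the line inside one element the density is a sum of squares of univariate
polynomials of degree at most `m`. The polynomial inverse inequality is applied to each square, and
the segment is then enlarged to the whole line by nonnegativity. The constant depends on `m` alone.
-/
theorem exists_line_inverse_ineq (m : ℕ) : ∃ C : ℝ, 0 < C ∧ ∀ {n : ℕ} {a b : Pt n}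
    {M : ParamMesh a b} {w : Pt n → Pt n} (_ : IsPwPoly M m w) {r : ℝ} (_ : 0 < r)
    (_ : ∀ (J : M.Elem) i, r ≤ M.hi J i - M.lo J i) (i : Fin (n + 1)) (y : Fin n → ℝ),
    y ∈ Icc (fun l => a (i.succAbove l)) (fun l => b (i.succAbove l)) → y ∈ M.faceRegular i →
    ∀ t ∈ Icc (a i) (b i), t ∈ M.lineRegular i →
      sobolevDensity a b w (i.insertNth t y) ≤
        C / r * ∫ s in Icc (a i) (b i), sobolevDensity a b w (i.insertNth s y) := by
  obtain ⟨C, hC, h⟩ := exists_sq_eval_le_integral m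
  refine ⟨C, hC, ?_⟩
  intro n a b M w hw r hr hside i y hy hyr t ht htr
  have hx : (i.insertNth t y : Pt n) ∈ Icc a b := ParamMesh.insertNth_mem_Icc.2 ⟨ht, hy⟩
  obtain ⟨J, hJ⟩ := mem_iUnion.1 (M.Icc_subset_iUnion hx)
  choose g hg he using fun l => hw.poly l J
  set s₀ := M.lo J i
  set s₁ := M.hi J i
  have hlt : s₀ < s₁ := M.lo_lt_hi J i
  have hJ' := ParamMesh.insertNth_mem_Icc.1 hJ
  have hmem : ∀ s ∈ Icc s₀ s₁, (i.insertNth s y : Pt n) ∈ M.closedElem J := fun s hs =>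
    ParamMesh.insertNth_mem_Icc.2 ⟨hs, hJ'.2⟩
  choose P hPd hP using fun l => exists_polynomial_line (hg l) i y
  choose Q hQd hQ using fun k l => exists_polynomial_line (fderiv_mem_polySpace (hg l) k) i y
  have hq : ∀ s ∈ Icc s₀ s₁, s ∈ M.lineRegular i → sobolevDensity a b w (i.insertNth s y) =
      ∑ l, (P l).eval s ^ 2 + ∑ k, ∑ l, (Q k l).eval s ^ 2 := by
    intro s hs hsr
    have hz := hmem s hs
    have hzr : (i.insertNth s y : Pt n) ∈ M.regular := M.insertNth_mem_regular.2 ⟨hsr, hyr⟩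
    unfold sobolevDensity
    congr 1
    · refine Finset.sum_congr rfl fun l _ => ?_
      rw [← hP l s, ← he l hz]
    · refine Finset.sum_congr rfl fun k _ => Finset.sum_congr rfl fun l _ => ?_
      rw [← hQ k l s, partialDeriv, M.fderivWithin_eq_of_regular hz hzr,
        fderivWithin_congr (he l) (he l hz),
        ((contDiff_of_mem_polySpace (hg l) (r := 1)).differentiable one_ne_zero _).fderivWithin
          (M.uniqueDiffOn_closedElem J _ hz)]
  have hint : ∀ P : Polynomial ℝ, IntervalIntegrable (fun s => P.eval s ^ 2) volume s₀ s₁ :=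
    fun P => Continuous.intervalIntegrable (by fun_prop) _ _
  have h0 : ∫ s in Icc s₀ s₁, sobolevDensity a b w (i.insertNth s y) =
      ∑ l, (∫ s in s₀..s₁, (P l).eval s ^ 2) + ∑ k, ∑ l, ∫ s in s₀..s₁, (Q k l).eval s ^ 2 := by
    rw [setIntegral_congr_ae (g := fun s => ∑ l, (P l).eval s ^ 2 + ∑ k, ∑ l, (Q k l).eval s ^ 2)
      measurableSet_Icc (by
        filter_upwards [M.ae_mem_lineRegular i] with s hs hsm using hq s hsm hs),
      integral_Icc_eq_integral_Ioc, ← intervalIntegral.integral_of_le hlt.le,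
      intervalIntegral.integral_add, intervalIntegral.integral_finsetSum,
      intervalIntegral.integral_finsetSum]
    · congr 1
      refine Finset.sum_congr rfl fun k _ => ?_
      rw [intervalIntegral.integral_finsetSum]
      exact fun l _ => hint _
    · exact fun k _ => Continuous.intervalIntegrable (by fun_prop) _ _
    · exact fun l _ => hint _
    · exact Continuous.intervalIntegrable (by fun_prop) _ _
    · exact Continuous.intervalIntegrable (by fun_prop) _ _
  have hpos : ∀ P : Polynomial ℝ, 0 ≤ ∫ s in s₀..s₁, P.eval s ^ 2 := fun P =>
    intervalIntegral.integral_nonneg hlt.le fun _ _ => sq_nonneg _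
  have hb : ∀ P : Polynomial ℝ, P.natDegree ≤ m →
      P.eval t ^ 2 ≤ C / r * ∫ s in s₀..s₁, P.eval s ^ 2 := by
    intro P hP
    refine (h P hP s₀ s₁ hlt t hJ'.1).trans ?_
    refine mul_le_mul_of_nonneg_right ?_ (hpos P)
    exact div_le_div_of_nonneg_left hC.le hr (hside J i)
  have hsubI : Icc s₀ s₁ ⊆ Icc (a i) (b i) := by
    intro s hs
    exact (ParamMesh.insertNth_mem_Icc.1 (M.closedElem_subset J (hmem s hs))).1
  calc sobolevDensity a b w (i.insertNth t y)
      = ∑ l, (P l).eval t ^ 2 + ∑ k, ∑ l, (Q k l).eval t ^ 2 := hq t hJ'.1 htr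
    _ ≤ ∑ l, (C / r * ∫ s in s₀..s₁, (P l).eval s ^ 2) +
        ∑ k, ∑ l, (C / r * ∫ s in s₀..s₁, (Q k l).eval s ^ 2) :=
      add_le_add (Finset.sum_le_sum fun l _ => hb _ (hPd l))
        (Finset.sum_le_sum fun k _ => Finset.sum_le_sum fun l _ => hb _ (hQd k l))
    _ = C / r * ∫ s in Icc s₀ s₁, sobolevDensity a b w (i.insertNth s y) := by
      rw [h0, mul_add, Finset.mul_sum, Finset.mul_sum]
      simp only [Finset.mul_sum]
    _ ≤ C / r * ∫ s in Icc (a i) (b i), sobolevDensity a b w (i.insertNth s y) := by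
      refine mul_le_mul_of_nonneg_left ?_ (by positivity)
      exact setIntegral_mono_set (hw.pwCont_sobolevDensity.integrableOn_line hy hyr)
        (ae_of_all _ fun s => sobolevDensity_nonneg w _) hsubI.eventuallyLE

end SkelStab

end


noncomputable section

namespace SkelStab

variable {n : ℕ} {a b : Pt n} {F : Pt n → Pt n} {M : ParamMesh a b} {m : ℕ} {Λ : ℝ}
  {u w : Pt n → Pt n}

/-! ### Discrete velocity fields -/

/-- `u` is the Piola transform of the piecewise polynomial field `w` without normal component on
the boundary of the box. -/
structure IsDiscreteField (F : Pt n → Pt n) (M : ParamMesh a b) (m : ℕ) (w u : Pt n → Pt n) :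
    Prop where
  poly : IsPwPoly M m w
  eq_piola : ∀ x ∈ Icc a b, u (F x) = (piola a b F x).mulVec (w x)
  bdry : ∀ i, ∀ x ∈ Icc a b, x i = a i ∨ x i = b i → w x i = 0

/-- The conormal is row `i` of `DF⁻¹`, so the normal component of a Piola field on a face is a
nonzero multiple of the component `w_i`. Vanishing normal flow thus becomes a condition on `w` that
does not involve `F`. -/
theorem exists_isDiscreteField (hF : RegularMap a b F) {k α : ℕ}
    (hu : u ∈ velocitySpace a b F k α M) : ∃ w, (∀ i, (fun x => w x i) ∈ tensorSplines M
      (fun l => if l = i then k + 1 else k) (fun l => if l = i then α + 1 else α)) ∧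
      IsDiscreteField F M (k + 1) w u := by
  obtain ⟨⟨w, hw, he⟩, hn⟩ := hu
  refine ⟨w, hw, ⟨fun i => continuousOn_of_mem_tensorSplines (hw i),
    fun i J => exists_polySpace_eqOn (fun l => ?_) (hw i) J⟩, fun x hx => ?_, fun i x hx hxi => ?_⟩
  · split_ifs <;> omega
  · rw [he x hx, piola, Matrix.smul_mulVec]
  · have h1 := hn i x hx hxi
    rw [he x hx, unitNormal, dotProduct_smul, smul_dotProduct, smul_eq_mul, smul_eq_mul,
      mul_eq_zero, mul_eq_zero] at h1
    rcases h1 with h1 | h1 | h1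
    · exact absurd h1 (inv_ne_zero (hF.euclNorm_conormal_pos hx i).ne')
    · exact absurd h1 (inv_ne_zero (hF.det_ne_zero x hx))
    · rw [dotProduct_comm, conormal] at h1
      change ((jac a b F x)⁻¹.mulVec ((jac a b F x).mulVec (w x))) i = 0 at h1
      rwa [Matrix.mulVec_mulVec, Matrix.nonsing_inv_mul _ (hF.isUnit_det hx),
        Matrix.one_mulVec] at h1

/-- `|u ∘ F|²`. -/
def normDensity (F u : Pt n → Pt n) (x : Pt n) : ℝ := ∑ j, u (F x) j ^ 2

/-- `|D(u ∘ F)|²`. -/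
def pullDensity (a b : Pt n) (F u : Pt n → Pt n) (x : Pt n) : ℝ :=
  ∑ k, ∑ j, partialDeriv a b k (fun z => u (F z) j) x ^ 2

/-- `|∇u|² ∘ F`. -/
def gradDensity (a b : Pt n) (F u : Pt n → Pt n) (x : Pt n) : ℝ :=
  ∑ i, ∑ j, grad a b F u (F x) i j ^ 2

/-- `|∇ˢu|² ∘ F`. -/
def symDensity (a b : Pt n) (F u : Pt n → Pt n) (x : Pt n) : ℝ :=
  contract (symGrad a b F u (F x)) (symGrad a b F u (F x))

theorem symDensity_eq (x : Pt n) : symDensity a b F u x =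
    ∑ i, ∑ j, ((1 / 2 : ℝ) * (grad a b F u (F x) i j + grad a b F u (F x) j i)) ^ 2 := by
  simp [symDensity, contract, symGrad, pow_two]

namespace IsDiscreteField

theorem comp_eq (hu : IsDiscreteField F M m w u) (j : Fin (n + 1)) {x : Pt n} (hx : x ∈ Icc a b) :
    u (F x) j = ∑ l, piola a b F x j l * w x l := by
  rw [hu.eq_piola x hx]; rfl

theorem continuousOn_comp (hF : RegularMap a b F) (hu : IsDiscreteField F M m w u)
    (j : Fin (n + 1)) : ContinuousOn (fun x => u (F x) j) (Icc a b) := by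
  have : ContinuousOn (fun x => ∑ l, piola a b F x j l * w x l) (Icc a b) :=
    continuousOn_finsetSum _ fun l _ => (hF.continuousOn_piola j l).mul (hu.poly.continuousOn l)
  exact this.congr fun x hx => hu.comp_eq j hx

theorem contDiffOn_comp (hF : RegularMap a b F)
    (hM : ∀ J : M.Elem, ContDiffOn ℝ 2 F (M.closedElem J)) (hu : IsDiscreteField F M m w u)
    (j : Fin (n + 1)) (J : M.Elem) : ContDiffOn ℝ 1 (fun x => u (F x) j) (M.closedElem J) := by
  have : ContDiffOn ℝ 1 (fun x => ∑ l, piola a b F x j l * w x l) (M.closedElem J) :=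
    ContDiffOn.sum fun l _ => (hF.contDiffOn_piola (hM J) j l).mul (hu.poly.contDiffOn l J)
  exact this.congr fun x hx => hu.comp_eq j (M.closedElem_subset J hx)

end IsDiscreteField

/-! ### Calculus rules for partial derivatives on the box. -/

theorem differentiableWithinAt_of_regular {g : Pt n → ℝ}
    (hg : ∀ J : M.Elem, ContDiffOn ℝ 1 g (M.closedElem J)) {x : Pt n} (hx : x ∈ Icc a b)
    (hr : x ∈ M.regular) : DifferentiableWithinAt ℝ g (Icc a b) x := by
  obtain ⟨J, hJ⟩ := mem_iUnion.1 (M.Icc_subset_iUnion hx)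
  exact (M.hasFDerivWithinAt_of_regular hJ hr (hg J)).differentiableWithinAt

/-- Difference quotients along the coordinate line inside the box suffice, one-sided ones at
boundary points. -/
theorem abs_partialDeriv_le (hab : ∀ i, a i < b i) {g : Pt n → ℝ} {L : ℝ}
    (hg : ∀ x ∈ Icc a b, ∀ y ∈ Icc a b, |g x - g y| ≤ L * ‖x - y‖) {x : Pt n} (hx : x ∈ Icc a b)
    (hd : DifferentiableWithinAt ℝ g (Icc a b) x) (k : Fin (n + 1)) :
    |partialDeriv a b k g x| ≤ L := by
  obtain ⟨t, y, rfl⟩ : ∃ t y, x = (k.insertNth t y : Pt n) :=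
    ⟨x k, k.removeNth x, (Fin.insertNth_self_removeNth k x).symm⟩
  have hty := ParamMesh.insertNth_mem_Icc.1 hx
  have h1 := hd.hasFDerivWithinAt.comp_hasDerivWithinAt t
    (ParamMesh.hasDerivAt_insertNth k y t).hasDerivWithinAt (s := Icc (a k) (b k))
    (fun s hs => ParamMesh.insertNth_mem_Icc.2 ⟨hs, hty.2⟩)
  rw [hasDerivWithinAt_iff_tendsto_slope] at h1
  have hne : (𝓝[Icc (a k) (b k) \ {t}] t).NeBot := by
    have := uniqueDiffOn_Icc (hab k) t hty.1
    exact (accPt_principal_iff_nhdsWithin.1 (uniqueDiffWithinAt_iff_accPt.1 this))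
  refine le_of_tendsto h1.abs ?_
  filter_upwards [self_mem_nhdsWithin] with s hs
  have hst : 0 < |s - t| := abs_pos.2 (sub_ne_zero.2 hs.2)
  rw [slope_def_field, abs_div, div_le_iff₀ hst]
  refine (hg _ (ParamMesh.insertNth_mem_Icc.2 ⟨hs.1, hty.2⟩) _ hx).trans ?_
  have hL : 0 ≤ L := by
    have h0 := hg _ (ParamMesh.insertNth_mem_Icc.2 ⟨hs.1, hty.2⟩) _ hx
    by_contra hneg
    have h2 : (k.insertNth s y : Pt n) ≠ k.insertNth t y := fun h => by
      have := congrFun h k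
      simp only [Fin.insertNth_apply_same] at this
      exact hs.2 this
    have h3 := norm_pos_iff.2 (sub_ne_zero.2 h2)
    nlinarith [abs_nonneg (g (k.insertNth s y) - g (k.insertNth t y))]
  refine mul_le_mul_of_nonneg_left ?_ hL
  refine (pi_norm_le_iff_of_nonneg (abs_nonneg _)).2 fun l => ?_
  refine Fin.succAboveCases k ?_ (fun l => ?_) l
  · simp
  · simp

theorem partialDeriv_mul {f g : Pt n → ℝ} {x : Pt n} (hu : UniqueDiffWithinAt ℝ (Icc a b) x)
    (hf : DifferentiableWithinAt ℝ f (Icc a b) x) (hg : DifferentiableWithinAt ℝ g (Icc a b) x)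
    (k : Fin (n + 1)) : partialDeriv a b k (fun z => f z * g z) x =
      partialDeriv a b k f x * g x + f x * partialDeriv a b k g x := by
  have h := (hf.hasFDerivWithinAt.mul hg.hasFDerivWithinAt).fderivWithin hu
  unfold partialDeriv
  rw [show (fun z => f z * g z) = f * g from rfl, h]
  simp only [add_apply, smul_apply, smul_eq_mul]
  ring

theorem partialDeriv_sum {ι : Type*} {s : Finset ι} {f : ι → Pt n → ℝ} {x : Pt n}
    (hu : UniqueDiffWithinAt ℝ (Icc a b) x)
    (hf : ∀ i ∈ s, DifferentiableWithinAt ℝ (f i) (Icc a b) x) (k : Fin (n + 1)) :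
    partialDeriv a b k (fun z => ∑ i ∈ s, f i z) x = ∑ i ∈ s, partialDeriv a b k (f i) x := by
  unfold partialDeriv
  rw [(HasFDerivWithinAt.fun_sum fun i hi => (hf i hi).hasFDerivWithinAt).fderivWithin hu]
  simp only [sum_apply]

theorem partialDeriv_congr {f g : Pt n → ℝ} (h : EqOn f g (Icc a b)) {x : Pt n} (hx : x ∈ Icc a b)
    (k : Fin (n + 1)) : partialDeriv a b k f x = partialDeriv a b k g x := by
  unfold partialDeriv
  rw [fderivWithin_congr h (h hx)]

/-! ### Pointwise equivalence of the densities -/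

theorem sq_sum_mul_le {ι : Type*} [Fintype ι] {c y : ι → ℝ} {B : ℝ} (hc : ∀ l, |c l| ≤ B) :
    (∑ l, c l * y l) ^ 2 ≤ Fintype.card ι * B ^ 2 * ∑ l, y l ^ 2 := by
  refine (Finset.sum_mul_sq_le_sq_mul_sq _ _ _).trans ?_
  refine mul_le_mul_of_nonneg_right ?_ (Finset.sum_nonneg fun _ _ => sq_nonneg _)
  calc ∑ l, c l ^ 2 ≤ ∑ _l : ι, B ^ 2 := Finset.sum_le_sum fun l _ => by
        rw [← sq_abs]; exact pow_le_pow_left₀ (abs_nonneg _) (hc l) 2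
    _ = _ := by simp

theorem GeomBound.pos (hΛ : GeomBound a b F Λ) : 0 < Λ := one_pos.trans_le hΛ.one_le

theorem GeomBound.piola_le (hΛ : GeomBound a b F Λ) {x : Pt n} (hx : x ∈ Icc a b)
    (i j : Fin (n + 1)) : |piola a b F x i j| ≤ Λ ^ 2 := by
  have hd : |(jac a b F x).det⁻¹| ≤ Λ := by
    rw [abs_inv]; exact inv_le_of_inv_le₀ hΛ.pos (hΛ.det_lower x hx)
  rw [piola, Matrix.smul_apply, smul_eq_mul, abs_mul, pow_two]
  exact mul_le_mul hd (hΛ.jac_le x hx i j) (abs_nonneg _) hΛ.pos.le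

/-- The inverse of the Piola matrix is `det DF · DF⁻¹`, which recovers `w` from `u ∘ F`. -/
theorem sum_det_inv_mul_piola (hF : RegularMap a b F) {x : Pt n} (hx : x ∈ Icc a b)
    (v : Pt n) (l : Fin (n + 1)) :
    ∑ j, ((jac a b F x).det * (jac a b F x)⁻¹ l j) * ∑ k, piola a b F x j k * v k = v l := by
  have h : ((jac a b F x)⁻¹.mulVec ((jac a b F x).mulVec v)) l = v l := by
    rw [Matrix.mulVec_mulVec, Matrix.nonsing_inv_mul _ (hF.isUnit_det hx), Matrix.one_mulVec]
  rw [← h]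
  simp only [Matrix.mulVec, dotProduct, piola, Matrix.smul_apply, smul_eq_mul]
  refine Finset.sum_congr rfl fun j _ => ?_
  simp only [mul_assoc, ← Finset.mul_sum]
  have := hF.det_ne_zero x hx
  field_simp

theorem GeomBound.det_inv_le (hΛ : GeomBound a b F Λ) {x : Pt n} (hx : x ∈ Icc a b)
    (i j : Fin (n + 1)) : |(jac a b F x).det * (jac a b F x)⁻¹ i j| ≤ Λ ^ 2 := by
  rw [abs_mul, pow_two]
  exact mul_le_mul (hΛ.det_upper x hx) (hΛ.inv_le x hx i j) (abs_nonneg _) hΛ.pos.le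

namespace IsDiscreteField

theorem sum_sq_le (hF : RegularMap a b F) (hΛ : GeomBound a b F Λ)
    (hu : IsDiscreteField F M m w u) {x : Pt n}
    (hx : x ∈ Icc a b) : ∑ l, w x l ^ 2 ≤ ((n + 1 : ℕ) * Λ ^ 2) ^ 2 * normDensity F u x := by
  unfold normDensity
  calc ∑ l, w x l ^ 2 ≤ ∑ _l : Fin (n + 1), (n + 1 : ℕ) * (Λ ^ 2) ^ 2 * ∑ j, u (F x) j ^ 2 :=
        Finset.sum_le_sum fun l _ => by
          rw [← sum_det_inv_mul_piola hF hx (w x) l]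
          simp only [← hu.comp_eq _ hx]
          simpa using sq_sum_mul_le (y := u (F x)) fun j => hΛ.det_inv_le hx l j
    _ = _ := by simp; ring

theorem partialDeriv_comp (hF : RegularMap a b F)
    (hM : ∀ J : M.Elem, ContDiffOn ℝ 2 F (M.closedElem J)) (hu : IsDiscreteField F M m w u)
    {x : Pt n} (hx : x ∈ Icc a b) (hr : x ∈ M.regular) (k j : Fin (n + 1)) :
    partialDeriv a b k (fun z => u (F z) j) x =
      ∑ l, partialDeriv a b k (fun z => piola a b F z j l) x * w x l +
        ∑ l, piola a b F x j l * partialDeriv a b k (fun z => w z l) x := by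
  have hA : ∀ l, DifferentiableWithinAt ℝ (fun z => piola a b F z j l) (Icc a b) x := fun l =>
    differentiableWithinAt_of_regular (fun J => hF.contDiffOn_piola (hM J) j l) hx hr
  have hw : ∀ l, DifferentiableWithinAt ℝ (fun z => w z l) (Icc a b) x := fun l =>
    differentiableWithinAt_of_regular (fun J => hu.poly.contDiffOn l J) hx hr
  rw [partialDeriv_congr (fun z hz => hu.comp_eq j hz) hx,
    partialDeriv_sum (f := fun l z => piola a b F z j l * w z l) (hF.uniqueDiffOn x hx)
      (fun l _ => (hA l).mul (hw l)),
    ← Finset.sum_add_distrib]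
  exact Finset.sum_congr rfl fun l _ => partialDeriv_mul (hF.uniqueDiffOn x hx) (hA l) (hw l) k

theorem abs_partialDeriv_piola_le (hF : RegularMap a b F) (hΛ : GeomBound a b F Λ)
    (hM : ∀ J : M.Elem, ContDiffOn ℝ 2 F (M.closedElem J))
    {x : Pt n} (hx : x ∈ Icc a b) (hr : x ∈ M.regular) (k j l : Fin (n + 1)) :
    |partialDeriv a b k (fun z => piola a b F z j l) x| ≤ Λ :=
  abs_partialDeriv_le hF.lt (fun x hx y hy => hΛ.piola_lip x hx y hy j l) hx
    (differentiableWithinAt_of_regular (fun J => hF.contDiffOn_piola (hM J) j l) hx hr) k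

/-- Product rule for `u ∘ F = piola · w`. The derivative of the Piola matrix is bounded by its
global Lipschitz constant, hence independently of the mesh. -/
theorem pullDensity_le (hF : RegularMap a b F) (hΛ : GeomBound a b F Λ)
    (hM : ∀ J : M.Elem, ContDiffOn ℝ 2 F (M.closedElem J)) (hu : IsDiscreteField F M m w u)
    {x : Pt n} (hx : x ∈ Icc a b) (hr : x ∈ M.regular) :
    pullDensity a b F u x ≤ 2 * ((n + 1 : ℕ) * Λ ^ 2) ^ 3 * sobolevDensity a b w x := by
  set d : ℝ := ((n + 1 : ℕ) : ℝ) with hd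
  have hd1 : 1 ≤ d := by rw [hd]; norm_cast; omega
  have hΛ1 := hΛ.one_le
  set W := ∑ l, w x l ^ 2
  have hW : 0 ≤ W := Finset.sum_nonneg fun _ _ => sq_nonneg _
  have h1 : ∀ k j, partialDeriv a b k (fun z => u (F z) j) x ^ 2 ≤
      2 * (d * Λ ^ 2 * W) + 2 * (d * (Λ ^ 2) ^ 2 *
        ∑ l, partialDeriv a b k (fun z => w z l) x ^ 2) := by
    intro k j
    rw [hu.partialDeriv_comp hF hM hx hr]
    have e1 := sq_sum_mul_le (y := w x) fun l => abs_partialDeriv_piola_le hF hΛ hM hx hr k j l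
    have e2 := sq_sum_mul_le (y := fun l => partialDeriv a b k (fun z => w z l) x)
      fun l => hΛ.piola_le hx j l
    simp only [Fintype.card_fin] at e1 e2
    rw [← hd] at e1 e2
    refine add_sq_le.trans ?_
    rw [mul_add]
    gcongr
  calc pullDensity a b F u x ≤ ∑ k, ∑ _j : Fin (n + 1), (2 * (d * Λ ^ 2 * W) +
        2 * (d * (Λ ^ 2) ^ 2 * ∑ l, partialDeriv a b k (fun z => w z l) x ^ 2)) :=
        Finset.sum_le_sum fun k _ => Finset.sum_le_sum fun j _ => h1 k j
    _ = 2 * (d ^ 3 * Λ ^ 2) * W + 2 * (d ^ 2 * Λ ^ 4) *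
        ∑ k, ∑ l, partialDeriv a b k (fun z => w z l) x ^ 2 := by
      simp only [Finset.sum_const, Finset.card_univ, Fintype.card_fin, nsmul_eq_mul,
        Finset.sum_add_distrib, ← Finset.mul_sum, ← hd]
      ring
    _ ≤ 2 * (d * Λ ^ 2) ^ 3 * W + 2 * (d * Λ ^ 2) ^ 3 *
        ∑ k, ∑ l, partialDeriv a b k (fun z => w z l) x ^ 2 := by
      rw [mul_pow, ← pow_mul]
      gcongr <;> first | assumption | norm_num
    _ = _ := by unfold sobolevDensity; ring

/-- The product rule is solved for `piola · Dw` and the Piola matrix inverted. The zeroth-order term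
is kept, because `Dw` need not vanish when `D(u ∘ F)` does. The exponent `7` is a rounded-up `d⁵Λ⁶ ·
(d Λ²)²`, where `d = n + 1`. -/
theorem sobolevDensity_le (hF : RegularMap a b F) (hΛ : GeomBound a b F Λ)
    (hM : ∀ J : M.Elem, ContDiffOn ℝ 2 F (M.closedElem J)) (hu : IsDiscreteField F M m w u)
    {x : Pt n} (hx : x ∈ Icc a b) (hr : x ∈ M.regular) :
    sobolevDensity a b w x ≤
      4 * ((n + 1 : ℕ) * Λ ^ 2) ^ 7 * (pullDensity a b F u x + normDensity F u x) := by
  set d : ℝ := ((n + 1 : ℕ) : ℝ) with hd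
  have hd1 : 1 ≤ d := by rw [hd]; norm_cast; omega
  have hΛ1 := hΛ.one_le
  have hΛ2 : 1 ≤ Λ ^ 2 := one_le_pow₀ hΛ1
  set W := ∑ l, w x l ^ 2 with hWd
  have hW : 0 ≤ W := Finset.sum_nonneg fun _ _ => sq_nonneg _
  have hU : 0 ≤ normDensity F u x := Finset.sum_nonneg fun _ _ => sq_nonneg _
  have hD : 0 ≤ pullDensity a b F u x :=
    Finset.sum_nonneg fun _ _ => Finset.sum_nonneg fun _ _ => sq_nonneg _
  have hWU : W ≤ (d * Λ ^ 2) ^ 2 * normDensity F u x := hu.sum_sq_le hF hΛ hx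
  have h1 : ∀ k l, partialDeriv a b k (fun z => w z l) x ^ 2 ≤ d * (Λ ^ 2) ^ 2 *
      ∑ j, (2 * partialDeriv a b k (fun z => u (F z) j) x ^ 2 + 2 * (d * Λ ^ 2 * W)) := by
    intro k l
    rw [← sum_det_inv_mul_piola hF hx (fun l => partialDeriv a b k (fun z => w z l) x) l]
    have e2 := sq_sum_mul_le
      (y := fun j => ∑ l, piola a b F x j l * partialDeriv a b k (fun z => w z l) x)
      fun j => hΛ.det_inv_le hx l j
    simp only [Fintype.card_fin] at e2
    rw [← hd] at e2
    refine e2.trans (mul_le_mul_of_nonneg_left (Finset.sum_le_sum fun j _ => ?_) (by positivity))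
    have e1 := sq_sum_mul_le (y := w x) fun l => abs_partialDeriv_piola_le hF hΛ hM hx hr k j l
    simp only [Fintype.card_fin] at e1
    rw [← hd] at e1
    have e3 := hu.partialDeriv_comp hF hM hx hr k j
    have e4 : ∑ l, piola a b F x j l * partialDeriv a b k (fun z => w z l) x =
      partialDeriv a b k (fun z => u (F z) j) x -
        ∑ l, partialDeriv a b k (fun z => piola a b F z j l) x * w x l := by rw [e3]; ring
    rw [e4]
    nlinarith [sq_nonneg (partialDeriv a b k (fun z => u (F z) j) x +
        ∑ l, partialDeriv a b k (fun z => piola a b F z j l) x * w x l)]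
  have h2 : ∑ k, ∑ l, partialDeriv a b k (fun z => w z l) x ^ 2 ≤
      2 * (d ^ 2 * Λ ^ 4) * pullDensity a b F u x + 2 * (d ^ 5 * Λ ^ 6) * W := by
    calc _ ≤ ∑ k, ∑ _l : Fin (n + 1), d * (Λ ^ 2) ^ 2 *
          ∑ j, (2 * partialDeriv a b k (fun z => u (F z) j) x ^ 2 + 2 * (d * Λ ^ 2 * W)) :=
          Finset.sum_le_sum fun k _ => Finset.sum_le_sum fun l _ => h1 k l
      _ = _ := by
        simp only [Finset.sum_const, Finset.card_univ, Fintype.card_fin, nsmul_eq_mul,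
          Finset.sum_add_distrib, ← Finset.mul_sum, ← hd, pullDensity]
        ring
  have hexp : sobolevDensity a b w x = W + ∑ k, ∑ l, partialDeriv a b k (fun z => w z l) x ^ 2 :=
    rfl
  rw [hexp]
  have hp : 1 ≤ d * Λ ^ 2 := by nlinarith
  calc _ ≤ 2 * (d ^ 2 * Λ ^ 4) * pullDensity a b F u x + (1 + 2 * (d ^ 5 * Λ ^ 6)) * W := by
        linarith
    _ ≤ 2 * (d ^ 2 * Λ ^ 4) * pullDensity a b F u x +
        (1 + 2 * (d ^ 5 * Λ ^ 6)) * ((d * Λ ^ 2) ^ 2 * normDensity F u x) := by gcongr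
    _ ≤ 4 * (d * Λ ^ 2) ^ 7 * pullDensity a b F u x +
        4 * (d * Λ ^ 2) ^ 7 * normDensity F u x := by
        have c1 : 2 * (d ^ 2 * Λ ^ 4) ≤ 4 * (d * Λ ^ 2) ^ 7 := by
          have h3 : (d * Λ ^ 2) ^ 2 ≤ (d * Λ ^ 2) ^ 7 := pow_le_pow_right₀ hp (by norm_num)
          rw [show (d * Λ ^ 2) ^ 2 = d ^ 2 * Λ ^ 4 by ring] at h3
          have : 0 ≤ (d * Λ ^ 2) ^ 7 := by positivity
          linarith
        have c2 : (1 + 2 * (d ^ 5 * Λ ^ 6)) * (d * Λ ^ 2) ^ 2 ≤ 4 * (d * Λ ^ 2) ^ 7 := by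
          have h3 : d ^ 5 * Λ ^ 6 ≤ d ^ 5 * Λ ^ 10 := by gcongr <;> first | assumption | norm_num
          have h4 : 1 ≤ (d * Λ ^ 2) ^ 5 := one_le_pow₀ hp
          have h5 : 1 + 2 * (d ^ 5 * Λ ^ 6) ≤ 4 * (d * Λ ^ 2) ^ 5 := by
            rw [show (d * Λ ^ 2) ^ 5 = d ^ 5 * Λ ^ 10 by ring] at h4 ⊢
            linarith
          calc _ ≤ 4 * (d * Λ ^ 2) ^ 5 * (d * Λ ^ 2) ^ 2 := by gcongr
            _ = _ := by ring
        rw [← mul_assoc (1 + 2 * (d ^ 5 * Λ ^ 6))]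
        exact add_le_add (mul_le_mul_of_nonneg_right c1 hD) (mul_le_mul_of_nonneg_right c2 hU)
    _ = _ := by ring

end IsDiscreteField

theorem gradDensity_le (hF : RegularMap a b F) (hΛ : GeomBound a b F Λ) {x : Pt n}
    (hx : x ∈ Icc a b)
    (hu : ∀ j, DifferentiableWithinAt ℝ (fun z => u (F z) j) (Icc a b) x) :
    gradDensity a b F u x ≤ ((n + 1 : ℕ) * Λ) ^ 2 * pullDensity a b F u x := by
  calc gradDensity a b F u x ≤ ∑ _i : Fin (n + 1), ∑ j, (n + 1 : ℕ) * Λ ^ 2 *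
        ∑ k, partialDeriv a b k (fun z => u (F z) j) x ^ 2 :=
        Finset.sum_le_sum fun i _ => Finset.sum_le_sum fun j _ => by
          rw [hF.grad_apply hx hu]
          simpa using sq_sum_mul_le (y := fun k => partialDeriv a b k (fun z => u (F z) j) x)
            fun k => hΛ.inv_le x hx k i
    _ = _ := by
      simp only [Finset.sum_const, Finset.card_univ, Fintype.card_fin, nsmul_eq_mul,
        ← Finset.mul_sum, pullDensity]
      rw [Finset.sum_comm]
      ring

theorem pullDensity_le_gradDensity (hF : RegularMap a b F) (hΛ : GeomBound a b F Λ) {x : Pt n}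
    (hx : x ∈ Icc a b)
    (hu : ∀ j, DifferentiableWithinAt ℝ (fun z => u (F z) j) (Icc a b) x) :
    pullDensity a b F u x ≤ ((n + 1 : ℕ) * Λ) ^ 2 * gradDensity a b F u x := by
  calc pullDensity a b F u x ≤ ∑ _k : Fin (n + 1), ∑ j, (n + 1 : ℕ) * Λ ^ 2 *
        ∑ i, grad a b F u (F x) i j ^ 2 :=
        Finset.sum_le_sum fun k _ => Finset.sum_le_sum fun j _ => by
          rw [hF.sum_jac_mul_grad hx hu]
          simpa using sq_sum_mul_le (y := fun i => grad a b F u (F x) i j)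
            fun i => hΛ.jac_le x hx i k
    _ = _ := by
      simp only [Finset.sum_const, Finset.card_univ, Fintype.card_fin, nsmul_eq_mul,
        ← Finset.mul_sum, gradDensity]
      rw [Finset.sum_comm]
      ring

theorem symDensity_le_gradDensity (x : Pt n) :
    symDensity a b F u x ≤ gradDensity a b F u x := by
  rw [symDensity_eq, gradDensity]
  set G := grad a b F u (F x)
  have h : ∀ i j, ((1 / 2 : ℝ) * (G i j + G j i)) ^ 2 ≤ (1 / 2) * G i j ^ 2 + (1 / 2) * G j i ^ 2 :=
    fun i j => by nlinarith [sq_nonneg (G i j - G j i)]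
  calc _ ≤ ∑ i, ∑ j, ((1 / 2) * G i j ^ 2 + (1 / 2) * G j i ^ 2) :=
        Finset.sum_le_sum fun i _ => Finset.sum_le_sum fun j _ => h i j
    _ = _ := by
      simp only [Finset.sum_add_distrib, ← Finset.mul_sum]
      rw [Finset.sum_comm (f := fun i j => G j i ^ 2)]
      ring

theorem symDensity_nonneg (x : Pt n) : 0 ≤ symDensity a b F u x := by
  rw [symDensity_eq]; positivity

theorem normDensity_nonneg (x : Pt n) : 0 ≤ normDensity F u x := by unfold normDensity; positivity

theorem pullDensity_nonneg (x : Pt n) : 0 ≤ pullDensity a b F u x := by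
  unfold pullDensity; positivity

theorem gradDensity_nonneg (x : Pt n) : 0 ≤ gradDensity a b F u x := by
  unfold gradDensity; positivity

/-! ### Piecewise continuity of the densities -/

theorem pwCont_grad (hF : RegularMap a b F)
    (hu : ∀ j (J : M.Elem), ContDiffOn ℝ 1 (fun z => u (F z) j) (M.closedElem J))
    (i j : Fin (n + 1)) : M.PwCont fun x => grad a b F u (F x) i j := by
  refine ParamMesh.PwCont.congr (f := fun x => ∑ k, (jac a b F x)⁻¹ k i *
    partialDeriv a b k (fun z => u (F z) j) x) (.sum fun k _ => .mul
      (.of_continuousOn (hF.continuousOn_inv k i)) (ParamMesh.pwCont_partialDeriv (hu j) k))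
    fun x hx hr => ?_
  exact hF.grad_apply hx (fun j => differentiableWithinAt_of_regular (hu j) hx hr) i j

theorem pwCont_symGrad (hF : RegularMap a b F)
    (hu : ∀ j (J : M.Elem), ContDiffOn ℝ 1 (fun z => u (F z) j) (M.closedElem J))
    (i j : Fin (n + 1)) : M.PwCont fun x => symGrad a b F u (F x) i j := by
  have := (ParamMesh.PwCont.const (M := M) (1 / 2)).mul
    ((pwCont_grad hF hu i j).add (pwCont_grad hF hu j i))
  exact this

theorem pwCont_gradDensity (hF : RegularMap a b F)
    (hu : ∀ j (J : M.Elem), ContDiffOn ℝ 1 (fun z => u (F z) j) (M.closedElem J)) :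
    M.PwCont (gradDensity a b F u) :=
  .sum fun i _ => .sum fun j _ => (pwCont_grad hF hu i j).sq

theorem pwCont_symDensity (hF : RegularMap a b F)
    (hu : ∀ j (J : M.Elem), ContDiffOn ℝ 1 (fun z => u (F z) j) (M.closedElem J)) :
    M.PwCont (symDensity a b F u) := by
  unfold symDensity contract
  exact .sum fun i _ => .sum fun j _ => (pwCont_symGrad hF hu i j).mul (pwCont_symGrad hF hu i j)

theorem pwCont_pullDensity
    (hu : ∀ j (J : M.Elem), ContDiffOn ℝ 1 (fun z => u (F z) j) (M.closedElem J)) :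
    M.PwCont (pullDensity a b F u) :=
  .sum fun k _ => .sum fun j _ => (ParamMesh.pwCont_partialDeriv (hu j) k).sq

theorem pwCont_normDensity (hu : ∀ j, ContinuousOn (fun x => u (F x) j) (Icc a b)) :
    M.PwCont (normDensity F u) :=
  .sum fun j _ => (ParamMesh.PwCont.of_continuousOn (hu j)).sq

end SkelStab

end


noncomputable section

namespace SkelStab

variable {n : ℕ} {a b : Pt n} {F : Pt n → Pt n} {M : ParamMesh a b} {Λ : ℝ} {u : Pt n → Pt n}

/-! ### Cutoff near the boundary -/

/-- The layer of width `δ` along the boundary of the box. -/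
def boundaryLayer (a b : Pt n) (δ : ℝ) : Set (Pt n) := {x | ∃ i, x i ≤ a i + δ ∨ b i - δ ≤ x i}

theorem measurableSet_boundaryLayer (a b : Pt n) (δ : ℝ) : MeasurableSet (boundaryLayer a b δ) := by
  have : boundaryLayer a b δ = ⋃ i, ({x : Pt n | x i ≤ a i + δ} ∪ {x : Pt n | b i - δ ≤ x i}) := by
    ext x; simp [boundaryLayer]
  rw [this]
  exact MeasurableSet.iUnion fun i => (measurableSet_le (measurable_pi_apply i)
    measurable_const).union (measurableSet_le measurable_const (measurable_pi_apply i))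

/-- The cutoff that vanishes outside the box and is one off the boundary layer. -/
def cutoff (a b : Pt n) (δ : ℝ) (x : Pt n) : ℝ :=
  min 1 (Metric.infDist x (paramDomain a b)ᶜ / δ)

theorem cutoff_nonneg {δ : ℝ} (hδ : 0 < δ) (x : Pt n) : 0 ≤ cutoff a b δ x :=
  le_min zero_le_one (div_nonneg Metric.infDist_nonneg hδ.le)

theorem cutoff_le_one {δ : ℝ} (x : Pt n) : cutoff a b δ x ≤ 1 := min_le_left _ _

theorem cutoff_eq_zero {δ : ℝ} {x : Pt n} (hx : x ∉ paramDomain a b) : cutoff a b δ x = 0 := by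
  rw [cutoff, Metric.infDist_zero_of_mem hx]; simp

theorem cutoff_lipschitz {δ : ℝ} (hδ : 0 < δ) (x y : Pt n) :
    |cutoff a b δ x - cutoff a b δ y| ≤ δ⁻¹ * ‖x - y‖ := by
  have h1 : |cutoff a b δ x - cutoff a b δ y| ≤
      |Metric.infDist x (paramDomain a b)ᶜ / δ - Metric.infDist y (paramDomain a b)ᶜ / δ| := by
    have := abs_min_sub_min_le_max (1 : ℝ) (Metric.infDist x (paramDomain a b)ᶜ / δ) 1
      (Metric.infDist y (paramDomain a b)ᶜ / δ)
    simpa [cutoff] using this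
  refine h1.trans ?_
  rw [← sub_div, abs_div, abs_of_pos hδ, div_eq_inv_mul]
  refine mul_le_mul_of_nonneg_left ?_ (inv_nonneg.2 hδ.le)
  have := (Metric.lipschitz_infDist_pt (paramDomain a b)ᶜ).dist_le_mul x y
  rwa [NNReal.coe_one, one_mul, Real.dist_eq, dist_eq_norm] at this

/-- Distances are in the maximum norm: a point outside the open box violates one coordinate bound,
and that single coordinate already gives distance at least `δ`. Equality on a neighborhood is needed
for the derivative. -/
theorem cutoff_eventuallyEq_one {δ : ℝ} (hδ : 0 < δ) {x : Pt n} (hx : x ∉ boundaryLayer a b δ) :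
    cutoff a b δ =ᶠ[𝓝 x] fun _ => 1 := by
  have hx' : ∀ i, a i + δ < x i ∧ x i < b i - δ := by
    intro i
    constructor
    · by_contra h; exact hx ⟨i, Or.inl (not_lt.1 h)⟩
    · by_contra h; exact hx ⟨i, Or.inr (not_lt.1 h)⟩
  have hopen : ∀ᶠ z : Pt n in 𝓝 x, ∀ i, a i + δ < z i ∧ z i < b i - δ := by
    refine eventually_all.2 fun i => ?_
    exact ((continuous_apply i).continuousAt.eventually (lt_mem_nhds (hx' i).1)).and
      ((continuous_apply i).continuousAt.eventually (gt_mem_nhds (hx' i).2))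
  filter_upwards [hopen] with z hz
  refine min_eq_left ((one_le_div hδ).2 ?_)
  have hne : ((paramDomain a b)ᶜ : Set (Pt n)).Nonempty :=
    ⟨a, fun h => lt_irrefl _ (h 0 trivial).1⟩
  refine (Metric.le_infDist hne).2 fun y hy => ?_
  have hy' : ∃ i, ¬ (a i < y i ∧ y i < b i) := by
    by_contra! hcon
    exact hy fun i _ => hcon i
  obtain ⟨i, hi⟩ := hy'
  refine le_trans ?_ (dist_le_pi_dist z y i)
  rw [Real.dist_eq]
  rcases not_and_or.1 hi with h | h
  · exact le_trans (by linarith [(hz i).1]) (le_abs_self _)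
  · exact le_trans (by linarith [(hz i).2]) (neg_le_abs _)

/-! ### Fields cut off near the boundary -/

/-- The field `χ u` on the physical domain, extended by zero. -/
def cutField (a b : Pt n) (F u : Pt n → Pt n) (δ : ℝ) (p : Pt n) : Pt n := by
  classical exact
  if p ∈ closedDomain a b F then cutoff a b δ (Function.invFunOn F (Icc a b) p) • u p else 0

theorem cutField_apply (hF : RegularMap a b F) {δ : ℝ} {x : Pt n} (hx : x ∈ Icc a b) :
    cutField a b F u δ (F x) = cutoff a b δ x • u (F x) := by
  have hm : F x ∈ closedDomain a b F := mem_image_of_mem F hx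
  rw [cutField, if_pos hm, hF.invFunOn_apply hx]

theorem cutField_eq_zero (hF : RegularMap a b F) {δ : ℝ} {p : Pt n} (hp : p ∉ domain a b F) :
    cutField a b F u δ p = 0 := by
  by_cases h : p ∈ closedDomain a b F
  · obtain ⟨x, hx, rfl⟩ := h
    rw [cutField_apply hF hx, cutoff_eq_zero, zero_smul]
    exact fun hx' => hp ⟨x, hx', rfl⟩
  · rw [cutField, if_neg h]

theorem hasCompactSupport_cutField (hF : RegularMap a b F) (δ : ℝ) (j : Fin (n + 1)) :
    HasCompactSupport fun p => cutField a b F u δ p j :=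
  HasCompactSupport.intro hF.isCompact_closedDomain fun p hp => by
    rw [cutField_eq_zero hF fun h => hp (RegularMap.domain_subset_closedDomain h)]; rfl

/-- In parametric coordinates `χ u` is a product of bounded Lipschitz functions, and `F⁻¹` is
Lipschitz. The constant may depend on `u`, `δ` and the mesh: it only makes Korn's inequality
applicable and enters no estimate. -/
theorem exists_lipschitzWith_cutField (hF : RegularMap a b F) (hΛ : GeomBound a b F Λ)
    (hc : ∀ j, ContinuousOn (fun x => u (F x) j) (Icc a b))
    (hd : ∀ j (J : M.Elem), ContDiffOn ℝ 1 (fun x => u (F x) j) (M.closedElem J)) {δ : ℝ}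
    (hδ : 0 < δ) : ∃ C : NNReal, ∀ j, LipschitzWith C fun p => cutField a b F u δ p j := by
  choose L hL0 hL using fun j => ParamMesh.exists_lipschitz (hc j) (hd j)
  choose B hB using fun j => isCompact_Icc.exists_bound_of_continuousOn (hc j)
  have hB0 : ∀ j, 0 ≤ B j := fun j => (norm_nonneg _).trans
    (hB j a (left_mem_Icc.2 fun i => (hF.lt i).le))
  have hin : ∀ j, ∀ p ∈ closedDomain a b F, ∀ q ∈ closedDomain a b F,
      |cutField a b F u δ p j - cutField a b F u δ q j| ≤
        (L j + B j * δ⁻¹) * Λ * ‖p - q‖ := by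
    rintro j _ ⟨x, hx, rfl⟩ _ ⟨y, hy, rfl⟩
    rw [cutField_apply hF hx, cutField_apply hF hy]
    simp only [Pi.smul_apply, smul_eq_mul]
    have e : cutoff a b δ x * u (F x) j - cutoff a b δ y * u (F y) j =
        cutoff a b δ x * (u (F x) j - u (F y) j) +
          (cutoff a b δ x - cutoff a b δ y) * u (F y) j := by ring
    rw [e]
    have h1 : |cutoff a b δ x * (u (F x) j - u (F y) j)| ≤ L j * ‖x - y‖ := by
      rw [abs_mul, abs_of_nonneg (cutoff_nonneg hδ x)]
      exact (mul_le_of_le_one_left (abs_nonneg _) (cutoff_le_one x)).trans (hL j x hx y hy)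
    have h2 : |(cutoff a b δ x - cutoff a b δ y) * u (F y) j| ≤ (δ⁻¹ * ‖x - y‖) * B j := by
      rw [abs_mul]
      exact mul_le_mul (cutoff_lipschitz hδ x y) (hB j y hy) (abs_nonneg _) (by positivity)
    have h3 : 0 ≤ L j + B j * δ⁻¹ := add_nonneg (hL0 j) (mul_nonneg (hB0 j) (inv_nonneg.2 hδ.le))
    calc _ ≤ _ := abs_add_le _ _
      _ ≤ (L j + B j * δ⁻¹) * ‖x - y‖ := by linarith
      _ ≤ (L j + B j * δ⁻¹) * (Λ * ‖F x - F y‖) :=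
        mul_le_mul_of_nonneg_left (hΛ.antilip x hx y hy) h3
      _ = _ := by ring
  have hmix : ∀ j, ∀ p ∈ closedDomain a b F, ∀ q ∉ closedDomain a b F,
      |cutField a b F u δ p j| ≤ (L j + B j * δ⁻¹) * Λ * ‖p - q‖ := by
    intro j p hp q hq
    have hC : 0 ≤ (L j + B j * δ⁻¹) * Λ :=
      mul_nonneg (add_nonneg (hL0 j) (mul_nonneg (hB0 j) (inv_nonneg.2 hδ.le))) hΛ.pos.le
    by_cases hpd : p ∈ domain a b F
    -- A segment from inside the domain to outside its closure meets the boundary, where the cut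
    -- field vanishes; the bound inside the closed domain is applied up to that point.
    · obtain ⟨r, hr, hrm, hrd⟩ : ∃ r ∈ segment ℝ p q, r ∈ closedDomain a b F ∧
          r ∉ domain a b F := by
        by_contra! hcon
        have hpre : IsPreconnected (segment ℝ p q) := (convex_segment p q).isPreconnected
        obtain ⟨r, _, hr1, hr2⟩ := hpre (domain a b F) (closedDomain a b F)ᶜ hF.isOpen_domain
          hF.isCompact_closedDomain.isClosed.isOpen_compl (fun r hr => by
            by_cases h : r ∈ closedDomain a b F
            · exact Or.inl (hcon r hr h)
            · exact Or.inr h) ⟨p, left_mem_segment ℝ p q, hpd⟩ ⟨q, right_mem_segment ℝ p q, hq⟩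
        exact hr2 (RegularMap.domain_subset_closedDomain hr1)
      have h1 := hin j p hp r hrm
      rw [cutField_eq_zero hF hrd, Pi.zero_apply, sub_zero] at h1
      refine h1.trans (mul_le_mul_of_nonneg_left ?_ hC)
      have := dist_add_dist_of_mem_segment hr
      rw [← dist_eq_norm, ← dist_eq_norm, ← this]
      linarith [dist_nonneg (x := r) (y := q)]
    · rw [cutField_eq_zero hF hpd, Pi.zero_apply, abs_zero]
      positivity
  obtain ⟨C, hC⟩ := (finite_range fun j => Real.toNNReal ((L j + B j * δ⁻¹) * Λ)).bddAbove
  refine ⟨C, fun j => LipschitzWith.of_dist_le_mul fun p q => ?_⟩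
  have hle : (L j + B j * δ⁻¹) * Λ * ‖p - q‖ ≤ C * ‖p - q‖ :=
    mul_le_mul_of_nonneg_right ((Real.le_coe_toNNReal _).trans (NNReal.coe_le_coe.2 (hC ⟨j, rfl⟩)))
      (norm_nonneg _)
  rw [Real.dist_eq, dist_eq_norm]
  refine le_trans ?_ hle
  by_cases hp : p ∈ closedDomain a b F <;> by_cases hq : q ∈ closedDomain a b F
  · exact hin j p hp q hq
  · rw [cutField_eq_zero hF fun h => hq (RegularMap.domain_subset_closedDomain h), Pi.zero_apply,
      sub_zero]
    exact hmix j p hp q hq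
  · rw [cutField_eq_zero hF (p := p) fun h => hp (RegularMap.domain_subset_closedDomain h),
      Pi.zero_apply, zero_sub, abs_neg, norm_sub_rev]
    exact hmix j q hq p hp
  · rw [cutField_eq_zero hF (p := p) fun h => hp (RegularMap.domain_subset_closedDomain h),
      cutField_eq_zero hF fun h => hq (RegularMap.domain_subset_closedDomain h), sub_self, abs_zero]
    exact mul_nonneg (mul_nonneg (add_nonneg (hL0 j) (mul_nonneg (hB0 j) (inv_nonneg.2 hδ.le)))
      hΛ.pos.le) (norm_nonneg _)

theorem lineDeriv_eq_grad (hF : RegularMap a b F) {v : Pt n → Pt n} {x : Pt n}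
    (hx : x ∈ paramDomain a b)
    (hv : ∀ j, DifferentiableWithinAt ℝ (fun z => v (F z) j) (Icc a b) x) (i j : Fin (n + 1)) :
    lineDeriv ℝ (fun p => v p j) (F x) (Pi.single i 1) = grad a b F v (F x) i j := by
  have hxI := paramDomain_subset_Icc hx
  have hnhds : closedDomain a b F ∈ 𝓝 (F x) :=
    mem_of_superset (hF.isOpen_domain.mem_nhds (mem_image_of_mem F hx))
      RegularMap.domain_subset_closedDomain
  have hD : HasFDerivWithinAt (fun z => v (F z))
      (ContinuousLinearMap.pi fun j => fderivWithin ℝ (fun z => v (F z) j) (Icc a b) x)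
      (Icc a b) x := hasFDerivWithinAt_pi.2 fun j => (hv j).hasFDerivWithinAt
  have h1 := (hF.hasFDerivWithinAt_closedDomain hxI hD)
  have h2 := h1.hasFDerivAt hnhds
  rw [grad, Matrix.of_apply, h1.fderivWithin (hF.uniqueDiffWithinAt_closedDomain hxI)]
  exact ((hasFDerivAt_pi'.1 h2 j).hasLineDerivAt (Pi.single i 1)).lineDeriv

theorem grad_cutField (hF : RegularMap a b F) {δ : ℝ} {x : Pt n} (hx : x ∈ paramDomain a b)
    (hu : ∀ j, DifferentiableWithinAt ℝ (fun z => u (F z) j) (Icc a b) x)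
    (hχ : DifferentiableAt ℝ (cutoff a b δ) x) :
    (∀ j, DifferentiableWithinAt ℝ (fun z => cutField a b F u δ (F z) j) (Icc a b) x) ∧
    ∀ i j, grad a b F (cutField a b F u δ) (F x) i j = cutoff a b δ x * grad a b F u (F x) i j +
      (∑ k, (jac a b F x)⁻¹ k i * partialDeriv a b k (cutoff a b δ) x) * u (F x) j := by
  have hxI := paramDomain_subset_Icc hx
  have heq : ∀ j, EqOn (fun z => cutField a b F u δ (F z) j)
      (fun z => cutoff a b δ z * u (F z) j) (Icc a b) := fun j z hz => by
    simp only [cutField_apply hF hz, Pi.smul_apply, smul_eq_mul]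
  have hd : ∀ j, DifferentiableWithinAt ℝ (fun z => cutField a b F u δ (F z) j) (Icc a b) x :=
    fun j => (hχ.differentiableWithinAt.mul (hu j)).congr (heq j) (heq j hxI)
  refine ⟨hd, fun i j => ?_⟩
  rw [hF.grad_apply hxI hd, hF.grad_apply hxI hu, Finset.mul_sum, Finset.sum_mul,
    ← Finset.sum_add_distrib]
  refine Finset.sum_congr rfl fun k _ => ?_
  rw [partialDeriv_congr (heq j) hxI, partialDeriv_mul (hF.uniqueDiffOn x hxI)
    hχ.differentiableWithinAt (hu j)]
  ring

/-- Korn's inequality for the field cut off near the boundary, in the parametric domain. -/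
theorem korn_cutField (hF : RegularMap a b F) (hΛ : GeomBound a b F Λ)
    (hc : ∀ j, ContinuousOn (fun x => u (F x) j) (Icc a b))
    (hd : ∀ j (J : M.Elem), ContDiffOn ℝ 1 (fun x => u (F x) j) (M.closedElem J)) {δ : ℝ}
    (hδ : 0 < δ) :
    IntegrableOn (fun x => |(jac a b F x).det| * gradDensity a b F (cutField a b F u δ) x)
      (Icc a b) ∧
    IntegrableOn (fun x => |(jac a b F x).det| * symDensity a b F (cutField a b F u δ) x)
      (Icc a b) ∧
    ∫ x in Icc a b, |(jac a b F x).det| * gradDensity a b F (cutField a b F u δ) x ≤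
      2 * ∫ x in Icc a b, |(jac a b F x).det| * symDensity a b F (cutField a b F u δ) x := by
  obtain ⟨C, hC⟩ := exists_lipschitzWith_cutField hF hΛ hc hd hδ
  have hsupp := hasCompactSupport_cutField (u := u) hF δ
  have hkorn := integral_sq_lineDeriv_le hC hsupp
  set V := cutField a b F u δ with hV
  set D : Fin (n + 1) → Fin (n + 1) → Pt n → ℝ :=
    fun i j p => lineDeriv ℝ (fun p => V p j) p (Pi.single i 1) with hD
  have hint : ∀ i j k l, Integrable fun p => D i j p * D k l p := fun i j k l =>
    integrable_lineDeriv_mul (hC j) (hC l) (hsupp l) _ _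
  have hiG : Integrable fun p => ∑ i, ∑ j, D i j p ^ 2 := by
    simp only [pow_two]
    exact integrable_finsetSum _ fun i _ => integrable_finsetSum _ fun j _ => hint i j i j
  have hiS : Integrable fun p => ∑ i, ∑ j, ((1 / 2 : ℝ) * (D i j p + D j i p)) ^ 2 := by
    refine integrable_finsetSum _ fun i _ => integrable_finsetSum _ fun j _ => ?_
    have := (((hint i j i j).add (hint j i j i)).add ((hint i j j i).const_mul 2)).const_mul (1 / 4)
    refine this.congr (ae_of_all _ fun p => ?_)
    simp only [Pi.add_apply]
    ring
  have hcut : ∀ᵐ x : Pt n, DifferentiableAt ℝ (cutoff a b δ) x := by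
    refine LipschitzWith.ae_differentiableAt (C := ⟨δ⁻¹, by positivity⟩) ?_
    refine LipschitzWith.of_dist_le_mul fun x y => ?_
    rw [Real.dist_eq, dist_eq_norm]
    exact cutoff_lipschitz hδ x y
  have hae : ∀ᵐ x : Pt n, x ∈ paramDomain a b → ∀ i j, D i j (F x) = grad a b F V (F x) i j := by
    filter_upwards [hcut, M.ae_mem_regular] with x hx hr hxp i j
    exact lineDeriv_eq_grad hF hxp (grad_cutField hF hxp (fun j =>
      differentiableWithinAt_of_regular (hd j) (paramDomain_subset_Icc hxp) hr) hx).1 i j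
  have hpd : ∀ᵐ x : Pt n, x ∈ Icc a b → x ∈ paramDomain a b := by
    filter_upwards [(paramDomain_ae_eq_Icc a b).mem_iff] with x hx using hx.2
  -- Outside the closed domain the field vanishes locally, and the boundary is a null set. Hence the
  -- integrals of Korn's inequality over the whole space reduce to the domain.
  have hzero : ∀ᵐ p : Pt n, p ∉ domain a b F → ∀ i j, D i j p = 0 := by
    have h0 : ∀ᵐ p : Pt n, p ∉ closedDomain a b F \ domain a b F :=
      measure_eq_zero_iff_ae_notMem.1 hF.volume_closedDomain_diff
    filter_upwards [h0] with p hp hpd i j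
    have hpc : p ∉ closedDomain a b F := fun h => hp ⟨h, hpd⟩
    refine lineDeriv_eq_zero_of_notMem_tsupport (fun h => hpc ?_) _
    refine closure_minimal (fun q hq => ?_) hF.isCompact_closedDomain.isClosed h
    by_contra hqc
    exact hq (by
      change V q j = 0
      rw [hV, cutField_eq_zero hF fun h => hqc (RegularMap.domain_subset_closedDomain h)]; rfl)
  have himg : ∀ {g : Pt n → ℝ}, Integrable g →
      IntegrableOn (fun x => |(jac a b F x).det| * g (F x)) (Icc a b) := by
    intro g hg
    have h1 := (integrableOn_image_iff_integrableOn_abs_det_fderiv_smul volume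
      (isOpen_paramDomain a b).measurableSet (f' := fun x => fderivWithin ℝ F (Icc a b) x)
      (fun x hx => (hF.hasFDerivWithinAt (paramDomain_subset_Icc hx)).mono paramDomain_subset_Icc)
      (hF.injOn.mono paramDomain_subset_Icc) g).1 hg.integrableOn
    simp only [jac_det, smul_eq_mul] at h1
    exact h1.congr_set_ae (paramDomain_ae_eq_Icc a b).symm
  have eG : ∀ᵐ x : Pt n, x ∈ Icc a b → |(jac a b F x).det| * ∑ i, ∑ j, D i j (F x) ^ 2 =
      |(jac a b F x).det| * gradDensity a b F V x := by
    filter_upwards [hae, hpd] with x h1 h2 hx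
    simp only [h1 (h2 hx), gradDensity]
  have eS : ∀ᵐ x : Pt n, x ∈ Icc a b → |(jac a b F x).det| *
      ∑ i, ∑ j, ((1 / 2 : ℝ) * (D i j (F x) + D j i (F x))) ^ 2 =
      |(jac a b F x).det| * symDensity a b F V x := by
    filter_upwards [hae, hpd] with x h1 h2 hx
    simp only [h1 (h2 hx), symDensity_eq]
  refine ⟨(himg hiG).congr_fun_ae ((ae_restrict_iff' measurableSet_Icc).2 eG),
    (himg hiS).congr_fun_ae ((ae_restrict_iff' measurableSet_Icc).2 eS), ?_⟩
  rw [← setIntegral_congr_ae measurableSet_Icc eG, ← setIntegral_congr_ae measurableSet_Icc eS,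
    ← hF.setIntegral_domain fun p => ∑ i, ∑ j, D i j p ^ 2,
    ← hF.setIntegral_domain fun p => ∑ i, ∑ j, ((1 / 2 : ℝ) * (D i j p + D j i p)) ^ 2]
  rw [setIntegral_eq_integral_of_ae_compl_eq_zero (by
      filter_upwards [hzero] with p hp hpd
      simp [hp hpd]),
    setIntegral_eq_integral_of_ae_compl_eq_zero (by
      filter_upwards [hzero] with p hp hpd
      simp [hp hpd])]
  exact hkorn

end SkelStab

end


noncomputable section

namespace SkelStab

variable {n : ℕ} {a b : Pt n} {F : Pt n → Pt n} {M : ParamMesh a b} {Λ : ℝ} {u : Pt n → Pt n}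

/-! ### Korn's inequality up to the boundary layer -/

theorem gradDensity_cutField_eq (hF : RegularMap a b F) {δ : ℝ} (hδ : 0 < δ) {x : Pt n}
    (hx : x ∈ paramDomain a b) (hl : x ∉ boundaryLayer a b δ)
    (hu : ∀ j, DifferentiableWithinAt ℝ (fun z => u (F z) j) (Icc a b) x) :
    gradDensity a b F (cutField a b F u δ) x = gradDensity a b F u x := by
  have h1 := cutoff_eventuallyEq_one hδ hl
  have hd : DifferentiableAt ℝ (cutoff a b δ) x :=
    (differentiableAt_const (1 : ℝ)).congr_of_eventuallyEq h1
  have h2 := (grad_cutField hF hx hu hd).2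
  have hz : ∀ k, partialDeriv a b k (cutoff a b δ) x = 0 := fun k => by
    rw [partialDeriv, (h1.filter_mono nhdsWithin_le_nhds).fderivWithin_eq h1.self_of_nhds]
    simp
  simp only [gradDensity, h2, hz, h1.self_of_nhds, mul_zero, Finset.sum_const_zero, zero_mul,
    add_zero, one_mul]

/-- The symmetric gradient of `χ u` is `χ ∇ˢu` plus the symmetric part of `∇χ ⊗ u`. The second term
lives in the layer, where `∇χ` is of size `1 / δ`. -/
theorem symDensity_cutField_le (hF : RegularMap a b F) (hΛ : GeomBound a b F Λ) {δ : ℝ}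
    (hδ : 0 < δ) {x : Pt n} (hx : x ∈ paramDomain a b)
    (hu : ∀ j, DifferentiableWithinAt ℝ (fun z => u (F z) j) (Icc a b) x)
    (hχ : DifferentiableAt ℝ (cutoff a b δ) x) :
    symDensity a b F (cutField a b F u δ) x ≤ 2 * symDensity a b F u x +
      (boundaryLayer a b δ).indicator
        (fun x => 2 * ((n + 1 : ℕ) ^ 3 * Λ ^ 2 * δ⁻¹ ^ 2) * normDensity F u x) x := by
  have hxI := paramDomain_subset_Icc hx
  have h2 := (grad_cutField hF hx hu hχ).2
  set z : Fin (n + 1) → ℝ :=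
    fun i => ∑ k, (jac a b F x)⁻¹ k i * partialDeriv a b k (cutoff a b δ) x with hz
  have key : symDensity a b F (cutField a b F u δ) x ≤ 2 * symDensity a b F u x +
      2 * ((∑ i, z i ^ 2) * normDensity F u x) := by
    have hpt : ∀ i j, ((1 / 2 : ℝ) * (grad a b F (cutField a b F u δ) (F x) i j +
        grad a b F (cutField a b F u δ) (F x) j i)) ^ 2 ≤
        2 * ((1 / 2 : ℝ) * (grad a b F u (F x) i j + grad a b F u (F x) j i)) ^ 2 +
          (z i ^ 2 * u (F x) j ^ 2 + z j ^ 2 * u (F x) i ^ 2) := by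
      intro i j
      rw [h2, h2]
      have hc0 := cutoff_nonneg (a := a) (b := b) hδ x
      have hc1 := cutoff_le_one (a := a) (b := b) (δ := δ) x
      set c := cutoff a b δ x
      set s := (1 / 2 : ℝ) * (grad a b F u (F x) i j + grad a b F u (F x) j i) with hs
      have e : (1 / 2 : ℝ) * (c * grad a b F u (F x) i j + z i * u (F x) j +
          (c * grad a b F u (F x) j i + z j * u (F x) i)) =
          c * s + (1 / 2) * (z i * u (F x) j + z j * u (F x) i) := by rw [hs]; ring
      rw [e]
      have h3 : (c * s) ^ 2 ≤ s ^ 2 := by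
        rw [mul_pow]
        exact mul_le_of_le_one_left (sq_nonneg _) (pow_le_one₀ hc0 hc1)
      have h4 := sq_nonneg (c * s - (1 / 2) * (z i * u (F x) j + z j * u (F x) i))
      have h5 := sq_nonneg (z i * u (F x) j - z j * u (F x) i)
      nlinarith
    rw [symDensity_eq, symDensity_eq]
    calc _ ≤ ∑ i, ∑ j, (2 * ((1 / 2 : ℝ) * (grad a b F u (F x) i j + grad a b F u (F x) j i)) ^ 2 +
          (z i ^ 2 * u (F x) j ^ 2 + z j ^ 2 * u (F x) i ^ 2)) :=
        Finset.sum_le_sum fun i _ => Finset.sum_le_sum fun j _ => hpt i j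
      _ = _ := by
        have e2 : ∑ i, ∑ j, z j ^ 2 * u (F x) i ^ 2 = ∑ j, z j ^ 2 * ∑ i, u (F x) i ^ 2 := by
          rw [Finset.sum_comm]
          simp only [Finset.mul_sum]
        simp only [Finset.sum_add_distrib, e2, ← Finset.mul_sum, normDensity, Finset.sum_mul]
        ring
  refine key.trans (add_le_add_right ?_ _)
  by_cases hl : x ∈ boundaryLayer a b δ
  · rw [indicator_of_mem hl, mul_assoc]
    refine mul_le_mul_of_nonneg_left (mul_le_mul_of_nonneg_right ?_ (normDensity_nonneg x)) two_pos.le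
    have hp : ∀ k, |partialDeriv a b k (cutoff a b δ) x| ≤ δ⁻¹ := fun k =>
      abs_partialDeriv_le hF.lt (fun x _ y _ => cutoff_lipschitz hδ x y) hxI
        hχ.differentiableWithinAt k
    calc ∑ i, z i ^ 2 ≤ ∑ _i : Fin (n + 1), (n + 1 : ℕ) * Λ ^ 2 * ((n + 1 : ℕ) * δ⁻¹ ^ 2) := by
          refine Finset.sum_le_sum fun i _ => ?_
          refine (sq_sum_mul_le (fun k => hΛ.inv_le x hxI k i)).trans ?_
          rw [Fintype.card_fin]
          refine mul_le_mul_of_nonneg_left ?_ (by positivity)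
          calc _ ≤ ∑ _k : Fin (n + 1), δ⁻¹ ^ 2 := Finset.sum_le_sum fun k _ => by
                rw [← sq_abs]; exact pow_le_pow_left₀ (abs_nonneg _) (hp k) 2
            _ = _ := by simp
      _ = _ := by simp; ring
  · have h1 := cutoff_eventuallyEq_one hδ hl
    have hz0 : ∀ i, z i = 0 := fun i => by
      refine Finset.sum_eq_zero fun k _ => ?_
      rw [partialDeriv, (h1.filter_mono nhdsWithin_le_nhds).fderivWithin_eq h1.self_of_nhds]
      simp
    rw [indicator_of_notMem hl]
    simp [hz0]

/-- The gradient is controlled by the symmetric gradient and by terms in the boundary layer. -/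
theorem integral_gradDensity_le_layer (hF : RegularMap a b F) (hΛ : GeomBound a b F Λ)
    (hc : ∀ j, ContinuousOn (fun x => u (F x) j) (Icc a b))
    (hd : ∀ j (J : M.Elem), ContDiffOn ℝ 1 (fun x => u (F x) j) (M.closedElem J)) {δ : ℝ}
    (hδ : 0 < δ) :
    ∫ x in Icc a b, gradDensity a b F u x ≤ Λ ^ 2 * (4 * (∫ x in Icc a b, symDensity a b F u x) +
      4 * ((n + 1 : ℕ) ^ 3 * Λ ^ 2 * δ⁻¹ ^ 2) *
        (∫ x in Icc a b ∩ boundaryLayer a b δ, normDensity F u x) +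
      ∫ x in Icc a b ∩ boundaryLayer a b δ, gradDensity a b F u x) := by
  obtain ⟨iG, iS, hkorn⟩ := korn_cutField hF hΛ hc hd hδ
  set V := cutField a b F u δ with hV
  set Z : ℝ := (n + 1 : ℕ) ^ 3 * Λ ^ 2 * δ⁻¹ ^ 2 with hZ
  have hmL := measurableSet_boundaryLayer a b δ
  have hΛ0 := hΛ.pos
  have hg : IntegrableOn (gradDensity a b F u) (Icc a b) := (pwCont_gradDensity hF hd).integrableOn
  have hs : IntegrableOn (symDensity a b F u) (Icc a b) := (pwCont_symDensity hF hd).integrableOn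
  have hU : IntegrableOn (normDensity F u) (Icc a b) :=
    (pwCont_normDensity (M := M) hc).integrableOn
  have hcut : ∀ᵐ x : Pt n, DifferentiableAt ℝ (cutoff a b δ) x := by
    refine LipschitzWith.ae_differentiableAt (C := ⟨δ⁻¹, by positivity⟩) ?_
    refine LipschitzWith.of_dist_le_mul fun x y => ?_
    rw [Real.dist_eq, dist_eq_norm]
    exact cutoff_lipschitz hδ x y
  have hpd : ∀ᵐ x : Pt n, x ∈ Icc a b → x ∈ paramDomain a b := by
    filter_upwards [(paramDomain_ae_eq_Icc a b).mem_iff] with x hx using hx.2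
  have hgL : IntegrableOn ((boundaryLayer a b δ).indicator (gradDensity a b F u)) (Icc a b) :=
    hg.indicator hmL
  have hUL : IntegrableOn ((boundaryLayer a b δ).indicator (normDensity F u)) (Icc a b) :=
    hU.indicator hmL
  -- Off the layer the cut field has the same gradient as `u`; in the layer the uncut gradient is
  -- simply added to the right-hand side. The factor `Λ` compensates for the Jacobian weight.
  have step1 : ∫ x in Icc a b, gradDensity a b F u x ≤
      Λ * (∫ x in Icc a b, |(jac a b F x).det| * gradDensity a b F V x) +
        ∫ x in Icc a b, (boundaryLayer a b δ).indicator (gradDensity a b F u) x := by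
    rw [← integral_const_mul, ← integral_add (iG.const_mul Λ) hgL]
    refine setIntegral_mono_ae_restrict hg ((iG.const_mul Λ).add hgL) ?_
    rw [EventuallyLE, ae_restrict_iff' measurableSet_Icc]
    filter_upwards [hpd, M.ae_mem_regular] with x h1 hr hx
    have hnn : 0 ≤ Λ * (|(jac a b F x).det| * gradDensity a b F V x) := by
      have := gradDensity_nonneg (a := a) (b := b) (F := F) (u := V) x
      positivity
    by_cases hl : x ∈ boundaryLayer a b δ
    · rw [indicator_of_mem hl]; linarith
    · rw [indicator_of_notMem hl, add_zero, hV, gradDensity_cutField_eq hF hδ (h1 hx) hl fun j =>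
        differentiableWithinAt_of_regular (hd j) hx hr, ← mul_assoc]
      refine le_mul_of_one_le_left (gradDensity_nonneg x) ?_
      have := mul_le_mul_of_nonneg_left (hΛ.det_lower x hx) hΛ0.le
      rwa [mul_inv_cancel₀ hΛ0.ne'] at this
  have step2 : ∫ x in Icc a b, |(jac a b F x).det| * symDensity a b F V x ≤
      Λ * (2 * (∫ x in Icc a b, symDensity a b F u x) +
        2 * Z * ∫ x in Icc a b, (boundaryLayer a b δ).indicator (normDensity F u) x) := by
    rw [← integral_const_mul, ← integral_const_mul, ← integral_add (hs.const_mul 2)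
      (hUL.const_mul (2 * Z)), ← integral_const_mul]
    refine setIntegral_mono_ae_restrict iS
      (((hs.const_mul 2).add (hUL.const_mul (2 * Z))).const_mul Λ) ?_
    rw [EventuallyLE, ae_restrict_iff' measurableSet_Icc]
    filter_upwards [hpd, M.ae_mem_regular, hcut] with x h1 hr hx1 hx
    refine mul_le_mul (hΛ.det_upper x hx) ?_ (symDensity_nonneg x) hΛ0.le
    refine (symDensity_cutField_le hF hΛ hδ (h1 hx) (fun j =>
        differentiableWithinAt_of_regular (hd j) hx hr) hx1).trans (le_of_eq ?_)
    by_cases hl : x ∈ boundaryLayer a b δ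
    · simp only [indicator_of_mem hl, hZ]
    · simp only [indicator_of_notMem hl, mul_zero]
  rw [setIntegral_indicator hmL] at step1 step2
  have hGL0 : 0 ≤ ∫ x in Icc a b ∩ boundaryLayer a b δ, gradDensity a b F u x :=
    integral_nonneg fun x => gradDensity_nonneg x
  have hΛ1 : 1 ≤ Λ ^ 2 := one_le_pow₀ hΛ.one_le
  have h3 := mul_le_mul_of_nonneg_left (hkorn.trans (mul_le_mul_of_nonneg_left step2 two_pos.le))
    hΛ0.le
  have h4 := le_mul_of_one_le_left hGL0 hΛ1
  calc _ ≤ _ := step1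
    _ ≤ _ := add_le_add h3 h4
    _ = _ := by ring

/-! ### Integrals over the boundary layer -/

/-- The sum of the integrals over the faces of the box. -/
def faceSum (a b : Pt n) (g : Pt n → ℝ) : ℝ :=
  ∑ i : Fin (n + 1),
    ((∫ y in Icc (fun l => a (i.succAbove l)) fun l => b (i.succAbove l), g (i.insertNth (b i) y)) +
      ∫ y in Icc (fun l => a (i.succAbove l)) fun l => b (i.succAbove l), g (i.insertNth (a i) y))

theorem faceSum_nonneg {g : Pt n → ℝ} (hg : ∀ x, 0 ≤ g x) : 0 ≤ faceSum a b g :=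
  Finset.sum_nonneg fun _ _ => add_nonneg (integral_nonneg fun _ => hg _)
    (integral_nonneg fun _ => hg _)

/-- The layer is the union of the slabs along the faces. Near edges the slabs overlap, whence an
inequality. -/
theorem integral_layer_le_sum {g : Pt n → ℝ} (hg : IntegrableOn g (Icc a b)) (h0 : ∀ x, 0 ≤ g x)
    {δ : ℝ} (hab : ∀ i, a i + δ ≤ b i) :
    ∫ x in Icc a b ∩ boundaryLayer a b δ, g x ≤
      ∑ i, ((∫ x in slab a b i (b i - δ) (b i), g x) + ∫ x in slab a b i (a i) (a i + δ), g x) := by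
  have hsubA : ∀ i, slab a b i (a i) (a i + δ) ⊆ Icc a b := fun i => slab_subset le_rfl (hab i)
  have hsubB : ∀ i, slab a b i (b i - δ) (b i) ⊆ Icc a b := fun i =>
    slab_subset (by linarith [hab i]) le_rfl
  have hm : ∀ i s t, MeasurableSet (slab a b i s t) := fun i s t => measurableSet_Icc
  have iA := fun i => (hg.mono_set (hsubA i)).integrable_indicator (hm i _ _)
  have iB := fun i => (hg.mono_set (hsubB i)).integrable_indicator (hm i _ _)
  have hmL : MeasurableSet (Icc a b ∩ boundaryLayer a b δ) :=
    measurableSet_Icc.inter (measurableSet_boundaryLayer a b δ)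
  simp only [← integral_indicator (hm _ _ _)]
  rw [← integral_indicator hmL]
  simp only [← integral_add (iB _) (iA _)]
  have e := integral_finsetSum Finset.univ (f := fun i x => (slab a b i (b i - δ) (b i)).indicator g x +
    (slab a b i (a i) (a i + δ)).indicator g x) fun i _ => (iB i).add (iA i)
  rw [← e]
  refine integral_mono ((hg.mono_set inter_subset_left).integrable_indicator hmL)
    (integrable_finsetSum _ fun i _ => (iB i).add (iA i)) fun x => ?_
  have hnn : ∀ i s t, 0 ≤ (slab a b i s t).indicator g x := fun i s t =>
    indicator_nonneg (fun x _ => h0 x) x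
  by_cases hx : x ∈ Icc a b ∩ boundaryLayer a b δ
  · rw [indicator_of_mem hx]
    obtain ⟨hxI, i, hi⟩ := hx
    refine le_trans ?_ (Finset.single_le_sum (fun i _ => add_nonneg (hnn i _ _) (hnn i _ _))
      (Finset.mem_univ i))
    rcases hi with hi | hi
    · have : x ∈ slab a b i (a i) (a i + δ) := (mem_slab le_rfl (hab i)).2 ⟨hxI, hxI.1 i, hi⟩
      rw [indicator_of_mem this]
      linarith [hnn i (b i - δ) (b i)]
    · have : x ∈ slab a b i (b i - δ) (b i) :=
        (mem_slab (by linarith [hab i]) le_rfl).2 ⟨hxI, hi, hxI.2 i⟩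
      rw [indicator_of_mem this]
      linarith [hnn i (a i) (a i + δ)]
  · rw [indicator_of_notMem hx]
    exact Finset.sum_nonneg fun i _ => add_nonneg (hnn i _ _) (hnn i _ _)

theorem faceSum_mono {f g : Pt n → ℝ} (hf : M.PwCont f) (hg : M.PwCont g)
    (h : ∀ x ∈ Icc a b, x ∈ M.regular → f x ≤ g x) : faceSum a b f ≤ faceSum a b g := by
  have hface : ∀ i c, c ∈ Icc (a i) (b i) → c ∈ M.lineRegular i →
      ∫ y in Icc (fun l => a (i.succAbove l)) fun l => b (i.succAbove l), f (i.insertNth c y) ≤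
        ∫ y in Icc (fun l => a (i.succAbove l)) fun l => b (i.succAbove l), g (i.insertNth c y) := by
    intro i c hc hcr
    refine setIntegral_mono_ae_restrict (hf.integrableOn_face hc hcr) (hg.integrableOn_face hc hcr) ?_
    rw [EventuallyLE, ae_restrict_iff' measurableSet_Icc]
    filter_upwards [M.ae_mem_faceRegular i] with y hyr hy
    exact h _ (ParamMesh.insertNth_mem_Icc.2 ⟨hc, hy⟩) ((ParamMesh.insertNth_mem_regular M).2 ⟨hcr, hyr⟩)
  exact Finset.sum_le_sum fun i _ => add_le_add
    (hface i _ (right_mem_Icc.2 (M.bounds_lt i).le) (M.right_mem_lineRegular i))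
    (hface i _ (left_mem_Icc.2 (M.bounds_lt i).le) (M.left_mem_lineRegular i))

theorem faceSum_const_mul (c : ℝ) (g : Pt n → ℝ) :
    faceSum a b (fun x => c * g x) = c * faceSum a b g := by
  simp only [faceSum, integral_const_mul, ← mul_add, Finset.mul_sum]

theorem faceSum_add {f g : Pt n → ℝ} (hf : M.PwCont f) (hg : M.PwCont g) :
    faceSum a b (fun x => f x + g x) = faceSum a b f + faceSum a b g := by
  simp only [faceSum, ← Finset.sum_add_distrib]
  refine Finset.sum_congr rfl fun i _ => ?_
  rw [integral_add (hf.integrableOn_face (right_mem_Icc.2 (M.bounds_lt i).le)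
      (M.right_mem_lineRegular i)) (hg.integrableOn_face (right_mem_Icc.2 (M.bounds_lt i).le)
      (M.right_mem_lineRegular i)),
    integral_add (hf.integrableOn_face (left_mem_Icc.2 (M.bounds_lt i).le)
      (M.left_mem_lineRegular i)) (hg.integrableOn_face (left_mem_Icc.2 (M.bounds_lt i).le)
      (M.left_mem_lineRegular i))]
  ring

/-- Trace inequality on the faces, for densities with an inverse inequality along lines. -/
theorem faceSum_le {q : Pt n → ℝ} (hq : M.PwCont q) {C : ℝ}
    (hline : ∀ i, ∀ y ∈ Icc (fun l => a (i.succAbove l)) fun l => b (i.succAbove l),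
      y ∈ M.faceRegular i → ∀ t ∈ Icc (a i) (b i), t ∈ M.lineRegular i →
        q (i.insertNth t y) ≤ C * ∫ r in Icc (a i) (b i), q (i.insertNth r y)) :
    faceSum a b q ≤ 2 * (n + 1 : ℕ) * C * ∫ x in Icc a b, q x := by
  calc faceSum a b q ≤ ∑ _i : Fin (n + 1), 2 * (C * ∫ x in Icc a b, q x) := by
        refine Finset.sum_le_sum fun i _ => ?_
        rw [two_mul]
        exact add_le_add
          (ParamMesh.integral_face_le hq (right_mem_Icc.2 (M.bounds_lt i).le)
            (M.right_mem_lineRegular i) (hline i))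
          (ParamMesh.integral_face_le hq (left_mem_Icc.2 (M.bounds_lt i).le)
            (M.left_mem_lineRegular i) (hline i))
    _ = _ := by
        rw [Finset.sum_const, Finset.card_univ, Fintype.card_fin, nsmul_eq_mul]
        ring

/-- Smallness of densities with an inverse inequality along lines in the boundary layer. -/
theorem slabSum_le {q : Pt n → ℝ} (hq : M.PwCont q) {C δ : ℝ} (hδ : 0 < δ)
    (hab : ∀ i, a i + δ ≤ b i)
    (hline : ∀ i, ∀ y ∈ Icc (fun l => a (i.succAbove l)) fun l => b (i.succAbove l),
      y ∈ M.faceRegular i → ∀ t ∈ Icc (a i) (b i), t ∈ M.lineRegular i →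
        q (i.insertNth t y) ≤ C * ∫ r in Icc (a i) (b i), q (i.insertNth r y)) :
    ∑ i, ((∫ x in slab a b i (b i - δ) (b i), q x) + ∫ x in slab a b i (a i) (a i + δ), q x) ≤
      2 * (n + 1 : ℕ) * (δ * C) * ∫ x in Icc a b, q x := by
  calc _ ≤ ∑ _i : Fin (n + 1), 2 * (δ * C * ∫ x in Icc a b, q x) := by
        refine Finset.sum_le_sum fun i _ => ?_
        have hB := ParamMesh.integral_slab_le hq (i := i) (s := b i - δ) (t := b i)
          (by linarith [hab i]) le_rfl (by linarith) (hline i)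
        have hA := ParamMesh.integral_slab_le hq (i := i) (s := a i) (t := a i + δ)
          le_rfl (hab i) (by linarith) (hline i)
        rw [sub_sub_cancel] at hB
        rw [add_sub_cancel_left] at hA
        linarith
    _ = _ := by
        rw [Finset.sum_const, Finset.card_univ, Fintype.card_fin, nsmul_eq_mul]
        ring

theorem integral_slab_normDensity_le (hc : ∀ j, ContinuousOn (fun x => u (F x) j) (Icc a b))
    (hd : ∀ j (J : M.Elem), ContDiffOn ℝ 1 (fun x => u (F x) j) (M.closedElem J))
    {i : Fin (n + 1)} {s t c : ℝ} (hs : a i ≤ s) (ht : t ≤ b i) (hcm : c ∈ Icc s t)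
    (hcr : c ∈ M.lineRegular i) :
    ∫ x in slab a b i s t, normDensity F u x ≤
      2 * (t - s) * (∫ y in Icc (fun l => a (i.succAbove l)) fun l => b (i.succAbove l),
        normDensity F u (i.insertNth c y)) +
      2 * (t - s) ^ 2 * ∫ x in slab a b i s t, pullDensity a b F u x := by
  have hsub := slab_subset (a := a) (b := b) (i := i) hs ht
  have hcI : c ∈ Icc (a i) (b i) := ⟨hs.trans hcm.1, hcm.2.trans ht⟩
  have hp : ∀ j, M.PwCont fun x => u (F x) j ^ 2 := fun j =>
    (ParamMesh.PwCont.of_continuousOn (hc j)).sq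
  have hq : ∀ j, M.PwCont fun x => partialDeriv a b i (fun z => u (F z) j) x ^ 2 := fun j =>
    (M.pwCont_partialDeriv (hd j) i).sq
  have e1 : ∫ x in slab a b i s t, normDensity F u x =
      ∑ j, ∫ x in slab a b i s t, u (F x) j ^ 2 :=
    integral_finsetSum _ fun j _ => (hp j).integrableOn.mono_set hsub
  have e2 : ∫ y in Icc (fun l => a (i.succAbove l)) fun l => b (i.succAbove l),
        normDensity F u (i.insertNth c y) =
      ∑ j, ∫ y in Icc (fun l => a (i.succAbove l)) fun l => b (i.succAbove l),
        u (F (i.insertNth c y)) j ^ 2 :=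
    integral_finsetSum _ fun j _ => (hp j).integrableOn_face hcI hcr
  have e3 : ∑ j, ∫ x in slab a b i s t, partialDeriv a b i (fun z => u (F z) j) x ^ 2 ≤
      ∫ x in slab a b i s t, pullDensity a b F u x := by
    have e := integral_finsetSum (μ := volume.restrict (slab a b i s t)) Finset.univ
      (f := fun j x => partialDeriv a b i (fun z => u (F z) j) x ^ 2) fun j _ =>
        (hq j).integrableOn.mono_set hsub
    rw [← e]
    refine integral_mono (integrable_finsetSum _ fun j _ => (hq j).integrableOn.mono_set hsub)
      ((pwCont_pullDensity hd).integrableOn.mono_set hsub) fun x => ?_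
    exact Finset.single_le_sum (f := fun k => ∑ j, partialDeriv a b k (fun z => u (F z) j) x ^ 2)
      (fun k _ => Finset.sum_nonneg fun j _ => sq_nonneg _) (Finset.mem_univ i)
  rw [e1, e2]
  refine le_trans (Finset.sum_le_sum fun j _ =>
    ParamMesh.integral_slab_sq_le (hc j) (hd j) hs ht hcm hcr) ?_
  rw [Finset.sum_add_distrib, ← Finset.mul_sum, ← Finset.mul_sum]
  exact add_le_add_right (mul_le_mul_of_nonneg_left e3 (by positivity)) _

/-- Poincaré inequality in the slabs along the boundary. -/
theorem slabSum_normDensity_le (hc : ∀ j, ContinuousOn (fun x => u (F x) j) (Icc a b))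
    (hd : ∀ j (J : M.Elem), ContDiffOn ℝ 1 (fun x => u (F x) j) (M.closedElem J)) {δ : ℝ}
    (hδ : 0 < δ) (hab : ∀ i, a i + δ ≤ b i) :
    ∑ i, ((∫ x in slab a b i (b i - δ) (b i), normDensity F u x) +
        ∫ x in slab a b i (a i) (a i + δ), normDensity F u x) ≤
      2 * δ * faceSum a b (normDensity F u) +
      2 * δ ^ 2 * ∑ i, ((∫ x in slab a b i (b i - δ) (b i), pullDensity a b F u x) +
        ∫ x in slab a b i (a i) (a i + δ), pullDensity a b F u x) := by
  have h := fun i s t c hs ht hcm hcr =>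
    integral_slab_normDensity_le hc hd (i := i) (s := s) (t := t) (c := c) hs ht hcm hcr
  rw [faceSum, Finset.mul_sum, Finset.mul_sum, ← Finset.sum_add_distrib]
  refine Finset.sum_le_sum fun i _ => ?_
  have hB := h i (b i - δ) (b i) (b i) (by linarith [hab i]) le_rfl
    (right_mem_Icc.2 (by linarith)) (M.right_mem_lineRegular i)
  have hA := h i (a i) (a i + δ) (a i) le_rfl (hab i)
    (left_mem_Icc.2 (by linarith)) (M.left_mem_lineRegular i)
  rw [sub_sub_cancel] at hB
  rw [add_sub_cancel_left] at hA
  linarith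

end SkelStab

end


noncomputable section

namespace SkelStab

variable {n : ℕ} {a b : Pt n} {F : Pt n → Pt n} {M : ParamMesh a b} {Λ : ℝ} {u : Pt n → Pt n}

/-! ### Coercivity -/

theorem integral_mono_regular {f g : Pt n → ℝ} (hf : M.PwCont f) (hg : M.PwCont g)
    {s : Set (Pt n)} (hs : s ⊆ Icc a b) (hsm : MeasurableSet s)
    (h : ∀ x ∈ Icc a b, x ∈ M.regular → f x ≤ g x) : ∫ x in s, f x ≤ ∫ x in s, g x := by
  refine setIntegral_mono_ae_restrict (hf.integrableOn.mono_set hs) (hg.integrableOn.mono_set hs) ?_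
  rw [EventuallyLE, ae_restrict_iff' hsm]
  filter_upwards [M.ae_mem_regular] with x hr hx using h x (hs hx) hr

/-- Poincaré inequality with boundary values. -/
theorem integral_normDensity_le (hc : ∀ j, ContinuousOn (fun x => u (F x) j) (Icc a b))
    (hdf : ∀ j (J : M.Elem), ContDiffOn ℝ 1 (fun x => u (F x) j) (M.closedElem J)) {r ℓ : ℝ}
    (hr : 0 < r) (hrℓ' : r ≤ b 0 - a 0) (hℓ : b 0 - a 0 ≤ ℓ) :
    ∫ x in Icc a b, normDensity F u x ≤ 2 * ℓ ^ 2 * (faceSum a b (normDensity F u) / r) +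
      2 * ℓ ^ 2 * ∫ x in Icc a b, pullDensity a b F u x := by
  have hrℓ := hrℓ'.trans hℓ
  have hℓ0 : 0 < ℓ := hr.trans_le hrℓ
  set B := faceSum a b (normDensity F u) with hB
  set D := ∫ x in Icc a b, pullDensity a b F u x with hD
  have nB : 0 ≤ B := faceSum_nonneg fun x => normDensity_nonneg x
  have h := integral_slab_normDensity_le (F := F) (u := u) hc hdf (i := 0) (s := a 0) (t := b 0)
    le_rfl le_rfl (right_mem_Icc.2 (M.bounds_lt 0).le) (M.right_mem_lineRegular 0)
  have es : slab a b 0 (a 0) (b 0) = Icc a b := by simp [slab]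
  rw [es] at h
  have nD : 0 ≤ D := integral_nonneg fun x => pullDensity_nonneg x
  have hf : (∫ y in Icc (fun l => a (Fin.succAbove 0 l)) fun l => b (Fin.succAbove 0 l),
      normDensity F u (Fin.insertNth 0 (b 0) y)) ≤ B := by
    have := Finset.single_le_sum (f := fun i : Fin (n + 1) =>
      ((∫ y in Icc (fun l => a (i.succAbove l)) fun l => b (i.succAbove l),
        normDensity F u (i.insertNth (b i) y)) +
      ∫ y in Icc (fun l => a (i.succAbove l)) fun l => b (i.succAbove l),
        normDensity F u (i.insertNth (a i) y))) (fun i _ => add_nonneg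
        (integral_nonneg fun _ => normDensity_nonneg _)
        (integral_nonneg fun _ => normDensity_nonneg _)) (Finset.mem_univ 0)
    refine le_trans ?_ this
    exact le_add_of_nonneg_right (integral_nonneg fun _ => normDensity_nonneg _)
  have hl0 : 0 < b 0 - a 0 := by linarith [M.bounds_lt 0]
  have hsq : (b 0 - a 0) ^ 2 ≤ ℓ ^ 2 := pow_le_pow_left₀ hl0.le (hℓ) 2
  -- A Poincaré inequality would give `ℓ B`. Since `r ≤ ℓ`, it is weakened to `ℓ² (B / r)`, so that
  -- all boundary terms carry the scaling `B / r`.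
  have hb1 : (b 0 - a 0) * B ≤ ℓ ^ 2 * (B / r) := by
    have : (b 0 - a 0) * B ≤ ℓ * B := mul_le_mul_of_nonneg_right (hℓ) nB
    refine this.trans ?_
    have h2 : ℓ * B = ℓ * r * (B / r) := by field_simp
    rw [h2]
    exact mul_le_mul_of_nonneg_right (by nlinarith) (by positivity)
  have h3 := mul_le_mul_of_nonneg_left hf hl0.le
  have h4 := mul_le_mul_of_nonneg_right hsq nD
  nlinarith

/-- Absorption of a small multiple of `Q`. -/
theorem absorb_le {c2 c3 A Y X S G b' D U Q L : ℝ} (p2 : 0 ≤ c2) (p3 : 0 ≤ c3) (pA : 0 ≤ A)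
    (pY : 0 ≤ Y) (pX : 0 ≤ X) (nS : 0 ≤ S) (nG : 0 ≤ G) (nb : 0 ≤ b')
    (hX : X * (c3 * ((1 + 2 * L ^ 2) * c2 + 2 * L ^ 2)) ≤ 1 / 2) (hG : G ≤ A * S + Y * b' + X * Q)
    (DG : D ≤ c2 * G) (UB : U ≤ 2 * L ^ 2 * b' + 2 * L ^ 2 * D) (Q3 : Q ≤ c3 * (D + U)) :
    Q ≤ c3 * ((1 + 2 * L ^ 2) * c2 + 2 * L ^ 2) * (2 * A + 2 * Y + 1 + 1) * (S + b') := by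
  obtain ⟨K, hK⟩ : ∃ K, K = c3 * ((1 + 2 * L ^ 2) * c2 + 2 * L ^ 2) := ⟨_, rfl⟩
  have pK : 0 ≤ K := by rw [hK]; positivity
  rw [← hK] at hX ⊢
  have QG : Q ≤ K * (G + b') := by
    have h2 : D + U ≤ ((1 + 2 * L ^ 2) * c2 + 2 * L ^ 2) * (G + b') := by
      have h3 : (1 + 2 * L ^ 2) * D ≤ (1 + 2 * L ^ 2) * (c2 * G) :=
        mul_le_mul_of_nonneg_left DG (by positivity)
      have h4 : 0 ≤ (1 + 2 * L ^ 2) * c2 * b' := by positivity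
      have h5 : 0 ≤ 2 * L ^ 2 * G := by positivity
      linarith
    rw [hK, mul_assoc]
    exact Q3.trans (mul_le_mul_of_nonneg_left h2 p3)
  have h1 : X * Q ≤ 1 / 2 * (G + b') := by
    calc X * Q ≤ X * (K * (G + b')) := mul_le_mul_of_nonneg_left QG pX
      _ = X * K * (G + b') := by ring
      _ ≤ _ := mul_le_mul_of_nonneg_right hX (by positivity)
  have G4 : G ≤ (2 * A + 2 * Y + 1) * (S + b') := by
    have h3 : 0 ≤ (2 * Y + 1) * S := by positivity
    have h4 : 0 ≤ 2 * A * b' := by positivity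
    linarith
  rw [mul_assoc]
  refine QG.trans (mul_le_mul_of_nonneg_left ?_ pK)
  linarith

/-- The traces of the gradient on the faces are controlled by the symmetric gradient and the
boundary values, with the scaling of an inverse inequality. -/
theorem exists_faceSum_gradDensity_le (n m : ℕ) (Λ ℓ : ℝ) (hΛ1 : 1 ≤ Λ) (hℓ0 : 0 < ℓ) :
    ∃ C : ℝ, 0 < C ∧ ∀ {a b : Pt n} {F : Pt n → Pt n} {M : ParamMesh a b} {w u : Pt n → Pt n}
      (_ : RegularMap a b F) (_ : GeomBound a b F Λ)
      (_ : ∀ J : M.Elem, ContDiffOn ℝ 2 F (M.closedElem J)) (_ : IsDiscreteField F M m w u)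
      (_ : ∀ i, b i - a i ≤ ℓ) {r : ℝ} (_ : 0 < r) (_ : ∀ (J : M.Elem) i, r ≤ M.hi J i - M.lo J i),
      faceSum a b (gradDensity a b F u) ≤ C / r *
        ((∫ x in Icc a b, symDensity a b F u x) + faceSum a b (normDensity F u) / r) := by
  obtain ⟨c0, hc0, hline⟩ := exists_line_inverse_ineq m
  have hΛ0 : 0 < Λ := one_pos.trans_le hΛ1
  obtain ⟨d, hd⟩ : ∃ d : ℝ, d = ((n + 1 : ℕ) : ℝ) := ⟨_, rfl⟩
  have hd1 : 1 ≤ d := by rw [hd]; exact_mod_cast Nat.succ_le_succ (Nat.zero_le n)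
  have hd0 : 0 < d := one_pos.trans_le hd1
  obtain ⟨c1, hc1⟩ : ∃ c1, c1 = 2 * (d * Λ ^ 2) ^ 3 := ⟨_, rfl⟩
  obtain ⟨c2, hc2⟩ : ∃ c2, c2 = (d * Λ) ^ 2 := ⟨_, rfl⟩
  obtain ⟨c3, hc3⟩ : ∃ c3, c3 = 4 * (d * Λ ^ 2) ^ 7 := ⟨_, rfl⟩
  obtain ⟨Zc, hZc⟩ : ∃ Zc, Zc = d ^ 3 * Λ ^ 2 := ⟨_, rfl⟩
  have p1 : 0 < c1 := by rw [hc1]; positivity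
  have p2 : 0 < c2 := by rw [hc2]; positivity
  have p3 : 0 < c3 := by rw [hc3]; positivity
  have pZ : 0 < Zc := by rw [hZc]; positivity
  -- `P θ` is the coefficient with which `Q`, the integral of `|w|² + |Dw|²`, returns from the
  -- layer. The part `8 Zc` comes from `|u|²/δ²` after the Poincaré inequality, the part `c2` from
  -- the gradient in the layer.
  obtain ⟨P, hP⟩ : ∃ P, P = Λ ^ 2 * (8 * Zc + c2) * (2 * d * c0 * c1) := ⟨_, rfl⟩
  -- `Q ≤ K3 (G + B / r)`, where `G` is the integral of `|∇u|²` and `B` that of `|u|²` over the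
  -- faces: `w` is controlled by `D(u ∘ F)` and `u`, and `u` by Poincaré.
  obtain ⟨K3, hK3⟩ : ∃ K3, K3 = c3 * ((1 + 2 * ℓ ^ 2) * c2 + 2 * ℓ ^ 2) := ⟨_, rfl⟩
  have pP : 0 < P := by rw [hP]; positivity
  have pK3 : 0 < K3 := by rw [hK3]; positivity
  -- Chosen so that `P θ K3 ≤ 1 / 2`, which permits absorption, and `θ ≤ 1`, so that the layer is no
  -- wider than `r`.
  obtain ⟨θ, hθ⟩ : ∃ θ, θ = 1 / (1 + 2 * P * K3) := ⟨_, rfl⟩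
  have pθ : 0 < θ := by rw [hθ]; positivity
  have hθ1 : θ ≤ 1 := by
    rw [hθ, div_le_one (by positivity)]
    have : 0 < P * K3 := by positivity
    nlinarith
  have hθ2 : P * θ * K3 ≤ 1 / 2 := by
    have : P * θ * K3 = P * K3 / (1 + 2 * P * K3) := by rw [hθ]; ring
    rw [this, div_le_iff₀ (by positivity)]
    nlinarith
  obtain ⟨K4, hK4⟩ : ∃ K4, K4 = 2 * (4 * Λ ^ 2) + 2 * (8 * Λ ^ 2 * Zc / θ) + 1 := ⟨_, rfl⟩
  have pK4 : 0 < K4 := by rw [hK4]; positivity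
  refine ⟨c2 * (c1 * (2 * d * c0 * (K3 * (K4 + 1)))), by positivity, ?_⟩
  intro a b F M w u hF hΛ hM hu hℓ r hr hside
  have hc := hu.continuousOn_comp hF
  have hdf := hu.contDiffOn_comp hF hM
  have hdiff : ∀ x ∈ Icc a b, x ∈ M.regular → ∀ j,
      DifferentiableWithinAt ℝ (fun z => u (F z) j) (Icc a b) x := fun x hx hxr j =>
    differentiableWithinAt_of_regular (hdf j) hx hxr
  have hpq := hu.poly.pwCont_sobolevDensity
  have hpG := pwCont_gradDensity hF hdf
  have hpD := pwCont_pullDensity hdf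
  have hpU := pwCont_normDensity (M := M) hc
  set q := sobolevDensity a b w with hq
  have l1 : ∀ x ∈ Icc a b, x ∈ M.regular → pullDensity a b F u x ≤ c1 * q x := fun x hx hxr => by
    rw [hc1, hd]; exact hu.pullDensity_le hF hΛ hM hx hxr
  have l2 : ∀ x ∈ Icc a b, x ∈ M.regular → gradDensity a b F u x ≤ c2 * pullDensity a b F u x :=
    fun x hx hxr => by rw [hc2, hd]; exact gradDensity_le hF hΛ hx (hdiff x hx hxr)
  have l2' : ∀ x ∈ Icc a b, x ∈ M.regular → pullDensity a b F u x ≤ c2 * gradDensity a b F u x :=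
    fun x hx hxr => by rw [hc2, hd]; exact pullDensity_le_gradDensity hF hΛ hx (hdiff x hx hxr)
  have l3 : ∀ x ∈ Icc a b, x ∈ M.regular →
      q x ≤ c3 * (pullDensity a b F u x + normDensity F u x) := fun x hx hxr => by
    rw [hc3, hd]; exact hu.sobolevDensity_le hF hΛ hM hx hxr
  have lq : ∀ x ∈ Icc a b, x ∈ M.regular → gradDensity a b F u x ≤ c2 * (c1 * q x) :=
    fun x hx hxr => (l2 x hx hxr).trans (mul_le_mul_of_nonneg_left (l1 x hx hxr) p2.le)
  have hrl : ∀ i, r ≤ b i - a i := by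
    intro i
    let J : M.Elem := fun i => ⟨0, M.N_pos i⟩
    have h1 := hside J i
    have h2 := M.closedElem_subset J (left_mem_Icc.2 fun i => (M.lo_lt_hi J i).le)
    have h3 := M.closedElem_subset J (right_mem_Icc.2 fun i => (M.lo_lt_hi J i).le)
    linarith [h2.1 i, h3.2 i]
  have hrℓ : r ≤ ℓ := (hrl 0).trans (hℓ 0)
  -- The layer width is proportional to `r`, with a factor that depends only on the geometry and the
  -- degree. Thus the factor `r⁻¹` of the inverse inequality cancels.
  obtain ⟨δ, hδ⟩ : ∃ δ, δ = θ * r := ⟨_, rfl⟩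
  have hδ0 : 0 < δ := by rw [hδ]; positivity
  have hδr : δ ≤ r := by rw [hδ]; exact mul_le_of_le_one_left hr.le hθ1
  have hδab : ∀ i, a i + δ ≤ b i := fun i => by linarith [hrl i]
  have hδ2 : ∀ i, a i ≤ b i - δ := fun i => by linarith [hrl i]
  have hlin := fun i => hline hu.poly hr hside i
  set S := ∫ x in Icc a b, symDensity a b F u x with hS
  set B := faceSum a b (normDensity F u) with hB
  obtain ⟨G, hG⟩ : ∃ G, G = ∫ x in Icc a b, gradDensity a b F u x := ⟨_, rfl⟩
  obtain ⟨Q, hQ⟩ : ∃ Q, Q = ∫ x in Icc a b, q x := ⟨_, rfl⟩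
  obtain ⟨D, hD⟩ : ∃ D, D = ∫ x in Icc a b, pullDensity a b F u x := ⟨_, rfl⟩
  obtain ⟨U, hU⟩ : ∃ U, U = ∫ x in Icc a b, normDensity F u x := ⟨_, rfl⟩
  have nS : 0 ≤ S := integral_nonneg fun x => symDensity_nonneg x
  have nB : 0 ≤ B := faceSum_nonneg fun x => normDensity_nonneg x
  have nQ : 0 ≤ Q := by rw [hQ]; exact integral_nonneg fun x => sobolevDensity_nonneg w x
  have nG : 0 ≤ G := by rw [hG]; exact integral_nonneg fun x => gradDensity_nonneg x
  -- Any density dominated by `c q` has layer mass at most a multiple of `θ Q`, because `δ · (c0 /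
  -- r) = θ c0`.
  have hsum : ∀ {f : Pt n → ℝ} {c : ℝ}, 0 ≤ c → M.PwCont f →
      (∀ x ∈ Icc a b, x ∈ M.regular → f x ≤ c * q x) →
      ∑ i, ((∫ x in slab a b i (b i - δ) (b i), f x) + ∫ x in slab a b i (a i) (a i + δ), f x) ≤
        c * (2 * d * (θ * c0) * Q) := by
    intro f c hc hf hle
    have hcq : M.PwCont fun x => c * q x := (ParamMesh.PwCont.const c).mul hpq
    have h1 := slabSum_le hpq hδ0 hδab hlin
    have e : δ * (c0 / r) = θ * c0 := by rw [hδ]; field_simp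
    rw [e, ← hQ, ← hd] at h1
    refine le_trans (Finset.sum_le_sum fun i _ => add_le_add
      (integral_mono_regular hf hcq (slab_subset (hδ2 i) le_rfl) measurableSet_Icc hle)
      (integral_mono_regular hf hcq (slab_subset le_rfl (hδab i)) measurableSet_Icc hle)) ?_
    simp only [integral_const_mul, ← mul_add, ← Finset.mul_sum]
    exact mul_le_mul_of_nonneg_left h1 hc
  have LD := hsum p1.le hpD l1
  have LG := (integral_layer_le_sum hpG.integrableOn (fun x => gradDensity_nonneg x) hδab).trans
    (hsum (mul_pos p2 p1).le hpG fun x hx hxr => (lq x hx hxr).trans_eq (mul_assoc _ _ _).symm)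
  have LU := (integral_layer_le_sum hpU.integrableOn (fun x => normDensity_nonneg x) hδab).trans
    (slabSum_normDensity_le hc hdf hδ0 hδab)
  have main := integral_gradDensity_le_layer (M := M) hF hΛ hc hdf hδ0
  rw [← hd, ← hZc, ← hG, ← hS] at main
  rw [← hB] at LU
  have nLU : (∫ x in Icc a b ∩ boundaryLayer a b δ, normDensity F u x) ≤
      2 * δ * B + 2 * δ ^ 2 * (c1 * (2 * d * (θ * c0) * Q)) :=
    LU.trans (add_le_add_right (mul_le_mul_of_nonneg_left LD (by positivity)) _)
  have main1 : G ≤ 4 * Λ ^ 2 * S + 8 * Λ ^ 2 * Zc / θ * (B / r) + P * θ * Q := by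
    refine main.trans ?_
    -- The factor `δ⁻²` of the cutoff meets `2δ B` and `2δ²` from the Poincaré inequality: the first
    -- leaves `B / r` with a factor `θ⁻¹`, the second leaves no power of `δ`.
    have h1 : 4 * (Zc * δ⁻¹ ^ 2) * (∫ x in Icc a b ∩ boundaryLayer a b δ, normDensity F u x) ≤
        8 * Zc / θ * (B / r) + 8 * Zc * (c1 * (2 * d * (θ * c0) * Q)) := by
      refine (mul_le_mul_of_nonneg_left nLU (by positivity)).trans (le_of_eq ?_)
      rw [hδ]
      field_simp
      ring
    calc _ ≤ Λ ^ 2 * (4 * S + (8 * Zc / θ * (B / r) + 8 * Zc * (c1 * (2 * d * (θ * c0) * Q))) +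
          c2 * c1 * (2 * d * (θ * c0) * Q)) := by
          refine mul_le_mul_of_nonneg_left (add_le_add (add_le_add le_rfl h1) LG) (by positivity)
      _ = _ := by rw [hP]; ring
  have DG : D ≤ c2 * G := by
    rw [hD, hG, ← integral_const_mul]
    exact integral_mono_regular hpD ((ParamMesh.PwCont.const c2).mul hpG) Subset.rfl
      measurableSet_Icc l2'
  have UB : U ≤ 2 * ℓ ^ 2 * (B / r) + 2 * ℓ ^ 2 * D := by
    rw [hU, hD]
    exact integral_normDensity_le hc hdf hr (hrl 0) (hℓ 0)
  have Q3 : Q ≤ c3 * (D + U) := by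
    rw [hQ, hD, hU, ← integral_add hpD.integrableOn hpU.integrableOn, ← integral_const_mul]
    exact integral_mono_regular hpq ((ParamMesh.PwCont.const c3).mul (hpD.add hpU)) Subset.rfl
      measurableSet_Icc l3
  have Q5 : Q ≤ K3 * (K4 + 1) * (S + B / r) := by
    rw [hK3, hK4]
    rw [hK3] at hθ2
    exact absorb_le p2.le p3.le (by positivity) (by positivity) (by positivity) nS nG
      (div_nonneg nB hr.le) hθ2 main1 DG UB Q3
  have hcq : M.PwCont fun x => c2 * c1 * q x := (ParamMesh.PwCont.const _).mul hpq
  -- The trace of the gradient is bounded by the trace of `q`, the inverse inequality along lines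
  -- bounds this by `Q / r`, and `Q` has just been controlled.
  calc faceSum a b (gradDensity a b F u) ≤ faceSum a b fun x => c2 * c1 * q x :=
        faceSum_mono hpG hcq fun x hx hxr => (lq x hx hxr).trans_eq (mul_assoc _ _ _).symm
    _ = c2 * c1 * faceSum a b q := faceSum_const_mul _ _
    _ ≤ c2 * c1 * (2 * d * (c0 / r) * Q) := by
        refine mul_le_mul_of_nonneg_left ?_ (by positivity)
        rw [hQ, hd]
        exact faceSum_le hpq hlin
    _ ≤ c2 * c1 * (2 * d * (c0 / r) * (K3 * (K4 + 1) * (S + B / r))) := by gcongr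
    _ = _ := by ring

end SkelStab

end


noncomputable section

namespace SkelStab

variable {n : ℕ} {a b : Pt n} {F : Pt n → Pt n} {M : ParamMesh a b} {Λ : ℝ} {u : Pt n → Pt n}

/-! ### Coercivity of the Nitsche form -/

/-- In a quasi-uniform mesh all sides of the parametric elements are bounded below by `h`. -/
theorem ParamMesh.IsQuasiUniform.le_side (hΛ : GeomBound a b F Λ) {κ h : ℝ} (hκ : 0 < κ)
    (hq : M.IsQuasiUniform F κ h) (J : M.Elem) (i : Fin (n + 1)) :
    κ ^ 2 / ((n + 1 : ℕ) * Λ) * h ≤ M.hi J i - M.lo J i := by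
  have hΛ0 := hΛ.pos
  set s := M.hi J i - M.lo J i with hs
  have hs0 : 0 < s := sub_pos.2 (M.lo_lt_hi J i)
  have hnorm : ∀ x ∈ M.closedElem J, ∀ y ∈ M.closedElem J, ‖x - y‖ ≤ s / κ := by
    intro x hx y hy
    refine (pi_norm_le_iff_of_nonneg (by positivity)).2 fun l => ?_
    rw [le_div_iff₀ hκ, Pi.sub_apply, Real.norm_eq_abs]
    have h1 := hq.shape J l i
    have h2 : |x l - y l| ≤ M.hi J l - M.lo J l :=
      abs_sub_le_iff.2 ⟨by linarith [hx.2 l, hy.1 l], by linarith [hy.2 l, hx.1 l]⟩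
    nlinarith
  -- The Euclidean norm costs a factor `√(n + 1)`, estimated by `n + 1`. A lower bound for the
  -- physical diameter then bounds the parametric sides from below.
  have hdiam : M.elemDiam F J ≤ (n + 1 : ℕ) * (Λ * (s / κ)) := by
    refine Metric.diam_le_of_forall_dist_le (by positivity) ?_
    rintro _ ⟨_, ⟨x, hx, rfl⟩, rfl⟩ _ ⟨_, ⟨y, hy, rfl⟩, rfl⟩
    rw [EuclideanSpace.dist_eq]
    refine Real.sqrt_le_iff.2 ⟨by positivity, ?_⟩
    have hF := (hΛ.lip x (M.closedElem_subset J hx) y (M.closedElem_subset J hy)).trans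
      (mul_le_mul_of_nonneg_left (hnorm x hx y hy) hΛ0.le)
    have hB : 0 ≤ Λ * (s / κ) := by positivity
    calc _ ≤ ∑ _l : Fin (n + 1), (Λ * (s / κ)) ^ 2 := by
          refine Finset.sum_le_sum fun l _ => pow_le_pow_left₀ dist_nonneg ?_ 2
          rw [Real.dist_eq]
          exact le_trans (norm_le_pi_norm (F x - F y) l) hF
      _ = (n + 1 : ℕ) * (Λ * (s / κ)) ^ 2 := by simp
      _ ≤ _ := by
          have h1 : (1 : ℝ) ≤ (n + 1 : ℕ) := by exact_mod_cast Nat.succ_le_succ (Nat.zero_le n)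
          rw [mul_pow ((n + 1 : ℕ) : ℝ)]
          exact mul_le_mul_of_nonneg_right (le_self_pow₀ h1 two_ne_zero) (sq_nonneg (Λ * (s / κ)))
  have h1 := (hq.diam_lower J).trans hdiam
  have h2 : κ * h * κ ≤ (n + 1 : ℕ) * Λ * s := by
    have e : ((n + 1 : ℕ) : ℝ) * (Λ * (s / κ)) = (n + 1 : ℕ) * Λ * s / κ := by ring
    rwa [e, le_div_iff₀ hκ] at h1
  rw [div_mul_eq_mul_div, div_le_iff₀ (by positivity)]
  linarith

theorem sum_unitNormal_sq (hF : RegularMap a b F) {x : Pt n} (hx : x ∈ Icc a b)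
    (i : Fin (n + 1)) : ∑ l, unitNormal a b F i x l ^ 2 = 1 := by
  have hpos := hF.euclNorm_conormal_pos hx i
  have e : euclNorm (conormal a b F i x) ^ 2 = ∑ l, conormal a b F i x l ^ 2 := by
    have h0 : 0 ≤ conormal a b F i x ⬝ᵥ conormal a b F i x :=
      Finset.sum_nonneg fun l _ => mul_self_nonneg _
    rw [euclNorm, Real.sq_sqrt h0]
    exact Finset.sum_congr rfl fun l _ => (pow_two _).symm
  simp only [unitNormal, Pi.smul_apply, smul_eq_mul, mul_pow]
  rw [← Finset.mul_sum, ← e, inv_pow, inv_mul_cancel₀ (by positivity)]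

theorem continuousOn_unitNormal (hF : RegularMap a b F) (i l : Fin (n + 1)) :
    ContinuousOn (fun x => unitNormal a b F i x l) (Icc a b) := by
  simp only [unitNormal, Pi.smul_apply, smul_eq_mul]
  have hc : ∀ l, ContinuousOn (fun x => conormal a b F i x l) (Icc a b) := hF.continuousOn_inv i
  have hn : ContinuousOn (fun x => euclNorm (conormal a b F i x)) (Icc a b) :=
    (continuousOn_finsetSum _ fun l _ => (hc l).mul (hc l)).sqrt
  exact (hn.inv₀ fun x hx => (hF.euclNorm_conormal_pos hx i).ne').mul (hc l)

/-- Young's inequality for the consistency terms. -/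
theorem two_mul_vecMul_dotProduct_le (S : Matrix (Fin (n + 1)) (Fin (n + 1)) ℝ) (ν v : Pt n)
    (hν : ∑ l, ν l ^ 2 = 1) {ε : ℝ} (hε : 0 < ε) :
    2 * (S.vecMul ν ⬝ᵥ v) ≤ ε * contract S S + ε⁻¹ * ∑ j, v j ^ 2 := by
  have h1 : ∀ j, S.vecMul ν j ^ 2 ≤ ∑ i, S i j ^ 2 := fun j => by
    have := Finset.sum_mul_sq_le_sq_mul_sq Finset.univ ν (fun i => S i j)
    rwa [hν, one_mul] at this
  have h2 : contract S S = ∑ j, ∑ i, S i j ^ 2 := by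
    rw [contract, Finset.sum_comm]
    simp only [pow_two]
  rw [h2, dotProduct, Finset.mul_sum, Finset.mul_sum, Finset.mul_sum, ← Finset.sum_add_distrib]
  refine Finset.sum_le_sum fun j _ => ?_
  have h3 := mul_le_mul_of_nonneg_left (h1 j) hε.le
  have h4 : 0 ≤ ε⁻¹ * (ε * S.vecMul ν j - v j) ^ 2 := by positivity
  have h5 : ε⁻¹ * (ε * S.vecMul ν j - v j) ^ 2 =
      ε * S.vecMul ν j ^ 2 - 2 * (S.vecMul ν j * v j) + ε⁻¹ * v j ^ 2 := by
    field_simp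
    ring
  linarith

theorem boundaryIntegral_add_const_mul {g₁ g₂ : Pt n → Pt n → ℝ} (c : ℝ)
    (h₁ : ∀ i (σ : ℝ), M.PwCont fun x => g₁ (F x) (σ • unitNormal a b F i x) * areaDensity a b F i x)
    (h₂ : ∀ i (σ : ℝ), M.PwCont fun x => g₂ (F x) (σ • unitNormal a b F i x) * areaDensity a b F i x) :
    boundaryIntegral a b F (fun y ν => g₁ y ν + c * g₂ y ν) =
      boundaryIntegral a b F g₁ + c * boundaryIntegral a b F g₂ := by
  have hf : ∀ i t (σ : ℝ), t ∈ Icc (a i) (b i) → t ∈ M.lineRegular i →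
      facetIntegral a b F i t σ (fun l => a (i.succAbove l)) (fun l => b (i.succAbove l))
        (fun y ν => g₁ y ν + c * g₂ y ν) =
      facetIntegral a b F i t σ (fun l => a (i.succAbove l)) (fun l => b (i.succAbove l)) g₁ +
        c * facetIntegral a b F i t σ (fun l => a (i.succAbove l)) (fun l => b (i.succAbove l))
          g₂ := by
    intro i t σ ht htr
    simp only [facetIntegral]
    rw [← integral_const_mul, ← integral_add ((h₁ i σ).integrableOn_face ht htr)
      (((h₂ i σ).integrableOn_face ht htr).const_mul c)]
    refine integral_congr_ae (ae_of_all _ fun y => ?_)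
    ring
  simp only [boundaryIntegral, Finset.mul_sum, ← Finset.sum_add_distrib]
  refine Finset.sum_congr rfl fun i _ => ?_
  rw [hf i (b i) 1 (right_mem_Icc.2 (M.bounds_lt i).le) (M.right_mem_lineRegular i),
    hf i (a i) (-1) (left_mem_Icc.2 (M.bounds_lt i).le) (M.left_mem_lineRegular i)]
  ring

theorem faceSum_le_boundaryIntegral {f : Pt n → ℝ} {g : Pt n → Pt n → ℝ} (hf : M.PwCont f)
    (hg : ∀ i (σ : ℝ), M.PwCont fun x => g (F x) (σ • unitNormal a b F i x) * areaDensity a b F i x)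
    (h : ∀ i (σ : ℝ), σ = 1 ∨ σ = -1 → ∀ x ∈ Icc a b, x ∈ M.regular →
      f x ≤ g (F x) (σ • unitNormal a b F i x) * areaDensity a b F i x) :
    faceSum a b f ≤ boundaryIntegral a b F g := by
  have hface : ∀ i t (σ : ℝ), σ = 1 ∨ σ = -1 → t ∈ Icc (a i) (b i) → t ∈ M.lineRegular i →
      ∫ y in Icc (fun l => a (i.succAbove l)) fun l => b (i.succAbove l), f (i.insertNth t y) ≤
        facetIntegral a b F i t σ (fun l => a (i.succAbove l)) (fun l => b (i.succAbove l)) g := by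
    intro i t σ hσ ht htr
    refine setIntegral_mono_ae_restrict (hf.integrableOn_face ht htr)
      ((hg i σ).integrableOn_face ht htr) ?_
    rw [EventuallyLE, ae_restrict_iff' measurableSet_Icc]
    filter_upwards [M.ae_mem_faceRegular i] with y hyr hy
    exact h i σ hσ _ (ParamMesh.insertNth_mem_Icc.2 ⟨ht, hy⟩)
      ((ParamMesh.insertNth_mem_regular M).2 ⟨htr, hyr⟩)
  exact Finset.sum_le_sum fun i _ => add_le_add
    (hface i _ 1 (Or.inl rfl) (right_mem_Icc.2 (M.bounds_lt i).le) (M.right_mem_lineRegular i))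
    (hface i _ (-1) (Or.inr rfl) (left_mem_Icc.2 (M.bounds_lt i).le) (M.left_mem_lineRegular i))

theorem facetIntegral_nonneg {g : Pt n → Pt n → ℝ} (hg : ∀ y ν, 0 ≤ g y ν) (i : Fin (n + 1))
    (t σ : ℝ) (lo hi : Fin n → ℝ) : 0 ≤ facetIntegral a b F i t σ lo hi g :=
  integral_nonneg fun _ => mul_nonneg (hg _ _) (mul_nonneg (abs_nonneg _) (Real.sqrt_nonneg _))

/-- The integrand is pointwise nonnegative; existence of the one-sided limits and integrability of
the jumps play no role. -/
theorem skeletonForm_self_nonneg {S : Set (Pt n)} {η : (Pt n → Pt n) → Pt n → Pt n → ℝ}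
    (hη : IsStabParam S η) (α : ℕ) (u : Pt n → Pt n) : 0 ≤ skeletonForm a b F M α η u u := by
  refine Finset.sum_nonneg fun J _ => Finset.sum_nonneg fun i _ => ?_
  split_ifs
  · exact facetIntegral_nonneg (fun y ν => mul_nonneg (hη.nonneg _ _ _)
      (Finset.sum_nonneg fun j _ => mul_self_nonneg _)) i _ _ _ _
  · exact le_rfl

/-- Coercivity of the Nitsche form, for a penalty that depends only on the geometry, the degree and
the mesh regularity. -/
theorem exists_nitscheForm_self_nonneg (n m : ℕ) (Λ ℓ κ : ℝ) (hΛ1 : 1 ≤ Λ) (hℓ0 : 0 < ℓ)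
    (hκ : 0 < κ) :
    ∃ C₀ : ℝ, 0 < C₀ ∧ ∀ {a b : Pt n} {F : Pt n → Pt n} {M : ParamMesh a b} {w u : Pt n → Pt n}
      (_ : RegularMap a b F) (_ : GeomBound a b F Λ)
      (_ : ∀ J : M.Elem, ContDiffOn ℝ 2 F (M.closedElem J)) (_ : IsDiscreteField F M m w u)
      (_ : ∀ i, b i - a i ≤ ℓ) {h : ℝ} (_ : M.IsQuasiUniform F κ h) {S : Set (Pt n)}
      {η : (Pt n → Pt n) → Pt n → Pt n → ℝ} (_ : IsStabParam S η) (α : ℕ) {ν CNit : ℝ} (_ : 0 < ν)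
      (_ : C₀ ≤ CNit), 0 ≤ nitscheForm a b F M α η ν CNit h u u := by
  obtain ⟨C, hC, htrace⟩ := exists_faceSum_gradDensity_le n m Λ ℓ hΛ1 hℓ0
  have hΛ0 : 0 < Λ := one_pos.trans_le hΛ1
  obtain ⟨c, hc⟩ : ∃ c : ℝ, c = κ ^ 2 / ((n + 1 : ℕ) * Λ) := ⟨_, rfl⟩
  have hc0 : 0 < c := by rw [hc]; positivity
  -- With this `ε` the trace inequality gives `ε h Λ G ≤ Λ⁻¹ (I + B / (c h))`, where `I` is the box
  -- integral of `|∇ˢu|²` and `G`, `B` are the face sums of `|∇u|²` and `|u|²`. The first term is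
  -- exactly what the viscous form provides.
  obtain ⟨ε, hε⟩ : ∃ ε : ℝ, ε = c / (Λ ^ 2 * C) := ⟨_, rfl⟩
  have hε0 : 0 < ε := by rw [hε]; positivity
  -- `ε⁻¹` pays for the boundary term of Young's inequality and `c⁻¹` for that of the trace
  -- inequality.
  refine ⟨ε⁻¹ + c⁻¹, by positivity, ?_⟩
  intro a b F M w u hF hΛ hM hu hℓ h hq S η hη α ν CNit hν hCN
  have hh := hq.h_pos
  have hcu := hu.continuousOn_comp hF
  have hdf := hu.contDiffOn_comp hF hM
  have hpG := pwCont_gradDensity hF hdf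
  have hpU := pwCont_normDensity (M := M) hcu
  have htr := htrace hF hΛ hM hu hℓ (r := c * h) (by positivity) fun J i => by
    rw [hc]; exact hq.le_side hΛ hκ J i
  set I := ∫ x in Icc a b, symDensity a b F u x with hI
  set B := faceSum a b (normDensity F u) with hB
  set G := faceSum a b (gradDensity a b F u) with hG
  have nI : 0 ≤ I := integral_nonneg fun x => symDensity_nonneg x
  have nB : 0 ≤ B := faceSum_nonneg fun x => normDensity_nonneg x
  have hvisc : 2 * ν * (Λ⁻¹ * I) ≤ viscousForm a b F ν u u := by
    rw [viscousForm, hF.setIntegral_domain, ← integral_const_mul, ← integral_const_mul]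
    have hpS := pwCont_symDensity hF hdf
    have hdet : M.PwCont fun x => |(jac a b F x).det| := .of_continuousOn hF.continuousOn_det.abs
    refine integral_mono_regular ((ParamMesh.PwCont.const _).mul ((ParamMesh.PwCont.const _).mul
      hpS)) (hdet.mul ((ParamMesh.PwCont.const _).mul hpS)) Subset.rfl measurableSet_Icc
      fun x hx _ => ?_
    have := mul_le_mul_of_nonneg_right (hΛ.det_lower x hx) (symDensity_nonneg (a := a) (b := b)
      (F := F) (u := u) x)
    have h2 := mul_le_mul_of_nonneg_left this (mul_pos two_pos hν).le
    change _ ≤ |(jac a b F x).det| * (2 * ν * symDensity a b F u x)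
    linarith
  have hskel := skeletonForm_self_nonneg (a := a) (b := b) (F := F) (M := M) hη α u
  have harea : ∀ i, M.PwCont (areaDensity a b F i) := fun i =>
    .of_continuousOn (hF.continuousOn_areaDensity i)
  have hpc : ∀ j, M.PwCont fun x => u (F x) j := fun j => .of_continuousOn (hcu j)
  have hpn : ∀ i l (σ : ℝ), M.PwCont fun x => (σ • unitNormal a b F i x) l := fun i l σ =>
    .of_continuousOn (continuousOn_const.mul (continuousOn_unitNormal hF i l))
  obtain ⟨g₁, hg₁⟩ : ∃ g₁ : Pt n → Pt n → ℝ,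
    g₁ = fun y nrm => (2 * ν) * ((symGrad a b F u y).vecMul nrm ⬝ᵥ u y) := ⟨_, rfl⟩
  obtain ⟨g₂, hg₂⟩ : ∃ g₂ : Pt n → Pt n → ℝ,
    g₂ = fun y _ => 2 * ν * (CNit / h) * (u y ⬝ᵥ u y) := ⟨_, rfl⟩
  have hp₁ : ∀ i (σ : ℝ), M.PwCont fun x => g₁ (F x) (σ • unitNormal a b F i x) *
      areaDensity a b F i x := by
    intro i σ
    rw [hg₁]
    refine ((ParamMesh.PwCont.const _).mul (ParamMesh.PwCont.sum fun j _ => ?_)).mul (harea i)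
    have : M.PwCont fun x => ∑ l, (σ • unitNormal a b F i x) l * symGrad a b F u (F x) l j :=
      ParamMesh.PwCont.sum fun l _ => (hpn i l σ).mul (pwCont_symGrad hF hdf l j)
    exact this.mul (hpc j)
  have hp₂ : ∀ i (σ : ℝ), M.PwCont fun x => g₂ (F x) (σ • unitNormal a b F i x) *
      areaDensity a b F i x := by
    intro i σ
    rw [hg₂]
    exact ((ParamMesh.PwCont.const _).mul (ParamMesh.PwCont.sum fun j _ =>
      (hpc j).mul (hpc j))).mul (harea i)
  -- On the diagonal the two consistency terms coincide, whence the factor `-2`.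
  have hb := boundaryIntegral_add_const_mul (a := a) (b := b) (F := F) (-2) hp₂ hp₁
  have hCε : 0 ≤ CNit - ε⁻¹ := by linarith [inv_pos.2 hc0]
  have hlow : 2 * ν * ((CNit - ε⁻¹) / h * Λ⁻¹ * B) - 2 * ν * (ε * h * Λ * G) ≤
      boundaryIntegral a b F (fun y nrm => g₂ y nrm + -2 * g₁ y nrm) := by
    have hpf : M.PwCont fun x => 2 * ν * ((CNit - ε⁻¹) / h * Λ⁻¹ * normDensity F u x) +
        -(2 * ν * (ε * h * Λ)) * gradDensity a b F u x :=
      ((ParamMesh.PwCont.const _).mul ((ParamMesh.PwCont.const _).mul hpU)).add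
        ((ParamMesh.PwCont.const _).mul hpG)
    have hpg : ∀ i (σ : ℝ), M.PwCont fun x => (g₂ (F x) (σ • unitNormal a b F i x) +
        -2 * g₁ (F x) (σ • unitNormal a b F i x)) * areaDensity a b F i x := fun i σ =>
      ((hp₂ i σ).add ((ParamMesh.PwCont.const (-2)).mul (hp₁ i σ))).congr fun x _ _ => by ring
    have hle := faceSum_le_boundaryIntegral (g := fun y nrm => g₂ y nrm + -2 * g₁ y nrm) hpf hpg ?_
    · refine le_trans (le_of_eq ?_) hle
      have e := faceSum_add (a := a) (b := b) (M := M)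
        (f := fun x => 2 * ν * ((CNit - ε⁻¹) / h * Λ⁻¹ * normDensity F u x))
        (g := fun x => -(2 * ν * (ε * h * Λ)) * gradDensity a b F u x)
        ((ParamMesh.PwCont.const _).mul ((ParamMesh.PwCont.const _).mul hpU))
        ((ParamMesh.PwCont.const _).mul hpG)
      rw [e, faceSum_const_mul, faceSum_const_mul, faceSum_const_mul]
      ring
    · intro i σ hσ x hx hxr
      have hν1 : ∑ l, (σ • unitNormal a b F i x) l ^ 2 = 1 := by
        have hσ2 : σ ^ 2 = 1 := by rcases hσ with rfl | rfl <;> norm_num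
        simp only [Pi.smul_apply, smul_eq_mul, mul_pow, hσ2, one_mul]
        exact sum_unitNormal_sq hF hx i
      -- The weight `ε h` balances the scaling: the gradient trace costs `1 / h`, and the penalty
      -- supplies `1 / h`.
      have hY := two_mul_vecMul_dotProduct_le (symGrad a b F u (F x)) _ (u (F x)) hν1
        (mul_pos hε0 hh)
      have hsg := symDensity_le_gradDensity (a := a) (b := b) (F := F) (u := u) x
      have ha1 := hΛ.area_lower x hx i
      have ha2 := hΛ.area_upper x hx i
      have hN := normDensity_nonneg (F := F) (u := u) x
      have hGn := gradDensity_nonneg (a := a) (b := b) (F := F) (u := u) x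
      have huu : u (F x) ⬝ᵥ u (F x) = normDensity F u x :=
        Finset.sum_congr rfl fun j _ => (pow_two _).symm
      change _ ≤ ε * h * symDensity a b F u x + (ε * h)⁻¹ * normDensity F u x at hY
      rw [hg₁, hg₂]
      simp only [huu]
      set A := areaDensity a b F i x
      set X := (symGrad a b F u (F x)).vecMul (σ • unitNormal a b F i x) ⬝ᵥ u (F x)
      set N := normDensity F u x
      set Gx := gradDensity a b F u x
      have hA0 : 0 ≤ A := (inv_pos.2 hΛ0).le.trans ha1
      have h1 : CNit / h * N - 2 * X ≥ (CNit - ε⁻¹) / h * N - ε * h * Gx := by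
        have e : (CNit - ε⁻¹) / h * N = CNit / h * N - (ε * h)⁻¹ * N := by
          rw [mul_inv]; ring
        have := mul_le_mul_of_nonneg_left hsg (mul_pos hε0 hh).le
        linarith
      have h2 := mul_le_mul_of_nonneg_right h1 hA0
      have h3 : (CNit - ε⁻¹) / h * N * Λ⁻¹ ≤ (CNit - ε⁻¹) / h * N * A :=
        mul_le_mul_of_nonneg_left ha1 (mul_nonneg (div_nonneg hCε hh.le) hN)
      have h4 : ε * h * Gx * A ≤ ε * h * Gx * Λ :=
        mul_le_mul_of_nonneg_left ha2 (mul_nonneg (mul_pos hε0 hh).le hGn)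
      have h5 : (CNit - ε⁻¹) / h * N * Λ⁻¹ - ε * h * Gx * Λ ≤ (CNit / h * N - 2 * X) * A := by
        linarith
      have h6 := mul_le_mul_of_nonneg_left h5 (mul_pos two_pos hν).le
      calc _ = 2 * ν * ((CNit - ε⁻¹) / h * N * Λ⁻¹ - ε * h * Gx * Λ) := by ring
        _ ≤ _ := h6
        _ = _ := by ring
  have hG2 : ε * h * Λ * G ≤ Λ⁻¹ * I + Λ⁻¹ * (c⁻¹ / h) * B := by
    refine (mul_le_mul_of_nonneg_left htr (by positivity)).trans (le_of_eq ?_)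
    rw [hε]
    field_simp
  have hCB : 0 ≤ (CNit - ε⁻¹ - c⁻¹) / h * Λ⁻¹ * B :=
    mul_nonneg (mul_nonneg (div_nonneg (by linarith) hh.le) (inv_pos.2 hΛ0).le) nB
  have hfin : (CNit - ε⁻¹ - c⁻¹) / h * Λ⁻¹ * B =
      (CNit - ε⁻¹) / h * Λ⁻¹ * B - Λ⁻¹ * (c⁻¹ / h) * B := by ring
  have hpos := mul_nonneg (mul_pos two_pos hν).le
    (show 0 ≤ Λ⁻¹ * I + (CNit - ε⁻¹) / h * Λ⁻¹ * B - ε * h * Λ * G by linarith)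
  rw [nitscheForm, ← hg₁, ← hg₂]
  linarith

end SkelStab

end


noncomputable section

namespace SkelStab

variable {n : ℕ} {a b : Pt n} {F : Pt n → Pt n} {M : ParamMesh a b} {Λ : ℝ} {w u : Pt n → Pt n}
  {m : ℕ}

/-! ### The Piola identity -/

theorem Icc_mem_nhds_of_mem_paramDomain {x : Pt n} (hx : x ∈ paramDomain a b) : Icc a b ∈ 𝓝 x :=
  mem_of_superset ((isOpen_paramDomain a b).mem_nhds hx) paramDomain_subset_Icc

theorem hasDerivAt_partialDeriv {g : Pt n → ℝ} {x : Pt n} (hx : x ∈ paramDomain a b)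
    (hg : DifferentiableAt ℝ g x) (k : Fin (n + 1)) :
    HasDerivAt (fun s : ℝ => g (x + s • Pi.single k 1)) (partialDeriv a b k g x) 0 := by
  rw [partialDeriv, fderivWithin_of_mem_nhds (Icc_mem_nhds_of_mem_paramDomain hx)]
  have h1 : HasDerivAt (fun s : ℝ => x + s • (Pi.single k 1 : Pt n)) (Pi.single k 1) 0 := by
    simpa using ((hasDerivAt_id (0 : ℝ)).smul_const (Pi.single k 1 : Pt n)).const_add x
  have h2 : HasFDerivAt g (fderiv ℝ g x) (x + (0 : ℝ) • (Pi.single k 1 : Pt n)) := by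
    simpa using hg.hasFDerivAt
  exact h2.comp_hasDerivAt 0 h1

/-- Symmetry of second derivatives, available inside open elements, where `F` is `C²`. -/
theorem partialDeriv_jac_comm {J : M.Elem} (hJ : ContDiffOn ℝ 2 F (M.closedElem J)) {x : Pt n}
    (hx : x ∈ M.openElem J) (i k l : Fin (n + 1)) :
    partialDeriv a b k (fun z => jac a b F z i l) x =
      partialDeriv a b l (fun z => jac a b F z i k) x := by
  have hxp := M.openElem_subset_paramDomain J hx
  have hcd : ContDiffAt ℝ 2 F x := hJ.contDiffAt
    (mem_of_superset ((M.isOpen_openElem J).mem_nhds hx) (M.openElem_subset_closedElem J))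
  have hd : DifferentiableAt ℝ (fderiv ℝ F) x :=
    (hcd.fderiv_right (m := 1) (by norm_num)).differentiableAt (by norm_num)
  have hsymm := hcd.isSymmSndFDerivAt (by simp)
  have key : ∀ k l, partialDeriv a b k (fun z => jac a b F z i l) x =
      fderiv ℝ (fderiv ℝ F) x (Pi.single k 1) (Pi.single l 1) i := by
    intro k l
    have heq : (fun z => jac a b F z i l) =ᶠ[𝓝 x] fun z => fderiv ℝ F z (Pi.single l 1) i := by
      filter_upwards [(isOpen_paramDomain a b).mem_nhds hxp] with z hz
      rw [jac_apply, fderivWithin_of_mem_nhds (Icc_mem_nhds_of_mem_paramDomain hz)]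
    rw [partialDeriv, fderivWithin_of_mem_nhds (Icc_mem_nhds_of_mem_paramDomain hxp),
      heq.fderiv_eq]
    have h1 : HasFDerivAt (fun z => fderiv ℝ F z (Pi.single l 1) i)
        ((ContinuousLinearMap.proj i : Pt n →L[ℝ] ℝ).comp
          ((ContinuousLinearMap.apply ℝ (Pt n) (Pi.single l 1 : Pt n)).comp
            (fderiv ℝ (fderiv ℝ F) x))) x := by
      have h2 := ((ContinuousLinearMap.apply ℝ (Pt n) (Pi.single l 1 : Pt n)).hasFDerivAt
        (x := fderiv ℝ F x)).comp x hd.hasFDerivAt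
      exact ((ContinuousLinearMap.proj i : Pt n →L[ℝ] ℝ).hasFDerivAt).comp x h2
    rw [h1.fderiv]
    rfl
  rw [key, key, hsymm.eq]

theorem partialDeriv_det (hF : RegularMap a b F) {J : M.Elem}
    (hJ : ContDiffOn ℝ 2 F (M.closedElem J)) {x : Pt n} (hx : x ∈ M.openElem J)
    (k : Fin (n + 1)) : partialDeriv a b k (fun z => (jac a b F z).det) x =
      (jac a b F x).det * ∑ l, ∑ i, (jac a b F x)⁻¹ l i *
        partialDeriv a b k (fun z => jac a b F z i l) x := by
  have hxp := M.openElem_subset_paramDomain J hx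
  have hnhds : M.closedElem J ∈ 𝓝 x :=
    mem_of_superset ((M.isOpen_openElem J).mem_nhds hx) (M.openElem_subset_closedElem J)
  have hd : ∀ i j, DifferentiableAt ℝ (fun z => jac a b F z i j) x := fun i j =>
    ((hF.contDiffOn_jac hJ i j).contDiffAt hnhds).differentiableAt one_ne_zero
  have hdd : DifferentiableAt ℝ (fun z => (jac a b F z).det) x :=
    ((hF.contDiffOn_det hJ).contDiffAt hnhds).differentiableAt one_ne_zero
  have h1 := hasDerivAt_det (A := fun s : ℝ => jac a b F (x + s • Pi.single k 1))
    (A' := Matrix.of fun i j => partialDeriv a b k (fun z => jac a b F z i j) x) (t := 0)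
    (fun i j => hasDerivAt_partialDeriv hxp (hd i j) k)
    (by simpa using hF.det_ne_zero x (paramDomain_subset_Icc hxp))
  have h2 := (hasDerivAt_partialDeriv hxp hdd k).unique h1
  rw [h2]
  simp [Matrix.trace, Matrix.mul_apply]

/-- The Piola transform maps the parametric divergence to the physical one. -/
theorem det_mul_divergence (hF : RegularMap a b F)
    (hM : ∀ J : M.Elem, ContDiffOn ℝ 2 F (M.closedElem J)) (hu : IsDiscreteField F M m w u)
    {J : M.Elem} {x : Pt n} (hx : x ∈ M.openElem J) :
    (jac a b F x).det * divergence a b F u (F x) =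
      ∑ k, partialDeriv a b k (fun z => w z k) x := by
  have hxp := M.openElem_subset_paramDomain J hx
  have hxI := paramDomain_subset_Icc hxp
  have hxr := M.openElem_subset_regular J hx
  have hdet := hF.det_ne_zero x hxI
  have hnhds : M.closedElem J ∈ 𝓝 x :=
    mem_of_superset ((M.isOpen_openElem J).mem_nhds hx) (M.openElem_subset_closedElem J)
  have hdu : ∀ j, DifferentiableWithinAt ℝ (fun z => u (F z) j) (Icc a b) x := fun j =>
    differentiableWithinAt_of_regular (hu.contDiffOn_comp hF hM j) hxI hxr
  set B := (jac a b F x)⁻¹ with hB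
  set D := (jac a b F x).det with hD
  have hdj : ∀ i j, DifferentiableAt ℝ (fun z => jac a b F z i j) x := fun i j =>
    ((hF.contDiffOn_jac (hM J) i j).contDiffAt hnhds).differentiableAt one_ne_zero
  have hdd : DifferentiableAt ℝ (fun z => (jac a b F z).det) x :=
    ((hF.contDiffOn_det (hM J)).contDiffAt hnhds).differentiableAt one_ne_zero
  -- The quotient rule with Jacobi's formula for the derivative of the determinant.
  have hP : ∀ k i l, partialDeriv a b k (fun z => piola a b F z i l) x =
      D⁻¹ * partialDeriv a b k (fun z => jac a b F z i l) x -
        D⁻¹ * (∑ p, ∑ q, B p q * partialDeriv a b k (fun z => jac a b F z q p) x) *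
          jac a b F x i l := by
    intro k i l
    have h1 := (hasDerivAt_partialDeriv hxp hdd k).inv
      (by simpa using hdet)
    have h2 := h1.mul (hasDerivAt_partialDeriv hxp (hdj i l) k)
    have hdp : DifferentiableAt ℝ (fun z => piola a b F z i l) x :=
      ((hF.contDiffOn_piola (hM J) i l).contDiffAt hnhds).differentiableAt one_ne_zero
    have h3 := (hasDerivAt_partialDeriv hxp hdp k).unique h2
    rw [h3, partialDeriv_det hF (hM J) hx]
    simp only [zero_smul, add_zero, Pi.inv_apply]
    rw [← hD, ← hB]
    field_simp
    ring
  have hBJ : B * jac a b F x = 1 := Matrix.nonsing_inv_mul _ (hF.isUnit_det hxI)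
  have hBJ' : ∀ k l, ∑ i, B k i * jac a b F x i l = if k = l then 1 else 0 := fun k l => by
    have := congrFun (congrFun hBJ k) l
    rwa [Matrix.mul_apply, Matrix.one_apply] at this
  have h1 : divergence a b F u (F x) = ∑ i, ∑ k, B k i *
      (∑ l, partialDeriv a b k (fun z => piola a b F z i l) x * w x l +
        ∑ l, piola a b F x i l * partialDeriv a b k (fun z => w z l) x) := by
    rw [divergence, Matrix.trace]
    refine Finset.sum_congr rfl fun i _ => ?_
    rw [Matrix.diag_apply, hF.grad_apply hxI hdu]
    exact Finset.sum_congr rfl fun k _ => by rw [hu.partialDeriv_comp hF hM hxI hxr]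
  -- The Piola identity: each column of the Piola matrix is divergence-free in physical coordinates.
  -- By symmetry of second derivatives and `DF⁻¹ DF = 1`, the derivative of `DF` and that of the
  -- determinant contribute opposite amounts.
  have hz : ∀ l, ∑ i, ∑ k, B k i * partialDeriv a b k (fun z => piola a b F z i l) x = 0 := by
    intro l
    simp only [hP, mul_sub, Finset.sum_sub_distrib]
    have e1 : ∑ i, ∑ k, B k i * (D⁻¹ * partialDeriv a b k (fun z => jac a b F z i l) x) =
        D⁻¹ * ∑ p, ∑ q, B p q * partialDeriv a b l (fun z => jac a b F z q p) x := by
      rw [Finset.sum_comm]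
      simp only [Finset.mul_sum]
      refine Finset.sum_congr rfl fun k _ => Finset.sum_congr rfl fun i _ => ?_
      rw [partialDeriv_jac_comm (hM J) hx i k l]
      ring
    have e2 : ∑ i, ∑ k, B k i * (D⁻¹ * (∑ p, ∑ q, B p q *
        partialDeriv a b k (fun z => jac a b F z q p) x) * jac a b F x i l) =
        ∑ k, (∑ i, B k i * jac a b F x i l) * (D⁻¹ * ∑ p, ∑ q, B p q *
          partialDeriv a b k (fun z => jac a b F z q p) x) := by
      rw [Finset.sum_comm]
      refine Finset.sum_congr rfl fun k _ => ?_
      rw [Finset.sum_mul]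
      exact Finset.sum_congr rfl fun i _ => by ring
    rw [e1, e2]
    simp only [hBJ', ite_mul, one_mul, zero_mul, Finset.sum_ite_eq', Finset.mem_univ, if_true,
      sub_self]
  have h2 : ∑ i, ∑ k, B k i * ∑ l, partialDeriv a b k (fun z => piola a b F z i l) x * w x l = 0 := by
    have : ∑ i, ∑ k, B k i * ∑ l, partialDeriv a b k (fun z => piola a b F z i l) x * w x l =
        ∑ l, (∑ i, ∑ k, B k i * partialDeriv a b k (fun z => piola a b F z i l) x) * w x l := by
      simp only [Finset.mul_sum, Finset.sum_mul]
      rw [Finset.sum_congr rfl fun i _ => Finset.sum_comm, Finset.sum_comm]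
      exact Finset.sum_congr rfl fun l _ => Finset.sum_congr rfl fun i _ =>
        Finset.sum_congr rfl fun k _ => by ring
    rw [this]
    exact Finset.sum_eq_zero fun l _ => by rw [hz l, zero_mul]
  have h3 : ∑ i, ∑ k, B k i * ∑ l, piola a b F x i l * partialDeriv a b k (fun z => w z l) x =
      D⁻¹ * ∑ k, partialDeriv a b k (fun z => w z k) x := by
    have : ∀ k, ∑ i, B k i * ∑ l, piola a b F x i l * partialDeriv a b k (fun z => w z l) x =
        D⁻¹ * partialDeriv a b k (fun z => w z k) x := by
      intro k
      have e : ∑ i, B k i * ∑ l, piola a b F x i l * partialDeriv a b k (fun z => w z l) x =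
          D⁻¹ * ∑ l, (∑ i, B k i * jac a b F x i l) * partialDeriv a b k (fun z => w z l) x := by
        simp only [Finset.mul_sum, Finset.sum_mul]
        rw [Finset.sum_comm]
        refine Finset.sum_congr rfl fun l _ => Finset.sum_congr rfl fun i _ => ?_
        change B k i * (D⁻¹ * jac a b F x i l * _) = _
        ring
      rw [e]
      simp [hBJ']
    rw [Finset.sum_comm, Finset.mul_sum]
    exact Finset.sum_congr rfl fun k _ => this k
  rw [h1]
  simp only [mul_add, Finset.sum_add_distrib]
  rw [h2, h3, mul_zero, zero_add, mul_inv_cancel_left₀ hdet]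

/-! ### Integration by parts for solenoidal fields -/

theorem ae_mem_openElem (M : ParamMesh a b) :
    ∀ᵐ x : Pt n, x ∈ Icc a b → ∃ J : M.Elem, x ∈ M.openElem J := by
  filter_upwards [(paramDomain_ae_eq_Icc a b).mem_iff, M.ae_mem_regular] with x h1 hr hx
  obtain ⟨J, hJ⟩ := mem_iUnion.1 (M.Icc_subset_iUnion hx)
  exact ⟨J, M.mem_openElem_of_regular hJ hr (h1.2 hx)⟩

/-- The integrand is the divergence of `w φ`. For the `k`-th term only the faces orthogonal to
direction `k` matter, and there `w_k` vanishes. -/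
theorem integral_sum_mul_partialDeriv_eq_zero (hu : IsDiscreteField F M m w u)
    (hdiv : ∀ J : M.Elem, ∀ x ∈ M.openElem J, ∑ k, partialDeriv a b k (fun z => w z k) x = 0)
    {φ : Pt n → ℝ} (hc : ContinuousOn φ (Icc a b))
    (hφ : ∀ J : M.Elem, ContDiffOn ℝ 1 φ (M.closedElem J)) :
    ∫ x in Icc a b, ∑ k, w x k * partialDeriv a b k φ x = 0 := by
  have hwc := hu.poly.continuousOn
  have hwd := hu.poly.contDiffOn
  have h0 : ∀ k, ∫ x in Icc a b, partialDeriv a b k (fun z => w z k * φ z) x = 0 := fun k =>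
    ParamMesh.integral_partialDeriv_eq_zero (M := M) ((hwc k).mul hc)
      (fun J => (hwd k J).mul (hφ J)) fun x hx hxk => by rw [hu.bdry k x hx hxk, zero_mul]
  have hi : ∀ k, IntegrableOn (partialDeriv a b k fun z => w z k * φ z) (Icc a b) := fun k =>
    (M.pwCont_partialDeriv (fun J => (hwd k J).mul (hφ J)) k).integrableOn
  rw [← Finset.sum_eq_zero (s := Finset.univ) fun k _ => h0 k, ← integral_finsetSum _ fun k _ => hi k]
  refine setIntegral_congr_ae measurableSet_Icc ?_
  filter_upwards [ae_mem_openElem M, M.ae_mem_regular] with x h1 hr hx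
  obtain ⟨J, hJ⟩ := h1 hx
  have hd := hdiv J x hJ
  have hud := uniqueDiffOn_Icc_pi M.bounds_lt x hx
  have e : ∀ k, partialDeriv a b k (fun z => w z k * φ z) x =
      partialDeriv a b k (fun z => w z k) x * φ x + w x k * partialDeriv a b k φ x := fun k =>
    partialDeriv_mul hud (differentiableWithinAt_of_regular (hwd k) hx hr)
      (differentiableWithinAt_of_regular hφ hx hr) k
  simp only [e, Finset.sum_add_distrib, ← Finset.sum_mul, hd, zero_mul, zero_add]

/-- The convective form is skew for solenoidal fields without flow through the boundary. -/
theorem convectiveForm_self_eq_zero (hF : RegularMap a b F)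
    (hM : ∀ J : M.Elem, ContDiffOn ℝ 2 F (M.closedElem J)) (hu : IsDiscreteField F M m w u)
    (hdiv : ∀ J : M.Elem, ∀ x ∈ M.openElem J, ∑ k, partialDeriv a b k (fun z => w z k) x = 0) :
    convectiveForm a b F u u u = 0 := by
  have hc := hu.continuousOn_comp hF
  have hd := hu.contDiffOn_comp hF hM
  obtain ⟨σ, -, hσ⟩ := hF.exists_sign
  have h0 := integral_sum_mul_partialDeriv_eq_zero hu hdiv
    (φ := fun x => ∑ j, u (F x) j * u (F x) j)
    (continuousOn_finsetSum _ fun j _ => (hc j).mul (hc j))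
    (fun J => ContDiffOn.sum fun j _ => (hd j J).mul (hd j J))
  rw [convectiveForm, hF.setIntegral_domain, neg_eq_zero]
  -- Since `|det DF| DF⁻¹ u = σ w`, the integrand `u · ∇u · u` pulls back to `(σ / 2) w · ∇|u ∘
  -- F|²`.
  have : ∫ x in Icc a b, |(jac a b F x).det| *
      contract (Matrix.vecMulVec (u (F x)) (u (F x))) (grad a b F u (F x)) =
      ∫ x in Icc a b, σ / 2 * ∑ k, w x k *
        partialDeriv a b k (fun x => ∑ j, u (F x) j * u (F x) j) x := by
    refine setIntegral_congr_ae measurableSet_Icc ?_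
    filter_upwards [M.ae_mem_regular] with x hr hx
    have hud := hF.uniqueDiffOn x hx
    have hdx : ∀ j, DifferentiableWithinAt ℝ (fun z => u (F z) j) (Icc a b) x := fun j =>
      differentiableWithinAt_of_regular (hd j) hx hr
    have e1 : ∀ k, partialDeriv a b k (fun x => ∑ j, u (F x) j * u (F x) j) x =
        ∑ j, 2 * (u (F x) j * partialDeriv a b k (fun z => u (F z) j) x) := by
      intro k
      rw [partialDeriv_sum (f := fun j z => u (F z) j * u (F z) j) hud fun j _ =>
        (hdx j).mul (hdx j)]
      refine Finset.sum_congr rfl fun j _ => ?_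
      rw [partialDeriv_mul hud (hdx j) (hdx j)]
      ring
    have e2 : ∀ k, ∑ i, ((jac a b F x).det * (jac a b F x)⁻¹ k i) * u (F x) i = w x k := by
      intro k
      rw [← sum_det_inv_mul_piola hF hx (w x) k]
      exact Finset.sum_congr rfl fun i _ => by rw [hu.comp_eq i hx]
    have e3 : contract (Matrix.vecMulVec (u (F x)) (u (F x))) (grad a b F u (F x)) =
        ∑ k, (∑ i, (jac a b F x)⁻¹ k i * u (F x) i) *
          ∑ j, u (F x) j * partialDeriv a b k (fun z => u (F z) j) x := by
      simp only [contract, Matrix.vecMulVec_apply, hF.grad_apply hx hdx, Finset.sum_mul,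
        Finset.mul_sum]
      rw [Finset.sum_congr rfl fun i _ => Finset.sum_comm, Finset.sum_comm]
      exact Finset.sum_congr rfl fun k _ => by
        rw [Finset.sum_comm]
        exact Finset.sum_congr rfl fun j _ => Finset.sum_congr rfl fun i _ => by ring
    rw [hσ x hx, e3, mul_assoc, Finset.mul_sum, Finset.mul_sum, Finset.mul_sum]
    refine Finset.sum_congr rfl fun k _ => ?_
    rw [e1, ← Finset.mul_sum, ← e2 k]
    simp only [mul_assoc, ← Finset.mul_sum]
    ring
  rw [this, integral_const_mul, h0, mul_zero]

end SkelStab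

end


noncomputable section

namespace SkelStab

variable {n : ℕ} {a b : Pt n} {F : Pt n → Pt n} {M : ParamMesh a b} {m : ℕ}

/-! ### The time derivative of the energy -/

/-- The fields in parametric coordinates that are Piola transforms of piecewise polynomials,
extended by zero. -/
def pwPiola (a b : Pt n) (F : Pt n → Pt n) (M : ParamMesh a b) (m : ℕ) (σ : Pt n → M.Elem) :
    (Fin (n + 1) → M.Elem → polySpace n m) →ₗ[ℝ] (Pt n × Fin (n + 1) → ℝ) where
  toFun p q := (paramDomain a b).indicator
    (fun x => ∑ l, piola a b F x q.2 l * (p l (σ x) : Pt n → ℝ) x) q.1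
  map_add' p p' := by
    ext q
    by_cases hq : q.1 ∈ paramDomain a b
    · simp [hq, mul_add, Finset.sum_add_distrib]
    · simp [hq]
  map_smul' c p := by
    ext q
    by_cases hq : q.1 ∈ paramDomain a b
    · simp only [indicator_of_mem hq, Pi.smul_apply, Submodule.coe_smul, smul_eq_mul,
        RingHom.id_apply, Finset.mul_sum]
      exact Finset.sum_congr rfl fun l _ => by ring
    · simp [hq]

theorem pwPiola_apply (σ : Pt n → M.Elem) (p : Fin (n + 1) → M.Elem → polySpace n m) (x : Pt n)
    (j : Fin (n + 1)) : pwPiola a b F M m σ p (x, j) = (paramDomain a b).indicator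
      (fun x => ∑ l, piola a b F x j l * (p l (σ x) : Pt n → ℝ) x) x := rfl

/-- Families of functions on the box that are continuous up to the boundary. -/
def contUpTo (a b : Pt n) : Submodule ℝ (Pt n × Fin (n + 1) → ℝ) where
  carrier := {f | ∀ j, ∃ g : Pt n → ℝ, ContinuousOn g (Icc a b) ∧ ∀ x ∈ paramDomain a b, f (x, j) = g x}
  add_mem' {f f'} hf hf' j := by
    obtain ⟨g, hg, h⟩ := hf j
    obtain ⟨g', hg', h'⟩ := hf' j
    exact ⟨fun x => g x + g' x, hg.add hg', fun x hx => by rw [Pi.add_apply, h x hx, h' x hx]⟩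
  zero_mem' j := ⟨0, continuousOn_const, fun _ _ => rfl⟩
  smul_mem' c f hf j := by
    obtain ⟨g, hg, h⟩ := hf j
    exact ⟨fun x => c * g x, continuousOn_const.mul hg, fun x hx => by
      rw [Pi.smul_apply, h x hx, smul_eq_mul]⟩

theorem integrableOn_mul_of_mem_contUpTo (hF : RegularMap a b F) {f g : Pt n × Fin (n + 1) → ℝ}
    (hf : f ∈ contUpTo a b) (hg : g ∈ contUpTo a b) :
    IntegrableOn (fun x => |(jac a b F x).det| * ∑ j, f (x, j) * g (x, j)) (paramDomain a b) := by
  choose f' hf' hff using hf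
  choose g' hg' hgg using hg
  have h1 : IntegrableOn (fun x => |(jac a b F x).det| * ∑ j, f' j x * g' j x) (Icc a b) :=
    (hF.continuousOn_det.abs.mul (continuousOn_finsetSum _ fun j _ =>
      (hf' j).mul (hg' j))).integrableOn_compact isCompact_Icc
  refine (h1.mono_set paramDomain_subset_Icc).congr_fun (fun x hx => ?_)
    (isOpen_paramDomain a b).measurableSet
  simp only [hff _ x hx, hgg _ x hx]

/-- The `L²` inner product of physical fields in parametric coordinates. -/
def pullInner (hF : RegularMap a b F) (V : Submodule ℝ (Pt n × Fin (n + 1) → ℝ))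
    (hV : V ≤ contUpTo a b) : V →ₗ[ℝ] V →ₗ[ℝ] ℝ :=
  LinearMap.mk₂ ℝ (fun f g => ∫ x in paramDomain a b,
      |(jac a b F x).det| * ∑ j, f.1 (x, j) * g.1 (x, j))
    (fun f f' g => by
      rw [← integral_add (integrableOn_mul_of_mem_contUpTo hF (hV f.2) (hV g.2))
        (integrableOn_mul_of_mem_contUpTo hF (hV f'.2) (hV g.2))]
      refine integral_congr_ae (ae_of_all _ fun x => ?_)
      simp [add_mul, mul_add, Finset.sum_add_distrib])
    (fun c f g => by
      rw [smul_eq_mul, ← integral_const_mul]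
      refine integral_congr_ae (ae_of_all _ fun x => ?_)
      simp only [Submodule.coe_smul, Pi.smul_apply, smul_eq_mul, mul_assoc, ← Finset.mul_sum]
      ring)
    (fun f g g' => by
      rw [← integral_add (integrableOn_mul_of_mem_contUpTo hF (hV f.2) (hV g.2))
        (integrableOn_mul_of_mem_contUpTo hF (hV f.2) (hV g'.2))]
      refine integral_congr_ae (ae_of_all _ fun x => ?_)
      simp [mul_add, Finset.sum_add_distrib])
    (fun c f g => by
      rw [smul_eq_mul, ← integral_const_mul]
      refine integral_congr_ae (ae_of_all _ fun x => ?_)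
      simp only [Submodule.coe_smul, Pi.smul_apply, smul_eq_mul, Finset.mul_sum]
      exact Finset.sum_congr rfl fun j _ => by ring)

theorem l2Inner_eq (hF : RegularMap a b F) (u v : Pt n → Pt n) : l2Inner a b F u v =
    ∫ x in paramDomain a b, |(jac a b F x).det| * ∑ j, u (F x) j * v (F x) j := by
  rw [l2Inner, hF.setIntegral_domain, setIntegral_congr_set (paramDomain_ae_eq_Icc a b)]
  rfl

/-- A time-dependent discrete field that is differentiable in time at every point has a
differentiable energy. -/
theorem hasDerivWithinAt_energy (hF : RegularMap a b F) {T : ℝ} {u : ℝ → Pt n → Pt n}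
    (hu : ∀ t ∈ Ioc 0 T, ∃ w, IsDiscreteField F M m w (u t))
    (hdiff : ∀ t ∈ Ioc 0 T, ∀ x ∈ domain a b F,
      DifferentiableWithinAt ℝ (fun s => u s x) (Ioc 0 T) t) {t : ℝ} (ht : t ∈ Ioc 0 T) :
    HasDerivWithinAt (fun s => energy a b F (u s)) (l2Inner a b F (timeDeriv T u t) (u t))
      (Ioc 0 T) t := by
  classical
  have hσ : ∀ x : Pt n, ∃ J : M.Elem, x ∈ Icc a b → x ∈ M.closedElem J := fun x => by
    by_cases hx : x ∈ Icc a b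
    · obtain ⟨J, hJ⟩ := mem_iUnion.1 (M.Icc_subset_iUnion hx)
      exact ⟨J, fun _ => hJ⟩
    · exact ⟨fun i => ⟨0, M.N_pos i⟩, fun h => absurd h hx⟩
  choose σ hσ using hσ
  -- The range is finite-dimensional but contains fields that jump between elements, with values on
  -- interfaces depending on the arbitrary choice `σ`. The intersection keeps finite dimension and
  -- makes the `L²` product well behaved.
  let V : Submodule ℝ (Pt n × Fin (n + 1) → ℝ) :=
    LinearMap.range (pwPiola a b F M m σ) ⊓ contUpTo a b
  have hV : V ≤ contUpTo a b := inf_le_right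
  have : FiniteDimensional ℝ V :=
    Submodule.finiteDimensional_of_le (inf_le_left : V ≤ LinearMap.range (pwPiola a b F M m σ))
  -- Extension by zero outside the open box, because differentiability in time is assumed only at
  -- points of the open physical domain.
  let e : (Pt n → Pt n) → Pt n × Fin (n + 1) → ℝ := fun v q =>
    (paramDomain a b).indicator (fun x => v (F x) q.2) q.1
  have he : ∀ r ∈ Ioc 0 T, e (u r) ∈ V := by
    intro r hr
    obtain ⟨w, hw⟩ := hu r hr
    choose g hg hgw using hw.poly.poly
    refine ⟨⟨fun l J => ⟨g l J, hg l J⟩, ?_⟩, fun j => ⟨fun x => u r (F x) j,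
      hw.continuousOn_comp hF j, fun x hx => by
        simp only [e, indicator_of_mem hx]⟩⟩
    ext ⟨x, j⟩
    by_cases hx : x ∈ paramDomain a b
    · have hxI := paramDomain_subset_Icc hx
      rw [pwPiola_apply]
      simp only [e, indicator_of_mem hx]
      rw [hw.comp_eq j hxI]
      exact Finset.sum_congr rfl fun l _ => by rw [← hgw l (σ x) (hσ x hxI)]
    · rw [pwPiola_apply]
      simp only [e, indicator_of_notMem hx]
  let U : ℝ → V := fun r => if hr : r ∈ Ioc 0 T then ⟨e (u r), he r hr⟩ else 0
  have hU : ∀ r ∈ Ioc 0 T, (U r : Pt n × Fin (n + 1) → ℝ) = e (u r) := fun r hr => by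
    simp only [U, dif_pos hr]
  have hev : ∀ q, DifferentiableWithinAt ℝ (fun r => (U r : Pt n × Fin (n + 1) → ℝ) q)
      (Ioc 0 T) t := by
    rintro ⟨x, j⟩
    have h1 : ∀ r ∈ Ioc 0 T, (U r : Pt n × Fin (n + 1) → ℝ) (x, j) = e (u r) (x, j) :=
      fun r hr => by rw [hU r hr]
    refine DifferentiableWithinAt.congr ?_ h1 (h1 t ht)
    by_cases hx : x ∈ paramDomain a b
    · simp only [e, indicator_of_mem hx]
      exact differentiableWithinAt_pi.1 (hdiff t ht (F x) (mem_image_of_mem F hx)) j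
    · simp only [e, indicator_of_notMem hx]
      exact differentiableWithinAt_const _
  obtain ⟨U', hφ, hB⟩ := exists_hasDerivWithinAt_of_eval V hev
  -- The abstract derivative in `V` has the pointwise time derivative as its values, by uniqueness
  -- of derivatives on `(0, T]`, the endpoint `T` included.
  have hUq : ∀ x ∈ paramDomain a b, ∀ j, U'.1 (x, j) = timeDeriv T u t (F x) j := by
    intro x hx j
    have h1 := hφ ((LinearMap.proj (x, j)).comp V.subtype)
    have h2 : HasDerivWithinAt (fun r => u r (F x) j) (timeDeriv T u t (F x) j) (Ioc 0 T) t :=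
      hasDerivWithinAt_pi.1 (hdiff t ht (F x) (mem_image_of_mem F hx)).hasDerivWithinAt j
    have h3 : HasDerivWithinAt (fun r => u r (F x) j) (U'.1 (x, j)) (Ioc 0 T) t := by
      refine h1.congr (fun r hr => ?_) ?_
      · change _ = (U r : Pt n × Fin (n + 1) → ℝ) (x, j)
        rw [hU r hr]; simp only [e, indicator_of_mem hx]
      · change _ = (U t : Pt n × Fin (n + 1) → ℝ) (x, j)
        rw [hU t ht]; simp only [e, indicator_of_mem hx]
    exact (uniqueDiffOn_Ioc 0 T t ht).eq_deriv _ h3 h2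
  have hm := (isOpen_paramDomain a b).measurableSet
  have hsymm : ∀ v v', pullInner hF V hV v v' = pullInner hF V hV v' v := fun v v' => by
    refine integral_congr_ae (ae_of_all _ fun x => ?_)
    simp only [mul_comm]
  have h1 := (hB (pullInner hF V hV) hsymm).const_mul (1 / 2)
  have e1 : ∀ r ∈ Ioc 0 T, energy a b F (u r) = 1 / 2 * pullInner hF V hV (U r) (U r) := by
    intro r hr
    rw [energy, l2Inner_eq hF]
    congr 1
    refine setIntegral_congr_fun hm fun x hx => ?_
    simp only [hU r hr, e, indicator_of_mem hx]
  have e2 : l2Inner a b F (timeDeriv T u t) (u t) = 1 / 2 * (2 * pullInner hF V hV U' (U t)) := by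
    rw [l2Inner_eq hF, ← mul_assoc, one_div_mul_cancel two_ne_zero, one_mul]
    refine setIntegral_congr_fun hm fun x hx => ?_
    simp only [hU t ht, e, indicator_of_mem hx, hUq x hx]
  rw [e2]
  exact h1.congr e1 (e1 t ht)

end SkelStab

end


noncomputable section

namespace SkelStab

variable {n : ℕ} {a b : Pt n} {F : Pt n → Pt n} {M : ParamMesh a b} {Λ : ℝ} {w u : Pt n → Pt n}
  {m : ℕ}

/-! ### Smooth cutoffs with tensor product structure -/

theorem exists_deriv_smoothTransition_le : ∃ K : ℝ, 0 ≤ K ∧ ∀ s, |deriv Real.smoothTransition s| ≤ K := by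
  have hc : Continuous (deriv Real.smoothTransition) :=
    (Real.smoothTransition.contDiff (n := 1)).continuous_deriv le_rfl
  obtain ⟨K, hK⟩ := (isCompact_Icc (a := (0 : ℝ)) (b := 1)).exists_bound_of_continuousOn hc.continuousOn
  have hK0 : 0 ≤ K := (norm_nonneg _).trans (hK 0 (by simp))
  refine ⟨K, hK0, fun s => ?_⟩
  by_cases hs : s ∈ Icc (0 : ℝ) 1
  · exact hK s hs
  · suffices deriv Real.smoothTransition s = 0 by rw [this, abs_zero]; exact hK0
    rcases not_and_or.1 hs with h | h
    · have : Real.smoothTransition =ᶠ[𝓝 s] fun _ => 0 := by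
        filter_upwards [gt_mem_nhds (not_le.1 h)] with t ht
        exact Real.smoothTransition.zero_of_nonpos ht.le
      rw [this.deriv_eq, deriv_const]
    · have : Real.smoothTransition =ᶠ[𝓝 s] fun _ => 1 := by
        filter_upwards [lt_mem_nhds (not_le.1 h)] with t ht
        exact Real.smoothTransition.one_of_one_le ht.le
      rw [this.deriv_eq, deriv_const]

/-- A smooth function of one variable that vanishes at distance at most `δ` from the ends of the
interval and is one at distance at least `2δ`. -/
def lineCutoff (s t δ r : ℝ) : ℝ :=
  Real.smoothTransition ((r - s) / δ - 1) * Real.smoothTransition ((t - r) / δ - 1)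

theorem contDiff_lineCutoff (s t δ : ℝ) : ContDiff ℝ 1 (lineCutoff s t δ) :=
  (Real.smoothTransition.contDiff.comp (((contDiff_id.sub contDiff_const).div_const δ).sub
    contDiff_const)).mul (Real.smoothTransition.contDiff.comp
      (((contDiff_const.sub contDiff_id).div_const δ).sub contDiff_const))

theorem lineCutoff_nonneg (s t δ r : ℝ) : 0 ≤ lineCutoff s t δ r :=
  mul_nonneg (Real.smoothTransition.nonneg _) (Real.smoothTransition.nonneg _)

theorem lineCutoff_le_one (s t δ r : ℝ) : lineCutoff s t δ r ≤ 1 :=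
  mul_le_one₀ (Real.smoothTransition.le_one _) (Real.smoothTransition.nonneg _)
    (Real.smoothTransition.le_one _)

theorem lineCutoff_eq_zero {s t δ r : ℝ} (hδ : 0 < δ) (h : ¬ (s + δ ≤ r ∧ r ≤ t - δ)) :
    lineCutoff s t δ r = 0 := by
  rcases not_and_or.1 h with h | h
  · rw [lineCutoff, Real.smoothTransition.zero_of_nonpos, zero_mul]
    rw [sub_nonpos, div_le_one hδ]; linarith
  · rw [lineCutoff, mul_comm, Real.smoothTransition.zero_of_nonpos, zero_mul]
    rw [sub_nonpos, div_le_one hδ]; linarith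

theorem lineCutoff_eq_one {s t δ r : ℝ} (hδ : 0 < δ) (h1 : s + 2 * δ ≤ r) (h2 : r ≤ t - 2 * δ) :
    lineCutoff s t δ r = 1 := by
  rw [lineCutoff, Real.smoothTransition.one_of_one_le, Real.smoothTransition.one_of_one_le, one_mul]
  · rw [le_sub_iff_add_le, le_div_iff₀ hδ]; linarith
  · rw [le_sub_iff_add_le, le_div_iff₀ hδ]; linarith

theorem deriv_lineCutoff_eq_zero {s t δ r : ℝ} (hδ : 0 < δ) (h1 : s + 2 * δ < r)
    (h2 : r < t - 2 * δ) : deriv (lineCutoff s t δ) r = 0 := by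
  have : lineCutoff s t δ =ᶠ[𝓝 r] fun _ => 1 := by
    filter_upwards [lt_mem_nhds h1, gt_mem_nhds h2] with p hp hp'
    exact lineCutoff_eq_one hδ hp.le hp'.le
  rw [this.deriv_eq, deriv_const]

theorem abs_deriv_lineCutoff_le {K : ℝ} (hK : ∀ s, |deriv Real.smoothTransition s| ≤ K)
    {δ : ℝ} (hδ : 0 < δ) (s t r : ℝ) : |deriv (lineCutoff s t δ) r| ≤ 2 * K / δ := by
  have hd : ∀ p, HasDerivAt Real.smoothTransition (deriv Real.smoothTransition p) p := fun p =>
    ((Real.smoothTransition.contDiff (n := 1)).differentiable one_ne_zero p).hasDerivAt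
  have h1 : HasDerivAt (fun r => Real.smoothTransition ((r - s) / δ - 1))
      (deriv Real.smoothTransition ((r - s) / δ - 1) * (1 / δ)) r :=
    (hd _).comp r ((((hasDerivAt_id r).sub_const s).div_const δ).sub_const 1)
  have h2 : HasDerivAt (fun r => Real.smoothTransition ((t - r) / δ - 1))
      (deriv Real.smoothTransition ((t - r) / δ - 1) * (-1 / δ)) r :=
    (hd _).comp r ((((hasDerivAt_id r).const_sub t).div_const δ).sub_const 1)
  have h3 : HasDerivAt (lineCutoff s t δ) _ r := h1.mul h2
  rw [h3.deriv]
  have hψ : ∀ p, |Real.smoothTransition p| ≤ 1 := fun p => by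
    rw [abs_of_nonneg (Real.smoothTransition.nonneg p)]; exact Real.smoothTransition.le_one p
  have e : 2 * K / δ = K * (1 / δ) * 1 + 1 * (K * (1 / δ)) := by ring
  have hK0 : 0 ≤ K := (abs_nonneg _).trans (hK 0)
  have hδ' : |1 / δ| = 1 / δ := abs_of_pos (by positivity)
  have hδ2 : |-1 / δ| = 1 / δ := by rw [neg_div, abs_neg, hδ']
  rw [e]
  refine (abs_add_le _ _).trans (add_le_add ?_ ?_)
  · rw [abs_mul, abs_mul, hδ']
    exact mul_le_mul (mul_le_mul_of_nonneg_right (hK _) (by positivity)) (hψ _) (abs_nonneg _)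
      (by positivity)
  · rw [abs_mul, abs_mul, hδ2]
    exact mul_le_mul (hψ _) (mul_le_mul_of_nonneg_right (hK _) (by positivity)) (by positivity)
      zero_le_one

/-- The tensor product of the cutoffs in the coordinate directions. -/
def boxCutoff (a b : Pt n) (δ : ℝ) (x : Pt n) : ℝ := ∏ l, lineCutoff (a l) (b l) δ (x l)

theorem contDiff_boxCutoff (a b : Pt n) (δ : ℝ) : ContDiff ℝ 1 (boxCutoff a b δ) :=
  contDiff_prod fun l _ => (contDiff_lineCutoff (a l) (b l) δ).comp (contDiff_apply ℝ ℝ l)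

theorem boxCutoff_nonneg (δ : ℝ) (x : Pt n) : 0 ≤ boxCutoff a b δ x :=
  Finset.prod_nonneg fun _ _ => lineCutoff_nonneg _ _ _ _

theorem boxCutoff_le_one (δ : ℝ) (x : Pt n) : boxCutoff a b δ x ≤ 1 :=
  Finset.prod_le_one (fun _ _ => lineCutoff_nonneg _ _ _ _) fun _ _ => lineCutoff_le_one _ _ _ _

theorem boxCutoff_eq_zero {δ : ℝ} (hδ : 0 < δ) {x : Pt n}
    (hx : x ∉ Icc (fun i => a i + δ) fun i => b i - δ) : boxCutoff a b δ x = 0 := by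
  have : ∃ i, ¬ (a i + δ ≤ x i ∧ x i ≤ b i - δ) := by
    by_contra! h
    exact hx ⟨fun i => (h i).1, fun i => (h i).2⟩
  obtain ⟨i, hi⟩ := this
  exact Finset.prod_eq_zero (Finset.mem_univ i) (lineCutoff_eq_zero hδ hi)

theorem boxCutoff_eq_one {δ : ℝ} (hδ : 0 < δ) {x : Pt n} (hx : x ∉ boundaryLayer a b (2 * δ)) :
    boxCutoff a b δ x = 1 := by
  refine Finset.prod_eq_one fun i _ => lineCutoff_eq_one hδ ?_ ?_
  · by_contra h; exact hx ⟨i, Or.inl (not_le.1 h).le⟩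
  · by_contra h; exact hx ⟨i, Or.inr (not_le.1 h).le⟩

theorem partialDeriv_boxCutoff {δ : ℝ} {x : Pt n} (hx : x ∈ paramDomain a b) (k : Fin (n + 1)) :
    partialDeriv a b k (boxCutoff a b δ) x = deriv (lineCutoff (a k) (b k) δ) (x k) *
      ∏ l ∈ Finset.univ.erase k, lineCutoff (a l) (b l) δ (x l) := by
  have h1 := hasDerivAt_partialDeriv hx
    ((contDiff_boxCutoff a b δ).differentiable one_ne_zero x) k
  have hτ : HasDerivAt (lineCutoff (a k) (b k) δ) (deriv (lineCutoff (a k) (b k) δ) (x k))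
      (x k + 0) := by
    rw [add_zero]
    exact ((contDiff_lineCutoff (a k) (b k) δ).differentiable one_ne_zero (x k)).hasDerivAt
  have h2 := (hτ.comp 0 ((hasDerivAt_id (0 : ℝ)).const_add (x k))).mul_const
    (∏ l ∈ Finset.univ.erase k, lineCutoff (a l) (b l) δ (x l))
  rw [mul_one] at h2
  refine h1.unique (h2.congr_of_eventuallyEq (Eventually.of_forall fun s => ?_))
  change boxCutoff a b δ (x + s • Pi.single k 1) = lineCutoff (a k) (b k) δ (x k + s) * _
  rw [boxCutoff, ← Finset.mul_prod_erase _ _ (Finset.mem_univ k)]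
  congr 1
  · simp
  · refine Finset.prod_congr rfl fun l hl => ?_
    simp [Finset.ne_of_mem_erase hl]

theorem sum_mul_partialDeriv_boxCutoff_eq_zero {δ : ℝ} (hδ : 0 < δ) {x : Pt n}
    (hx : x ∈ paramDomain a b) (hl : x ∉ boundaryLayer a b (2 * δ)) (v : Pt n) :
    ∑ k, v k * partialDeriv a b k (boxCutoff a b δ) x = 0 := by
  refine Finset.sum_eq_zero fun k _ => ?_
  rw [partialDeriv_boxCutoff hx, deriv_lineCutoff_eq_zero hδ, zero_mul, mul_zero]
  · by_contra h; exact hl ⟨k, Or.inl (not_lt.1 h)⟩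
  · by_contra h; exact hl ⟨k, Or.inr (not_lt.1 h)⟩

/-- Fields without flow through the boundary have bounded flow through the cutoffs. -/
theorem IsDiscreteField.exists_sum_mul_partialDeriv_boxCutoff_le (hu : IsDiscreteField F M m w u) :
    ∃ R : ℝ, 0 ≤ R ∧ ∀ δ, 0 < δ → ∀ x ∈ paramDomain a b,
      |∑ k, w x k * partialDeriv a b k (boxCutoff a b δ) x| ≤ R := by
  obtain ⟨K, hK0, hK⟩ := exists_deriv_smoothTransition_le
  choose L hL0 hL using fun k => ParamMesh.exists_lipschitz (hu.poly.continuousOn k)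
    (hu.poly.contDiffOn k)
  refine ⟨∑ k, L k * 2 * (2 * K), Finset.sum_nonneg fun k _ => by have := hL0 k; positivity,
    fun δ hδ x hx => (Finset.abs_sum_le_sum_abs _ _).trans (Finset.sum_le_sum fun k _ => ?_)⟩
  have hxI := paramDomain_subset_Icc hx
  have hLk := hL0 k
  -- `w_k` vanishes on both faces orthogonal to direction `k` and is Lipschitz, so it is bounded by
  -- the distance to either of them.
  have hface : ∀ c, c = a k ∨ c = b k → |w x k| ≤ L k * |x k - c| := by
    intro c hc
    have hcm : c ∈ Icc (a k) (b k) := by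
      rcases hc with rfl | rfl
      · exact left_mem_Icc.2 (M.bounds_lt k).le
      · exact right_mem_Icc.2 (M.bounds_lt k).le
    have hy : Function.update x k c ∈ Icc a b := by
      constructor
      · intro i
        by_cases h : i = k
        · subst h; simpa using hcm.1
        · simpa [h] using hxI.1 i
      · intro i
        by_cases h : i = k
        · subst h; simpa using hcm.2
        · simpa [h] using hxI.2 i
    have h0 : w (Function.update x k c) k = 0 := hu.bdry k _ hy (by simpa using hc)
    have h1 := hL k x hxI _ hy
    rw [h0, sub_zero] at h1
    refine h1.trans (mul_le_mul_of_nonneg_left ?_ hLk)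
    refine (pi_norm_le_iff_of_nonneg (abs_nonneg _)).2 fun i => ?_
    by_cases h : i = k
    · subst h; simp
    · simp [h]
  have hprod : |∏ l ∈ Finset.univ.erase k, lineCutoff (a l) (b l) δ (x l)| ≤ 1 := by
    rw [abs_of_nonneg (Finset.prod_nonneg fun _ _ => lineCutoff_nonneg _ _ _ _)]
    exact Finset.prod_le_one (fun _ _ => lineCutoff_nonneg _ _ _ _)
      fun _ _ => lineCutoff_le_one _ _ _ _
  rw [partialDeriv_boxCutoff hx, abs_mul, abs_mul]
  by_cases h : a k + 2 * δ < x k ∧ x k < b k - 2 * δ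
  · rw [deriv_lineCutoff_eq_zero hδ h.1 h.2, abs_zero, zero_mul, mul_zero]
    positivity
  -- The tensor product form of the cutoff makes `∂_k χ` nonzero only within `2δ` of these two
  -- faces. There the smallness of `w_k` cancels the factor `1 / δ` of the derivative.
  · have hw : |w x k| ≤ L k * (2 * δ) := by
      rcases not_and_or.1 h with h | h
      · refine (hface _ (Or.inl rfl)).trans (mul_le_mul_of_nonneg_left ?_ hLk)
        rw [abs_of_nonneg (sub_nonneg.2 (hxI.1 k))]; linarith
      · refine (hface _ (Or.inr rfl)).trans (mul_le_mul_of_nonneg_left ?_ hLk)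
        rw [abs_of_nonpos (sub_nonpos.2 (hxI.2 k))]; linarith
    calc _ ≤ L k * (2 * δ) * (2 * K / δ * 1) :=
          mul_le_mul hw (mul_le_mul (abs_deriv_lineCutoff_le hK hδ _ _ _) hprod (abs_nonneg _)
            (by positivity)) (by positivity) (by positivity)
      _ = _ := by field_simp

/-! ### Solenoidal fields against test functions -/

theorem contDiffOn_comp_test {ζ : Pt n → ℝ} (hζ : ContDiff ℝ 1 ζ)
    {J : M.Elem} (hJ : ContDiffOn ℝ 2 F (M.closedElem J)) :
    ContDiffOn ℝ 1 (fun x => ζ (F x)) (M.closedElem J) :=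
  hζ.comp_contDiffOn (hJ.of_le (by norm_num))

/-- The divergence of a solenoidal field times a cutoff, tested with `ζ`. -/
theorem integral_cutoff_mul_test (hF : RegularMap a b F)
    (hM : ∀ J : M.Elem, ContDiffOn ℝ 2 F (M.closedElem J)) (hu : IsDiscreteField F M m w u)
    (hdiv : ∀ J : M.Elem, ∀ x ∈ M.openElem J, ∑ k, partialDeriv a b k (fun z => w z k) x = 0)
    {ζ χ : Pt n → ℝ} (hζ : ContDiff ℝ 1 ζ) (hχ : ContDiff ℝ 1 χ) {σ : ℝ}
    (hσ : ∀ x ∈ Icc a b, |(jac a b F x).det| = σ * (jac a b F x).det) :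
    ∫ x in Icc a b, |(jac a b F x).det| *
        (χ x * ∑ i, fderiv ℝ ζ (F x) (Pi.single i 1) * u (F x) i) =
      -∫ x in Icc a b, σ * (ζ (F x) * ∑ k, w x k * partialDeriv a b k χ x) := by
  have hFc : ContinuousOn F (Icc a b) := hF.contDiffOn.continuousOn
  have hζd : ∀ J : M.Elem, ContDiffOn ℝ 1 (fun x => ζ (F x)) (M.closedElem J) := fun J =>
    contDiffOn_comp_test hζ (hM J)
  have hζc : ContinuousOn (fun x => ζ (F x)) (Icc a b) := hζ.continuous.comp_continuousOn hFc
  -- The test function is `(ζ ∘ F) χ`; the product rule splits the vanishing integral into the two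
  -- sides of the claim.
  have h0 := integral_sum_mul_partialDeriv_eq_zero hu hdiv (φ := fun x => ζ (F x) * χ x)
    (hζc.mul hχ.continuous.continuousOn) (fun J => (hζd J).mul hχ.contDiffOn)
  have hi : IntegrableOn (fun x => σ * (ζ (F x) * ∑ k, w x k * partialDeriv a b k χ x))
      (Icc a b) := by
    refine ((ParamMesh.PwCont.const (M := M) σ).mul ((ParamMesh.PwCont.of_continuousOn hζc).mul
      (ParamMesh.PwCont.sum fun k _ => (ParamMesh.PwCont.of_continuousOn
        (hu.poly.continuousOn k)).mul (M.pwCont_partialDeriv (fun J => hχ.contDiffOn) k)))).integrableOn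
  have hi1 : IntegrableOn (fun x => σ * ∑ k, w x k *
      partialDeriv a b k (fun x => ζ (F x) * χ x) x) (Icc a b) := by
    refine ((ParamMesh.PwCont.const (M := M) σ).mul (ParamMesh.PwCont.sum fun k _ =>
      (ParamMesh.PwCont.of_continuousOn (hu.poly.continuousOn k)).mul
        (M.pwCont_partialDeriv (fun J => (hζd J).mul hχ.contDiffOn) k))).integrableOn
  have e : ∫ x in Icc a b, |(jac a b F x).det| *
        (χ x * ∑ i, fderiv ℝ ζ (F x) (Pi.single i 1) * u (F x) i) =
      ∫ x in Icc a b, (σ * (∑ k, w x k * partialDeriv a b k (fun x => ζ (F x) * χ x) x) -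
        σ * (ζ (F x) * ∑ k, w x k * partialDeriv a b k χ x)) := by
    refine setIntegral_congr_ae measurableSet_Icc ?_
    filter_upwards [M.ae_mem_regular] with x hr hx
    have hud := hF.uniqueDiffOn x hx
    have e1 : ∀ k, partialDeriv a b k (fun z => ζ (F z)) x =
        ∑ i, fderiv ℝ ζ (F x) (Pi.single i 1) * jac a b F x i k := by
      intro k
      have h1 : HasFDerivWithinAt (fun z => ζ (F z))
          ((fderiv ℝ ζ (F x)).comp (fderivWithin ℝ F (Icc a b) x)) (Icc a b) x :=
        ((hζ.differentiable one_ne_zero (F x)).hasFDerivAt).comp_hasFDerivWithinAt x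
          (hF.hasFDerivWithinAt hx)
      rw [partialDeriv, h1.fderivWithin hud, ContinuousLinearMap.comp_apply,
        ← Finset.univ_sum_single (fderivWithin ℝ F (Icc a b) x (Pi.single k 1)), map_sum]
      refine Finset.sum_congr rfl fun i _ => ?_
      have hs : ∀ c : ℝ, (Pi.single i c : Pt n) = c • Pi.single i 1 := fun c => by
        rw [← Pi.single_smul, smul_eq_mul, mul_one]
      rw [jac_apply, hs, map_smul, smul_eq_mul, mul_comm]
    have e2 : ∀ k, partialDeriv a b k (fun x => ζ (F x) * χ x) x =
        partialDeriv a b k (fun z => ζ (F z)) x * χ x + ζ (F x) * partialDeriv a b k χ x :=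
      fun k => partialDeriv_mul hud (differentiableWithinAt_of_regular hζd hx hr)
        (hχ.differentiable one_ne_zero x).differentiableWithinAt k
    have e3 : ∀ i, |(jac a b F x).det| * u (F x) i = σ * ∑ k, jac a b F x i k * w x k := by
      intro i
      have hdet := hF.det_ne_zero x hx
      rw [hu.comp_eq i hx, hσ x hx, mul_assoc, Finset.mul_sum]
      congr 1
      refine Finset.sum_congr rfl fun k _ => ?_
      change (jac a b F x).det * ((jac a b F x).det⁻¹ * jac a b F x i k * w x k) = _
      field_simp
    have e4 : |(jac a b F x).det| * (χ x * ∑ i, fderiv ℝ ζ (F x) (Pi.single i 1) * u (F x) i) =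
        χ x * ∑ i, fderiv ℝ ζ (F x) (Pi.single i 1) * (σ * ∑ k, jac a b F x i k * w x k) := by
      simp only [← e3, Finset.mul_sum]
      exact Finset.sum_congr rfl fun i _ => by ring
    rw [e4]
    simp only [e2, e1, mul_add, Finset.sum_add_distrib, Finset.mul_sum, Finset.sum_mul]
    rw [Finset.sum_comm]
    have e5 : ∀ k, σ * (w x k * (ζ (F x) * partialDeriv a b k χ x)) =
        σ * (ζ (F x) * (w x k * partialDeriv a b k χ x)) := fun k => by ring
    simp only [e5, add_sub_cancel_right]
    exact Finset.sum_congr rfl fun k _ => Finset.sum_congr rfl fun i _ => by ring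
  rw [e, integral_sub hi1 hi, integral_const_mul, h0, mul_zero, zero_sub]

end SkelStab

end


noncomputable section

namespace SkelStab

variable {n : ℕ} {a b : Pt n} {F : Pt n → Pt n} {M : ParamMesh a b} {Λ : ℝ} {w u : Pt n → Pt n}
  {m : ℕ}

/-! ### Mollification -/

/-- Mollification with a normed bump function. -/
def mollify (φ : ContDiffBump (0 : Pt n)) (g : Pt n → ℝ) : Pt n → ℝ :=
  convolution (φ.normed volume) g (ContinuousLinearMap.lsmul ℝ ℝ) volume

theorem contDiff_mollify (φ : ContDiffBump (0 : Pt n)) {g : Pt n → ℝ} (hg : Integrable g) :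
    ContDiff ℝ ∞ (mollify φ g) :=
  φ.hasCompactSupport_normed.contDiff_convolution_left _ φ.contDiff_normed hg.locallyIntegrable

theorem abs_mollify_le (φ : ContDiffBump (0 : Pt n)) {g : Pt n → ℝ} {B : ℝ}
    (hB : ∀ q, |g q| ≤ B) (p : Pt n) : |mollify φ g p| ≤ B := by
  have h1 : ∀ᵐ t : Pt n, ‖ContinuousLinearMap.lsmul ℝ ℝ (φ.normed volume t) (g (p - t))‖ ≤
      φ.normed volume t * B := ae_of_all _ fun t => by
    rw [ContinuousLinearMap.lsmul_apply, smul_eq_mul, norm_mul, Real.norm_eq_abs,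
      abs_of_nonneg (φ.nonneg_normed t)]
    exact mul_le_mul_of_nonneg_left (hB _) (φ.nonneg_normed t)
  have h2 := norm_integral_le_of_norm_le (φ.integrable_normed.mul_const B) h1
  rwa [integral_mul_const, φ.integral_normed, one_mul] at h2

theorem hasCompactSupport_fderiv_normed (φ : ContDiffBump (0 : Pt n)) :
    HasCompactSupport (fderiv ℝ (φ.normed volume)) :=
  φ.hasCompactSupport_normed.fderiv ℝ

theorem continuous_fderiv_normed (φ : ContDiffBump (0 : Pt n)) :
    Continuous (fderiv ℝ (φ.normed volume)) :=
  (φ.contDiff_normed (n := 1)).continuous_fderiv one_ne_zero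

theorem contDiff_normed_sub (φ : ContDiffBump (0 : Pt n)) (p : Pt n) :
    ContDiff ℝ 1 fun q => φ.normed volume (p - q) :=
  φ.contDiff_normed.comp (contDiff_const.sub contDiff_id)

theorem fderiv_normed_sub (φ : ContDiffBump (0 : Pt n)) (p q v : Pt n) :
    fderiv ℝ (fun q => φ.normed volume (p - q)) q v = -fderiv ℝ (φ.normed volume) (p - q) v := by
  have h1 := ((φ.contDiff_normed (μ := volume) (n := 1)).differentiable one_ne_zero
    (p - q)).hasFDerivAt
  have h2 : HasFDerivAt (fun q : Pt n => p - q) (-ContinuousLinearMap.id ℝ (Pt n)) q :=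
    (hasFDerivAt_id q).const_sub p
  have h3 : HasFDerivAt (fun q => φ.normed volume (p - q)) _ q := h1.comp q h2
  rw [h3.fderiv]
  simp

theorem integrable_fderiv_normed_mul (φ : ContDiffBump (0 : Pt n)) {g : Pt n → ℝ}
    (hg : Integrable g) (p v : Pt n) :
    Integrable fun q => fderiv ℝ (fun q => φ.normed volume (p - q)) q v * g q := by
  have hc : Continuous fun q => fderiv ℝ (fun q => φ.normed volume (p - q)) q v :=
    ((contDiff_normed_sub φ p).continuous_fderiv one_ne_zero).clm_apply continuous_const
  obtain ⟨C, hC⟩ := (hasCompactSupport_fderiv_normed φ).exists_bound_of_continuous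
    (continuous_fderiv_normed φ)
  refine hg.bdd_mul hc.aestronglyMeasurable (c := C * ‖v‖) (ae_of_all _ fun q => ?_)
  rw [fderiv_normed_sub, norm_neg]
  exact ((fderiv ℝ (φ.normed volume) (p - q)).le_opNorm v).trans
    (mul_le_mul_of_nonneg_right (hC _) (norm_nonneg v))

/-- The derivative falls on the kernel and is rewritten as one in the integration variable, whence
the sign. The kernel thereby becomes a smooth test function of `q` for fixed `p`. -/
theorem fderiv_mollify (φ : ContDiffBump (0 : Pt n)) {g : Pt n → ℝ} (hg : Integrable g)
    (p v : Pt n) : fderiv ℝ (mollify φ g) p v =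
      -∫ q, fderiv ℝ (fun q => φ.normed volume (p - q)) q v * g q := by
  have h1 := HasCompactSupport.hasFDerivAt_convolution_left (μ := volume)
    (ContinuousLinearMap.lsmul ℝ ℝ) (φ.hasCompactSupport_normed (μ := volume)) φ.contDiff_normed
    hg.locallyIntegrable p
  have hex : ConvolutionExistsAt (fderiv ℝ (φ.normed volume)) g p
      ((ContinuousLinearMap.lsmul ℝ ℝ).precompL (Pt n)) volume :=
    (hasCompactSupport_fderiv_normed φ).convolutionExists_left _ (continuous_fderiv_normed φ)
      hg.locallyIntegrable p
  change fderiv ℝ (convolution _ _ _ _) p v = _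
  rw [h1.fderiv, convolution_eq_swap, ContinuousLinearMap.integral_apply, ← integral_neg]
  · refine integral_congr_ae (ae_of_all _ fun q => ?_)
    simp only [fderiv_normed_sub, neg_mul, neg_neg]
    rfl
  · exact ConvolutionExistsAt.integrable_swap hex

/-- Convolution enlarges the support by at most the radius of the kernel; this keeps the mollified
fields compactly supported in the open domain. -/
theorem tsupport_mollify_subset (φ : ContDiffBump (0 : Pt n)) {g : Pt n → ℝ} {K : Set (Pt n)}
    (hg : ∀ q ∉ K, g q = 0) : tsupport (mollify φ g) ⊆ Metric.cthickening φ.rOut K := by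
  refine closure_minimal (fun p hp => ?_) Metric.isClosed_cthickening
  obtain ⟨s, hs, t, ht, rfl⟩ := support_convolution_subset _ hp
  rw [φ.support_normed_eq, mem_ball_zero_iff] at hs
  have htK : t ∈ K := by
    by_contra h
    exact ht (hg t h)
  refine Metric.mem_cthickening_of_dist_le (s + t) t _ _ htK ?_
  rw [dist_eq_norm, add_sub_cancel_right]
  exact hs.le

/-! ### Solenoidal fields are orthogonal to gradients -/

/-- Continuity of a function on the physical domain can be checked in parametric coordinates. -/
theorem RegularMap.continuousOn_closedDomain (hF : RegularMap a b F) {v : Pt n → ℝ}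
    (hv : ContinuousOn (fun x => v (F x)) (Icc a b)) : ContinuousOn v (closedDomain a b F) := by
  have hm : MapsTo (Function.invFunOn F (Icc a b)) (closedDomain a b F) (Icc a b) := by
    rintro _ ⟨x, hx, rfl⟩
    rwa [hF.invFunOn_apply hx]
  refine (hv.comp hF.continuousOn_invFunOn hm).congr ?_
  rintro _ ⟨x, hx, rfl⟩
  simp only [Function.comp, hF.invFunOn_apply hx]

/-- The field `χ u` with the tensor product cutoff `χ`, extended by zero. -/
def innerField (a b : Pt n) (F u : Pt n → Pt n) (δ : ℝ) (i : Fin (n + 1)) : Pt n → ℝ :=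
  (closedDomain a b F).indicator fun q => boxCutoff a b δ (Function.invFunOn F (Icc a b) q) * u q i

theorem innerField_apply (hF : RegularMap a b F) {δ : ℝ} {i : Fin (n + 1)} {x : Pt n}
    (hx : x ∈ Icc a b) : innerField a b F u δ i (F x) = boxCutoff a b δ x * u (F x) i := by
  have hm : F x ∈ closedDomain a b F := mem_image_of_mem F hx
  rw [innerField, indicator_of_mem hm, hF.invFunOn_apply hx]

theorem innerField_eq_zero (hF : RegularMap a b F) {δ : ℝ} (hδ : 0 < δ) (i : Fin (n + 1))
    {q : Pt n} (hq : q ∉ F '' Icc (fun i => a i + δ) fun i => b i - δ) :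
    innerField a b F u δ i q = 0 := by
  by_cases h : q ∈ closedDomain a b F
  · obtain ⟨x, hx, rfl⟩ := h
    rw [innerField_apply hF hx, boxCutoff_eq_zero hδ fun hx' => hq ⟨x, hx', rfl⟩, zero_mul]
  · exact indicator_of_notMem h _

theorem integrable_innerField (hF : RegularMap a b F)
    (hc : ∀ j, ContinuousOn (fun x => u (F x) j) (Icc a b)) (δ : ℝ) (i : Fin (n + 1)) :
    Integrable (innerField a b F u δ i) := by
  refine IntegrableOn.integrable_indicator ?_ hF.isCompact_closedDomain.measurableSet
  refine ContinuousOn.integrableOn_compact hF.isCompact_closedDomain ?_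
  exact ((contDiff_boxCutoff a b δ).continuous.comp_continuousOn hF.continuousOn_invFunOn).mul
    (hF.continuousOn_closedDomain (hc i))

theorem exists_abs_innerField_le (hF : RegularMap a b F)
    (hc : ∀ j, ContinuousOn (fun x => u (F x) j) (Icc a b)) (i : Fin (n + 1)) :
    ∃ B : ℝ, ∀ δ q, |innerField a b F u δ i q| ≤ B := by
  obtain ⟨B, hB⟩ := isCompact_Icc.exists_bound_of_continuousOn (hc i)
  have hB0 : 0 ≤ B := (norm_nonneg _).trans (hB a (left_mem_Icc.2 fun i => (hF.lt i).le))
  refine ⟨B, fun δ q => ?_⟩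
  by_cases h : q ∈ closedDomain a b F
  · obtain ⟨x, hx, rfl⟩ := h
    rw [innerField_apply hF hx, abs_mul, abs_of_nonneg (boxCutoff_nonneg δ x)]
    exact (mul_le_of_le_one_left (abs_nonneg _) (boxCutoff_le_one δ x)).trans (hB x hx)
  · rw [innerField, indicator_of_notMem h, abs_zero]
    exact hB0

/-- The divergence of the mollified field. -/
theorem divergence_mollify_innerField (hF : RegularMap a b F)
    (hM : ∀ J : M.Elem, ContDiffOn ℝ 2 F (M.closedElem J)) (hu : IsDiscreteField F M m w u)
    (hdiv : ∀ J : M.Elem, ∀ x ∈ M.openElem J, ∑ k, partialDeriv a b k (fun z => w z k) x = 0)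
    {σ : ℝ} (hσ : ∀ x ∈ Icc a b, |(jac a b F x).det| = σ * (jac a b F x).det) {δ : ℝ}
    (φ : ContDiffBump (0 : Pt n)) (p : Pt n) :
    ∑ i, fderiv ℝ (mollify φ (innerField a b F u δ i)) p (Pi.single i 1) =
      ∫ x in Icc a b, σ * (φ.normed volume (p - F x) *
        ∑ k, w x k * partialDeriv a b k (boxCutoff a b δ) x) := by
  have hg := integrable_innerField hF (hu.continuousOn_comp hF) δ
  -- The test function is the kernel `q ↦ φ (p - q)`. Solenoidality of `u` across element interfaces
  -- is used here, and only the gradient of the cutoff remains.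
  have h1 := integral_cutoff_mul_test hF hM hu hdiv (contDiff_normed_sub φ p)
    (contDiff_boxCutoff a b δ) hσ
  rw [← neg_eq_iff_eq_neg] at h1
  rw [← h1]
  simp only [fderiv_mollify φ (hg _)]
  rw [Finset.sum_neg_distrib, ← integral_finsetSum _ fun i _ =>
    integrable_fderiv_normed_mul φ (hg i) p _]
  congr 1
  have h2 : ∀ q ∉ closedDomain a b F, ∑ i, fderiv ℝ (fun q => φ.normed volume (p - q)) q
      (Pi.single i 1) * innerField a b F u δ i q = 0 := fun q hq =>
    Finset.sum_eq_zero fun i _ => by rw [innerField, indicator_of_notMem hq, mul_zero]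
  rw [← setIntegral_eq_integral_of_forall_compl_eq_zero h2]
  have hae : closedDomain a b F =ᵐ[volume] domain a b F :=
    (ae_le_set.2 hF.volume_closedDomain_diff).antisymm
      RegularMap.domain_subset_closedDomain.eventuallyLE
  rw [setIntegral_congr_set hae, hF.setIntegral_domain]
  refine setIntegral_congr_fun measurableSet_Icc fun x hx => ?_
  simp only [innerField_apply hF hx, Finset.mul_sum]
  exact Finset.sum_congr rfl fun i _ => by ring

/-- The flow of `w` through the cutoff is bounded by `R`, and the kernel has integral one; `Λ` pays
for inserting the Jacobian needed to integrate it over the physical domain. The bound depends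
neither on `δ` nor on the kernel. -/
theorem abs_divergence_mollify_innerField_le (hF : RegularMap a b F) (hΛ : GeomBound a b F Λ)
    (hM : ∀ J : M.Elem, ContDiffOn ℝ 2 F (M.closedElem J)) (hu : IsDiscreteField F M m w u)
    (hdiv : ∀ J : M.Elem, ∀ x ∈ M.openElem J, ∑ k, partialDeriv a b k (fun z => w z k) x = 0)
    {R δ : ℝ} (hR0 : 0 ≤ R) (hR : ∀ x ∈ paramDomain a b,
      |∑ k, w x k * partialDeriv a b k (boxCutoff a b δ) x| ≤ R)
    (φ : ContDiffBump (0 : Pt n)) (p : Pt n) :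
    |∑ i, fderiv ℝ (mollify φ (innerField a b F u δ i)) p (Pi.single i 1)| ≤ R * Λ := by
  obtain ⟨σ, hσ1, hσ⟩ := hF.exists_sign
  rw [divergence_mollify_innerField hF hM hu hdiv hσ]
  have hΛ0 := hΛ.pos
  have hFc : ContinuousOn F (Icc a b) := hF.contDiffOn.continuousOn
  have hφc : Continuous fun q => φ.normed volume (p - q) := (contDiff_normed_sub φ p).continuous
  have hi : IntegrableOn (fun x => R * Λ * (|(jac a b F x).det| * φ.normed volume (p - F x)))
      (Icc a b) :=
    (continuousOn_const.mul (hF.continuousOn_det.abs.mul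
      (hφc.comp_continuousOn hFc))).integrableOn_compact isCompact_Icc
  have hpd : ∀ᵐ x : Pt n, x ∈ Icc a b → x ∈ paramDomain a b := by
    filter_upwards [(paramDomain_ae_eq_Icc a b).mem_iff] with x hx using hx.2
  have hσa : |σ| = 1 := by rcases hσ1 with rfl | rfl <;> simp
  rw [← Real.norm_eq_abs]
  refine (norm_integral_le_of_norm_le hi ?_).trans ?_
  · rw [ae_restrict_iff' measurableSet_Icc]
    filter_upwards [hpd] with x hp hx
    have hφ := φ.nonneg_normed (μ := volume) (p - F x)
    rw [Real.norm_eq_abs, abs_mul, abs_mul, hσa, one_mul, abs_of_nonneg hφ]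
    have h1 : 1 ≤ Λ * |(jac a b F x).det| := by
      have := mul_le_mul_of_nonneg_left (hΛ.det_lower x hx) hΛ0.le
      rwa [mul_inv_cancel₀ hΛ0.ne'] at this
    calc _ ≤ φ.normed volume (p - F x) * R := mul_le_mul_of_nonneg_left (hR x (hp hx)) hφ
      _ ≤ (Λ * |(jac a b F x).det|) * (φ.normed volume (p - F x) * R) :=
        le_mul_of_one_le_left (mul_nonneg hφ hR0) h1
      _ = _ := by ring
  · rw [integral_const_mul]
    refine mul_le_of_le_one_right (by positivity) ?_
    rw [← hF.setIntegral_domain fun q => φ.normed volume (p - q)]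
    calc _ ≤ ∫ q, φ.normed volume (p - q) :=
          setIntegral_le_integral (φ.integrable_normed.comp_sub_left p)
            (ae_of_all _ fun q => φ.nonneg_normed (μ := volume) (p - q))
      _ = 1 := by rw [integral_sub_left_eq_self (fun q => φ.normed volume q), φ.integral_normed]

/-- Points of the physical domain have neighborhoods away from the boundary layers. -/
theorem exists_ball_of_mem_domain (hF : RegularMap a b F) (hΛ : GeomBound a b F Λ) {x : Pt n}
    (hx : x ∈ paramDomain a b) : ∃ ρ : ℝ, 0 < ρ ∧ Metric.ball (F x) ρ ⊆ domain a b F ∧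
      ∀ y ∈ Icc a b, F y ∈ Metric.ball (F x) ρ → y ∉ boundaryLayer a b ρ := by
  have hΛ0 := hΛ.pos
  obtain ⟨r, hr, hball⟩ := Metric.isOpen_iff.1 hF.isOpen_domain (F x) (mem_image_of_mem F hx)
  have h1 : ∀ᶠ d : ℝ in 𝓝[>] 0, ∀ i, a i + (1 + Λ) * d < x i ∧ x i < b i - (1 + Λ) * d := by
    refine Eventually.filter_mono nhdsWithin_le_nhds (eventually_all.2 fun i => ?_)
    have t1 : Tendsto (fun d : ℝ => a i + (1 + Λ) * d) (𝓝 0) (𝓝 (a i)) :=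
      Continuous.tendsto' (by fun_prop) _ _ (by simp)
    have t2 : Tendsto (fun d : ℝ => b i - (1 + Λ) * d) (𝓝 0) (𝓝 (b i)) :=
      Continuous.tendsto' (by fun_prop) _ _ (by simp)
    exact (t1.eventually (gt_mem_nhds (hx i trivial).1)).and
      (t2.eventually (lt_mem_nhds (hx i trivial).2))
  have h2 : ∀ᶠ d : ℝ in 𝓝[>] 0, d < r := (gt_mem_nhds hr).filter_mono nhdsWithin_le_nhds
  obtain ⟨ρ, ⟨h3, h4⟩, hρ⟩ := ((h1.and h2).and self_mem_nhdsWithin).exists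
  refine ⟨ρ, hρ, (Metric.ball_subset_ball h4.le).trans hball, ?_⟩
  rintro y hy hyb ⟨i, hi⟩
  have h5 : |y i - x i| < Λ * ρ := by
    refine lt_of_le_of_lt (norm_le_pi_norm (y - x) i) ((hΛ.antilip y hy x
      (paramDomain_subset_Icc hx)).trans_lt ?_)
    rw [Metric.mem_ball, dist_eq_norm] at hyb
    exact mul_lt_mul_of_pos_left hyb hΛ0
  obtain ⟨h6, h7⟩ := abs_lt.1 h5
  rcases hi with hi | hi
  · linarith [(h3 i).1]
  · linarith [(h3 i).2]

/-- Solenoidal discrete fields are orthogonal to conservative fields. -/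
theorem l2Inner_eq_zero_of_isConservative (hF : RegularMap a b F) (hΛ : GeomBound a b F Λ)
    (hM : ∀ J : M.Elem, ContDiffOn ℝ 2 F (M.closedElem J)) (hu : IsDiscreteField F M m w u)
    (hdiv : ∀ J : M.Elem, ∀ x ∈ M.openElem J, ∑ k, partialDeriv a b k (fun z => w z k) x = 0)
    {f : Pt n → Pt n} (hf : MemLp f 2 (volume.restrict (domain a b F)))
    (hcons : IsConservative (domain a b F) f) : l2Inner a b F f u = 0 := by
  have hc := hu.continuousOn_comp hF
  have hm := hF.isOpen_domain.measurableSet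
  have : IsFiniteMeasure (volume.restrict (domain a b F)) :=
    ⟨by
      rw [Measure.restrict_apply_univ]
      exact (measure_mono RegularMap.domain_subset_closedDomain).trans_lt
        hF.isCompact_closedDomain.measure_lt_top⟩
  have hfi : ∀ i, IntegrableOn (fun p => f p i) (domain a b F) := fun i =>
    (hf.integrable one_le_two).eval i
  obtain ⟨Φ, hΦ, hweak⟩ := hcons
  have hΦi : IntegrableOn Φ (domain a b F) := hΦ.integrable one_le_two
  obtain ⟨R, hR0, hR⟩ := hu.exists_sum_mul_partialDeriv_boxCutoff_le
  choose B hB using exists_abs_innerField_le hF hc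
  obtain ⟨δ, hδ⟩ : ∃ δ : ℕ → ℝ, δ = fun j : ℕ => 1 / ((j : ℝ) + 1) := ⟨_, rfl⟩
  have hδ0 : ∀ j, 0 < δ j := fun j => by rw [hδ]; positivity
  have hδt : Tendsto δ atTop (𝓝 0) := by rw [hδ]; exact tendsto_one_div_add_atTop_nhds_zero_nat
  -- The cut field is supported in a compact subset of the open domain, which leaves room for
  -- mollification.
  have hK : ∀ j, ∃ ε : ℝ, 0 < ε ∧ Metric.cthickening ε
      (F '' Icc (fun i => a i + δ j) fun i => b i - δ j) ⊆ domain a b F := by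
    intro j
    have hsub : Icc (fun i => a i + δ j) (fun i => b i - δ j) ⊆ paramDomain a b := fun x hx i _ =>
      ⟨by linarith [hx.1 i, hδ0 j], by linarith [hx.2 i, hδ0 j]⟩
    exact (isCompact_Icc.image_of_continuousOn (hF.contDiffOn.continuousOn.mono
      (hsub.trans paramDomain_subset_Icc))).exists_cthickening_subset_open hF.isOpen_domain
        (image_mono hsub)
  choose ε hε0 hε using hK
  have hr0 : ∀ j, 0 < min (ε j) (δ j) := fun j => lt_min (hε0 j) (hδ0 j)
  -- The radius is at most `ε j`, to stay inside the domain, and at most `δ j`, to tend to zero.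
  let φ : ℕ → ContDiffBump (0 : Pt n) := fun j =>
    ⟨min (ε j) (δ j) / 2, min (ε j) (δ j), half_pos (hr0 j), half_lt_self (hr0 j)⟩
  have hφε : ∀ j, (φ j).rOut ≤ ε j := fun j => min_le_left _ _
  have hφδ : ∀ j, (φ j).rOut ≤ δ j := fun j => min_le_right _ _
  obtain ⟨g, hg⟩ : ∃ g : ℕ → Fin (n + 1) → Pt n → ℝ,
    g = fun j i => innerField a b F u (δ j) i := ⟨_, rfl⟩
  have hgi : ∀ j i, Integrable (g j i) := fun j i => by
    rw [hg]; exact integrable_innerField hF hc _ i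
  obtain ⟨D, hD⟩ : ∃ D : ℕ → Pt n → ℝ,
    D = fun j p => ∑ i, fderiv ℝ (mollify (φ j) (g j i)) p (Pi.single i 1) := ⟨_, rfl⟩
  have hVs : ∀ j i, ContDiff ℝ ∞ (mollify (φ j) (g j i)) := fun j i => contDiff_mollify _ (hgi j i)
  have hts : ∀ j i, tsupport (mollify (φ j) (g j i)) ⊆ domain a b F := fun j i => by
    refine (tsupport_mollify_subset (φ j) fun q hq => ?_).trans
      ((Metric.cthickening_mono (hφε j) _).trans (hε j))
    rw [hg]; exact innerField_eq_zero hF (hδ0 j) i hq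
  have hcs : ∀ j i, HasCompactSupport (mollify (φ j) (g j i)) := fun j i =>
    hF.isCompact_closedDomain.of_isClosed_subset (isClosed_tsupport _)
      ((hts j i).trans RegularMap.domain_subset_closedDomain)
  have hDc : ∀ j i, Continuous fun p => fderiv ℝ (mollify (φ j) (g j i)) p (Pi.single i 1) :=
    fun j i => ((hVs j i).continuous_fderiv (by simp)).clm_apply continuous_const
  have hDb : ∀ j p, |D j p| ≤ R * Λ := fun j p => by
    rw [hD, hg]
    exact abs_divergence_mollify_innerField_le hF hΛ hM hu hdiv hR0 (hR _ (hδ0 j)) (φ j) p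
  have hVb : ∀ j i p, |mollify (φ j) (g j i) p| ≤ B i := fun j i p =>
    abs_mollify_le _ (fun q => by rw [hg]; exact hB i _ q) p
  -- Around each point of the domain the cutoff is eventually identically one on a fixed ball that
  -- contains the support of the kernel centered there.
  have hnear : ∀ x ∈ paramDomain a b, ∃ ρ : ℝ, 0 < ρ ∧ Metric.ball (F x) ρ ⊆ domain a b F ∧
      ∀ᶠ j in atTop, (φ j).rOut < ρ ∧ ∀ y ∈ Icc a b, F y ∈ Metric.ball (F x) ρ →
        y ∉ boundaryLayer a b (2 * δ j) := by
    intro x hx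
    obtain ⟨ρ, hρ, hρd, hρl⟩ := exists_ball_of_mem_domain hF hΛ hx
    refine ⟨ρ, hρ, hρd, ?_⟩
    filter_upwards [hδt.eventually (gt_mem_nhds (half_pos hρ))] with j hj
    refine ⟨by linarith [hφδ j], fun y hy hyb hyl => hρl y hy hyb ?_⟩
    obtain ⟨i, hi⟩ := hyl
    exact ⟨i, hi.imp (fun h => by linarith) fun h => by linarith⟩
  have hVlim : ∀ i, ∀ p ∈ domain a b F,
      Tendsto (fun j => mollify (φ j) (g j i) p) atTop (𝓝 (u p i)) := by
    rintro i _ ⟨x, hx, rfl⟩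
    obtain ⟨ρ, hρ, hρd, hev⟩ := hnear x hx
    have hxI := paramDomain_subset_Icc hx
    have hgu : ∀ᶠ j in atTop, (φ j).rOut < ρ ∧
        ∀ q ∈ Metric.ball (F x) ρ, g j i q = u q i := by
      filter_upwards [hev] with j hj
      refine ⟨hj.1, fun q hq => ?_⟩
      obtain ⟨y, hy, rfl⟩ := hρd hq
      have hyI := paramDomain_subset_Icc hy
      rw [hg]
      simp only [innerField_apply hF hyI]
      rw [boxCutoff_eq_one (hδ0 j) (hj.2 y hyI hq), one_mul]
    have hcont : ContinuousAt (fun q => u q i) (F x) :=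
      (hF.continuousOn_closedDomain (hc i)).continuousAt (mem_of_superset
        (hF.isOpen_domain.mem_nhds (mem_image_of_mem F hx)) RegularMap.domain_subset_closedDomain)
    refine Metric.tendsto_atTop'.2 fun η hη => ?_
    obtain ⟨ρ', hρ', hball⟩ := Metric.continuousAt_iff.1 hcont (η / 2) (half_pos hη)
    have hfin : ∀ᶠ j in atTop, dist (mollify (φ j) (g j i) (F x)) (u (F x) i) < η := by
      filter_upwards [hgu, hδt.eventually (gt_mem_nhds hρ')] with j hj hjδ
      have hx0 := hj.2 (F x) (Metric.mem_ball_self hρ)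
      rw [← hx0]
      refine lt_of_le_of_lt ((φ j).dist_normed_convolution_le (μ := volume) (ε := η / 2)
        (hgi j i).aestronglyMeasurable fun q hq => ?_) (half_lt_self hη)
      rw [hx0, hj.2 q (Metric.ball_subset_ball hj.1.le hq)]
      exact (hball ((Metric.mem_ball.1 hq).trans_le ((hφδ j).trans hjδ.le))).le
    obtain ⟨N, hN⟩ := eventually_atTop.1 hfin
    exact ⟨N, fun j hj => hN j hj.le⟩
  have hDlim : ∀ p ∈ domain a b F, Tendsto (fun j => D j p) atTop (𝓝 0) := by
    rintro _ ⟨x, hx, rfl⟩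
    obtain ⟨ρ, hρ, hρd, hev⟩ := hnear x hx
    refine tendsto_const_nhds.congr' ?_
    filter_upwards [hev] with j hj
    obtain ⟨σ, -, hσ⟩ := hF.exists_sign
    rw [hD, hg]
    simp only
    rw [divergence_mollify_innerField hF hM hu hdiv hσ]
    symm
    rw [setIntegral_congr_set (paramDomain_ae_eq_Icc a b).symm]
    refine setIntegral_eq_zero_of_forall_eq_zero fun y hy => ?_
    have hyI := paramDomain_subset_Icc hy
    -- In the ball the cutoff is locally constant; outside it the kernel vanishes. So the divergence
    -- at a fixed point is eventually zero.
    by_cases hyb : F y ∈ Metric.ball (F x) ρ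
    · rw [sum_mul_partialDeriv_boxCutoff_eq_zero (hδ0 j) hy (hj.2 y hyI hyb), mul_zero, mul_zero]
    · have h0 : F x - F y ∉ Function.support ((φ j).normed volume) := by
        rw [(φ j).support_normed_eq, mem_ball_zero_iff, not_lt]
        rw [Metric.mem_ball, not_lt, dist_comm, dist_eq_norm] at hyb
        exact hj.1.le.trans hyb
      rw [Function.notMem_support.1 h0, zero_mul, mul_zero]
  have hL : Tendsto (fun j => ∑ i, ∫ p in domain a b F, f p i * mollify (φ j) (g j i) p) atTop
      (𝓝 (∑ i, ∫ p in domain a b F, f p i * u p i)) := by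
    refine tendsto_finsetSum _ fun i _ => ?_
    refine tendsto_integral_of_dominated_convergence (fun p => |f p i| * B i)
      (fun j => (hfi i).aestronglyMeasurable.mul (hVs j i).continuous.aestronglyMeasurable)
      ((hfi i).abs.mul_const _) (fun j => ae_of_all _ fun p => ?_) ?_
    · rw [Real.norm_eq_abs, abs_mul]
      exact mul_le_mul_of_nonneg_left (hVb j i p) (abs_nonneg _)
    · rw [ae_restrict_iff' hm]
      exact ae_of_all _ fun p hp => (hVlim i p hp).const_mul _
  -- Dominated convergence: the divergences are uniformly bounded and tend to zero pointwise, and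
  -- `Φ` is integrable on the bounded domain. No trace of `Φ` is needed.
  have hRt : Tendsto (fun j => -∫ p in domain a b F, Φ p * D j p) atTop (𝓝 0) := by
    have h1 : Tendsto (fun j => ∫ p in domain a b F, Φ p * D j p) atTop
        (𝓝 (∫ _p in domain a b F, (0 : ℝ))) := by
      refine tendsto_integral_of_dominated_convergence (fun p => |Φ p| * (R * Λ)) (fun j => ?_)
        (hΦi.abs.mul_const _) (fun j => ae_of_all _ fun p => ?_) ?_
      · rw [hD]
        exact hΦi.aestronglyMeasurable.mul
          (continuous_finsetSum _ fun i _ => hDc j i).aestronglyMeasurable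
      · rw [Real.norm_eq_abs, abs_mul]
        exact mul_le_mul_of_nonneg_left (hDb j p) (abs_nonneg _)
      · rw [ae_restrict_iff' hm]
        exact ae_of_all _ fun p hp => by simpa using (hDlim p hp).const_mul (Φ p)
    simpa using h1.neg
  have heq : ∀ j, ∑ i, ∫ p in domain a b F, f p i * mollify (φ j) (g j i) p =
      -∫ p in domain a b F, Φ p * D j p := by
    intro j
    have h1 : ∀ i, ∫ p in domain a b F, f p i * mollify (φ j) (g j i) p =
        -∫ p in domain a b F, Φ p * fderiv ℝ (mollify (φ j) (g j i)) p (Pi.single i 1) := fun i => by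
      rw [hweak _ (hVs j i) (hcs j i) (hts j i) i, neg_neg]
    have h2 : ∀ i, IntegrableOn
        (fun p => Φ p * fderiv ℝ (mollify (φ j) (g j i)) p (Pi.single i 1)) (domain a b F) := by
      intro i
      obtain ⟨C, hC⟩ := ((hcs j i).fderiv_apply ℝ (Pi.single i 1)).exists_bound_of_continuous
        (hDc j i)
      exact hΦi.mul_bdd (c := C) (hDc j i).aestronglyMeasurable (ae_of_all _ hC)
    simp only [h1, hD, Finset.mul_sum]
    rw [Finset.sum_neg_distrib, ← integral_finsetSum _ fun i _ => h2 i]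
  have hfin := tendsto_nhds_unique (hL.congr heq) hRt
  have hint : ∀ i, IntegrableOn (fun p => f p i * u p i) (domain a b F) := by
    intro i
    have h1 : ContinuousOn (fun q => u q i) (closedDomain a b F) :=
      hF.continuousOn_closedDomain (hc i)
    obtain ⟨C, hC⟩ := hF.isCompact_closedDomain.exists_bound_of_continuousOn h1
    refine (hfi i).mul_bdd (c := C)
      ((h1.mono RegularMap.domain_subset_closedDomain).aestronglyMeasurable hm) ?_
    rw [ae_restrict_iff' hm]
    exact ae_of_all _ fun p hp => hC p (RegularMap.domain_subset_closedDomain hp)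
  rw [← integral_finsetSum _ fun i _ => hint i] at hfin
  exact hfin

end SkelStab

end

/-! ### The energy identity and its consequences. -/

theorem mainTheorem4 {n : ℕ} (hn : 1 ≤ n) (k α : ℕ) (hα : α + 1 ≤ k)
    (a b : SkelStab.Pt n) (F : SkelStab.Pt n → SkelStab.Pt n)
    (hF : SkelStab.IsParametrization a b F α) (κ : ℝ) (hκ : 0 < κ) :
    ∃ C₀ : ℝ, 0 < C₀ ∧
      ∀ (M : SkelStab.ParamMesh a b) (h : ℝ),
        (∀ J : M.Elem, ContDiffOn ℝ ((α + 2 : ℕ) : ℕ∞) F (M.closedElem J)) →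
        M.IsQuasiUniform F κ h →
        ∀ (ν CNit : ℝ), 0 < ν → C₀ ≤ CNit →
        ∀ η : (SkelStab.Pt n → SkelStab.Pt n) → SkelStab.Pt n → SkelStab.Pt n → ℝ,
          SkelStab.IsStabParam (SkelStab.closedDomain a b F) η →
        ∀ (T : ℝ) (f u : ℝ → SkelStab.Pt n → SkelStab.Pt n),
          (∀ t ∈ Set.Ioc 0 T,
            MeasureTheory.MemLp (f t) 2
              (MeasureTheory.volume.restrict (SkelStab.domain a b F))) →
          SkelStab.IsSemidiscreteSolution a b F k α M η ν CNit h T f u →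
          (∀ t ∈ Set.Ioc 0 T,
            HasDerivWithinAt (fun s => SkelStab.energy a b F (u s))
              (-SkelStab.stabForm a b F M α η ν CNit h (u t) (u t)
                + SkelStab.l2Inner a b F (f t) (u t)) (Set.Ioc 0 T) t ∧
            -SkelStab.stabForm a b F M α η ν CNit h (u t) (u t)
                + SkelStab.l2Inner a b F (f t) (u t)
              ≤ SkelStab.l2Inner a b F (f t) (u t)) ∧
          ((∀ t ∈ Set.Ioc 0 T, ∀ x ∈ SkelStab.domain a b F, f t x = 0) →
            AntitoneOn (fun s => SkelStab.energy a b F (u s)) (Set.Ioc 0 T)) ∧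
          ((∀ t ∈ Set.Ioc 0 T,
              SkelStab.IsConservative (SkelStab.domain a b F) (f t)) →
            AntitoneOn (fun s => SkelStab.energy a b F (u s)) (Set.Ioc 0 T)) := by
  classical
  -- The constant must precede the mesh. If no mesh makes `F` piecewise smooth, the claim is
  -- vacuous; otherwise any one such mesh yields geometric bounds, and these are valid for all
  -- meshes.
  by_cases hex : ∃ M : SkelStab.ParamMesh a b,
      ∀ J : M.Elem, ContDiffOn ℝ ((α + 2 : ℕ) : ℕ∞) F (M.closedElem J)
  swap
  · exact ⟨1, one_pos, fun M h hM => absurd ⟨M, hM⟩ hex⟩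
  obtain ⟨M₀, hM₀⟩ := hex
  have hle : ((2 : ℕ∞) : WithTop ℕ∞) ≤ ((α + 2 : ℕ) : ℕ∞) := by
    exact_mod_cast Nat.le_add_left 2 α
  have hreg := hF.regularMap M₀.bounds_lt
  obtain ⟨Λ, hΛ⟩ := hreg.exists_geomBound M₀ fun J => (hM₀ J).of_le hle
  obtain ⟨ℓ, hℓ⟩ := (Set.finite_range fun i => b i - a i).bddAbove
  have hℓ' : ∀ i, b i - a i ≤ ℓ := fun i => hℓ ⟨i, rfl⟩
  have hℓ0 : 0 < ℓ := (sub_pos.2 (hreg.lt 0)).trans_le (hℓ' 0)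
  obtain ⟨C₀, hC₀, hnit⟩ :=
    -- The degree is `k + 1`, the largest degree occurring in any component and direction of the
    -- spline fields.
    SkelStab.exists_nitscheForm_self_nonneg n (k + 1) Λ ℓ κ hΛ.one_le hℓ0 hκ
  refine ⟨C₀, hC₀, fun M h hM' hq ν CNit hν hCN η hη T f u hf hsol => ?_⟩
  have hM : ∀ J : M.Elem, ContDiffOn ℝ 2 F (M.closedElem J) := fun J => (hM' J).of_le hle
  have hw : ∀ t ∈ Set.Ioc 0 T, ∃ w, SkelStab.IsDiscreteField F M (k + 1) w (u t) := fun t ht => by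
    obtain ⟨w, -, hw⟩ := SkelStab.exists_isDiscreteField hreg (hsol.mem t ht).1
    exact ⟨w, hw⟩
  have hdiv : ∀ t ∈ Set.Ioc 0 T, ∀ w, SkelStab.IsDiscreteField F M (k + 1) w (u t) →
      ∀ J : M.Elem, ∀ x ∈ M.openElem J,
        ∑ i, SkelStab.partialDeriv a b i (fun z => w z i) x = 0 := by
    intro t ht w hw J x hx
    rw [← SkelStab.det_mul_divergence hreg hM hw hx, (hsol.mem t ht).2 J x hx, mul_zero]
  have hstab : ∀ t ∈ Set.Ioc 0 T, 0 ≤ SkelStab.stabForm a b F M α η ν CNit h (u t) (u t) := by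
    intro t ht
    obtain ⟨w, hwt⟩ := hw t ht
    rw [SkelStab.stabForm, SkelStab.convectiveForm_self_eq_zero hreg hM hwt (hdiv t ht w hwt),
      add_zero]
    exact hnit hreg hΛ hM hwt hℓ' hq hη α hν hCN
  have hderiv : ∀ t ∈ Set.Ioc 0 T, HasDerivWithinAt (fun s => SkelStab.energy a b F (u s))
      (-SkelStab.stabForm a b F M α η ν CNit h (u t) (u t) + SkelStab.l2Inner a b F (f t) (u t))
      (Set.Ioc 0 T) t := by
    intro t ht
    -- The derivative of the energy is `(∂u/∂t, u)`, which the equation tested with `u t` rewrites.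
    have h1 := SkelStab.hasDerivWithinAt_energy hreg hw hsol.differentiable ht
    have h2 := hsol.equation t ht (u t) (hsol.mem t ht)
    rwa [← h2, add_comm, add_neg_cancel_right]
  have hanti : (∀ t ∈ Set.Ioc 0 T, SkelStab.l2Inner a b F (f t) (u t) = 0) →
      AntitoneOn (fun s => SkelStab.energy a b F (u s)) (Set.Ioc 0 T) := by
    intro h0
    refine antitoneOn_of_hasDerivWithinAt_nonpos (convex_Ioc 0 T)
      (fun t ht => (hderiv t ht).continuousWithinAt)
      (fun t ht => (hderiv t (interior_subset ht)).mono interior_subset) fun t ht => ?_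
    rw [h0 t (interior_subset ht), add_zero, neg_nonpos]
    exact hstab t (interior_subset ht)
  refine ⟨fun t ht => ⟨hderiv t ht, ?_⟩, fun h0 => hanti fun t ht => ?_,
    fun hcons => hanti fun t ht => ?_⟩
  · linarith [hstab t ht]
  · rw [SkelStab.l2Inner]
    refine MeasureTheory.setIntegral_eq_zero_of_forall_eq_zero fun x hx => ?_
    rw [h0 t ht x hx, zero_dotProduct]
  · obtain ⟨w, hwt⟩ := hw t ht
    exact SkelStab.l2Inner_eq_zero_of_isConservative hreg hΛ hM hwt (hdiv t ht w hwt) (hf t ht)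
      (hcons t ht)
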